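/- Let $k$ be a field. All vector spaces, tensor products and (coassociative, counital) coalgebras are over $k$, Sweedler notation $\Delta(c)=\sum c_1\otimes c_2$ is used, and the dual $C^*$ of a coalgebra $C$ is an algebra under convolution, $(pq)(c)=\sum p(c_1)q(c_2)$, with unit $\varepsilon$. A *dual quasi-bialgebra* is a coalgebra $A$ with coalgebra morphisms $A\otimes A\to A$, $a\otimes b\mapsto ab$, and $u:k\to A$, $u(1)=1$, and a convolution invertible $\varphi\in(A\otimes A\otimes A)^*$, such that for all $a,b,c,d\in A$ $$\sum a_1(b_1c_1)\,\varphi(a_2,b_2,c_2)=\sum\varphi(a_1,b_1,c_1)\,(a_2b_2)c_2,\qquad 1a=a1=a,$$ $$\sum\varphi(a_1,b_1,c_1d_1)\varphi(a_2b_2,c_2,d_2)=\sum\varphi(b_1,c_1,d_1)\varphi(a_1,b_2c_2,d_2)\varphi(a_2,b_3,c_3),\qquad \varphi(a,1,b)=\varepsilon(a)\varepsilon(b).$$ It is a *dual quasi-Hopf algebra* if moreover there are a coalgebra antimorphism $S:A\to A$ (not assumed bijective) and $\alpha,\beta\in A^*$ such that for all $a\in A$ $$\sum S(a_1)\alpha(a_2)a_3=\alpha(a)1,\qquad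 \sum a_1\beta(a_2)S(a_3)=\beta(a)1,$$ $$\sum\varphi(a_1\beta(a_2),S(a_3),\alpha(a_4)a_5)=\sum\varphi^{-1}(S(a_1),\alpha(a_2)a_3,\beta(a_4)S(a_5))=\varepsilon(a).$$ A *left* (resp. *right*) *integral* on $A$ is a $T\in A^*$ with $pT=p(1)T$ (resp. $Tp=p(1)T$) for all $p\in A^*$. A coalgebra $C$ is a left $C^*$-module by $p\rightharpoonup c=\sum p(c_2)c_1$ and a right $C^*$-module by $c\leftharpoonup p=\sum p(c_1)c_2$. It is *left* (resp. *right*) *co-Frobenius* if there is an injective morphism of left (resp. right) $C^*$-modules $C\to C^*$; *left* (resp. *right*) *quasi-co-Frobenius (QcF)* if there is an injective morphism of left (resp. right) $C^*$-modules from $C$ to a free left (resp. right) $C^*$-module; *left* (resp. *right*) *semiperfect* if the category ${}^C\mathcal M$ of left $C$-comodules (resp. $\mathcal M^C$ of right $C$-comodules) has enough projectives. **Theorem.** Let $A$ be a dual quasi-Hopf algebra. The following assertions are equivalent: 1. $A$ has a nonzero left integral; 2. $A$ is left co-Frobenius; 3. $A$ is left QcF; 4. $A$ is left semiperfect; 5.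 $A$ has a nonzero right integral; 6. $A$ is right co-Frobenius; 7. $A$ is right QcF; 8. $A$ is right semiperfect; 9. $A$, as a left comodule via $\Delta$, is a generator of ${}^A\mathcal M$; 10. $A$, as a right comodule via $\Delta$, is a generator of $\mathcal M^A$; 11. $A$, as a left comodule via $\Delta$, is a projective object of ${}^A\mathcal M$; 12. $A$, as a right comodule via $\Delta$, is a projective object of $\mathcal M^A$. -/

import Mathlib

open CategoryTheory TensorProduct

universe u

noncomputable section

namespace DualQuasi

/-! ### Convolution -/

section Convolution

variable {k C V : Type*} [CommSemiring k] [AddCommMonoid C] [Module k C] [Coalgebra k C]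
  [AddCommMonoid V] [Module k V]

/-- `c ↦ ∑ p(c₁) g(c₂)` for a functional `p` on a coalgebra `C` and a linear map `g : C → V`. -/
def convLeft (p : C →ₗ[k] k) (g : C →ₗ[k] V) : C →ₗ[k] V :=
  (TensorProduct.lid k V).toLinearMap ∘ₗ TensorProduct.map p g ∘ₗ Coalgebra.comul

/-- `c ↦ ∑ g(c₁) p(c₂)` for a functional `p` on a coalgebra `C` and a linear map `g : C → V`. -/
def convRight (g : C →ₗ[k] V) (p : C →ₗ[k] k) : C →ₗ[k] V :=
  (TensorProduct.rid k V).toLinearMap ∘ₗ TensorProduct.map g p ∘ₗ Coalgebra.comul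

theorem convLeft_repr {ι : Type*} (p : C →ₗ[k] k) (g : C →ₗ[k] V) {c : C}
    (r : Coalgebra.Repr k c ι) :
    convLeft p g c = ∑ i ∈ r.index, p (r.left i) • g (r.right i) := by
  simp [convLeft, ← r.eq]

theorem convRight_repr {ι : Type*} (g : C →ₗ[k] V) (p : C →ₗ[k] k) {c : C}
    (r : Coalgebra.Repr k c ι) :
    convRight g p c = ∑ i ∈ r.index, p (r.right i) • g (r.left i) := by
  simp [convRight, ← r.eq]

end Convolution

/-- The dual algebra `C^*` of a coalgebra `C`: linear functionals with the convolution product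
`(p * q)(c) = ∑ p(c₁) q(c₂)` and unit `ε`. -/
abbrev DualAlg (k C : Type*) [CommSemiring k] [AddCommMonoid C] [Module k C] : Type _ :=
  WithConv (C →ₗ[k] k)

/-! ### Dual quasi-bialgebras and dual quasi-Hopf algebras -/

open Coalgebra in
/-- A dual quasi-bialgebra structure on the coassociative counital coalgebra `A`. -/
class DualQuasiBialgebra (k A : Type*) [Field k] [AddCommGroup A] [Module k A]
    [Coalgebra k A] where
  /-- The multiplication, a coalgebra morphism. -/
  mul : (A ⊗[k] A) →ₗc[k] A
  /-- The unit, a coalgebra morphism. -/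
  unit : k →ₗc[k] A
  /-- The reassociator, a convolution invertible functional on `A ⊗ A ⊗ A`. -/
  reassoc : (DualAlg k (A ⊗[k] (A ⊗[k] A)))ˣ
  /-- `∑ a₁(b₁c₁) φ(a₂, b₂, c₂) = ∑ φ(a₁, b₁, c₁) (a₂b₂)c₂`. -/
  quasi_assoc :
    convRight (mul.toLinearMap ∘ₗ mul.toLinearMap.lTensor A) reassoc.val.ofConv =
      convLeft reassoc.val.ofConv
        (mul.toLinearMap ∘ₗ mul.toLinearMap.rTensor A ∘ₗ
          (TensorProduct.assoc k A A A).symm.toLinearMap)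
  one_mul : ∀ a : A, mul.toLinearMap (unit 1 ⊗ₜ[k] a) = a
  mul_one : ∀ a : A, mul.toLinearMap (a ⊗ₜ[k] unit 1) = a
  /-- `∑ φ(a₁, b₁, c₁d₁) φ(a₂b₂, c₂, d₂) = ∑ φ(b₁, c₁, d₁) φ(a₁, b₂c₂, d₂) φ(a₂, b₃, c₃)`,
  an identity between convolution products of functionals on `A ⊗ A ⊗ A ⊗ A`. -/
  cocycle :
    (WithConv.toConv (reassoc.val.ofConv ∘ₗ (mul.toLinearMap.lTensor A).lTensor A) *
        WithConv.toConv (reassoc.val.ofConv ∘ₗ mul.toLinearMap.rTensor (A ⊗[k] A) ∘ₗ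
          (TensorProduct.assoc k A A (A ⊗[k] A)).symm.toLinearMap) :
        DualAlg k (A ⊗[k] (A ⊗[k] (A ⊗[k] A)))) =
      WithConv.toConv ((TensorProduct.lid k k).toLinearMap ∘ₗ
          TensorProduct.map counit reassoc.val.ofConv) *
        WithConv.toConv (reassoc.val.ofConv ∘ₗ
          (mul.toLinearMap.rTensor A ∘ₗ
            (TensorProduct.assoc k A A A).symm.toLinearMap).lTensor A) *
        WithConv.toConv (reassoc.val.ofConv ∘ₗ
          (((TensorProduct.rid k A).toLinearMap ∘ₗ counit.lTensor A).lTensor A).lTensor A)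
  /-- `φ(a, 1, b) = ε(a) ε(b)`. -/
  reassoc_one : ∀ a b : A,
    reassoc.val.ofConv (a ⊗ₜ[k] (unit 1 ⊗ₜ[k] b)) = counit (R := k) a * counit (R := k) b

/-- The unit element `1 = u(1)` of a dual quasi-bialgebra. -/
def DualQuasiBialgebra.one (k A : Type*) [Field k] [AddCommGroup A] [Module k A]
    [Coalgebra k A] [DualQuasiBialgebra k A] : A :=
  DualQuasiBialgebra.unit (1 : k)

open Coalgebra DualQuasiBialgebra in
/-- A dual quasi-Hopf algebra structure on the coalgebra `A`. The antipode is an antimorphism of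
coalgebras; it is not required to be bijective. -/
class DualQuasiHopfAlgebra (k A : Type*) [Field k] [AddCommGroup A] [Module k A]
    [Coalgebra k A] extends DualQuasiBialgebra k A where
  /-- The antipode. -/
  antipode : A →ₗ[k] A
  α : A →ₗ[k] k
  β : A →ₗ[k] k
  counit_antipode : counit ∘ₗ antipode = (counit : A →ₗ[k] k)
  /-- `Δ(S(a)) = ∑ S(a₂) ⊗ S(a₁)`. -/
  comul_antipode : comul ∘ₗ antipode =
    (TensorProduct.comm k A A).toLinearMap ∘ₗ TensorProduct.map antipode antipode ∘ₗ comul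
  /-- `∑ S(a₁) α(a₂) a₃ = α(a) 1`. -/
  antipode_left : ∀ a : A,
    mul.toLinearMap (TensorProduct.map antipode (convLeft α LinearMap.id) (comul (R := k) a)) =
      α a • DualQuasiBialgebra.one k A
  /-- `∑ a₁ β(a₂) S(a₃) = β(a) 1`. -/
  antipode_right : ∀ a : A,
    mul.toLinearMap (TensorProduct.map LinearMap.id (convLeft β antipode) (comul (R := k) a)) =
      β a • DualQuasiBialgebra.one k A
  /-- `∑ φ(a₁ β(a₂), S(a₃), α(a₄) a₅) = ε(a)`. -/
  reassoc_antipode : ∀ a : A,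
    reassoc.val.ofConv (TensorProduct.map (convRight LinearMap.id β)
      (TensorProduct.map antipode (convLeft α LinearMap.id) ∘ₗ comul) (comul (R := k) a)) =
      counit (R := k) a
  /-- `∑ φ⁻¹(S(a₁), α(a₂) a₃, β(a₄) S(a₅)) = ε(a)`. -/
  reassoc_inv_antipode : ∀ a : A,
    reassoc.inv.ofConv (TensorProduct.map antipode
      (TensorProduct.map (convLeft α LinearMap.id) (convLeft β antipode) ∘ₗ comul)
        (comul (R := k) a)) =
      counit (R := k) a

section Integrals

variable {k A : Type*} [Field k] [AddCommGroup A] [Module k A] [Coalgebra k A]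
  [DualQuasiBialgebra k A]

/-- `T ∈ A^*` is a left integral on `A` if `p T = p(1) T` for all `p ∈ A^*`. -/
def IsLeftIntegral (T : DualAlg k A) : Prop :=
  ∀ p : DualAlg k A, p * T = p.ofConv (DualQuasiBialgebra.one k A) • T

/-- `T ∈ A^*` is a right integral on `A` if it is a left integral on `A^{op,cop}`. The convolution
product of `(A^{op,cop})^*` is the opposite of that of `A^*` and the unit element `1` is the same,
so this says that `T p = p(1) T` for all `p ∈ A^*`. -/
def IsRightIntegral (T : DualAlg k A) : Prop :=
  ∀ p : DualAlg k A, T * p = p.ofConv (DualQuasiBialgebra.one k A) • T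

end Integrals

/-! ### `C` as a left and as a right `C^*`-module -/

section DualModule

variable {k C : Type*} [Field k] [AddCommGroup C] [Module k C] [Coalgebra k C]

theorem convRight_id_mul (p q : DualAlg k C) (c : C) :
    convRight LinearMap.id (p * q).ofConv c =
      convRight LinearMap.id p.ofConv (convRight LinearMap.id q.ofConv c) := by
  let F : C ⊗[k] (C ⊗[k] C) →ₗ[k] C := (TensorProduct.rid k C).toLinearMap ∘ₗ
    (LinearMap.mul' k k ∘ₗ TensorProduct.map p.ofConv q.ofConv).lTensor C
  have h1 : convRight LinearMap.id (p * q).ofConv =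
      F ∘ₗ (Coalgebra.comul (R := k)).lTensor C ∘ₗ Coalgebra.comul := by
    have h : F ∘ₗ (Coalgebra.comul (R := k)).lTensor C =
        (TensorProduct.rid k C).toLinearMap ∘ₗ (p * q).ofConv.lTensor C := by
      simp only [F, LinearMap.comp_assoc, ← LinearMap.lTensor_comp]
      rfl
    rw [← LinearMap.comp_assoc, h]
    rfl
  have h2 : F ∘ₗ (TensorProduct.assoc k C C C).toLinearMap =
      (TensorProduct.rid k C).toLinearMap ∘ₗ (TensorProduct.map LinearMap.id p.ofConv) ∘ₗ
        (TensorProduct.rid k (C ⊗[k] C)).toLinearMap ∘ₗ q.ofConv.lTensor (C ⊗[k] C) := by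
    ext x y z
    simp [F, smul_smul, mul_comm]
  have h3 : (TensorProduct.rid k (C ⊗[k] C)).toLinearMap ∘ₗ q.ofConv.lTensor (C ⊗[k] C) ∘ₗ
      (Coalgebra.comul (R := k)).rTensor C = Coalgebra.comul ∘ₗ
        (TensorProduct.rid k C).toLinearMap ∘ₗ TensorProduct.map LinearMap.id q.ofConv := by
    ext x y
    simp
  rw [h1, ← Coalgebra.coassoc, ← LinearMap.comp_assoc, h2]
  have := fun t => LinearMap.congr_fun h3 t
  simp only [LinearMap.comp_apply] at this
  simp only [LinearMap.comp_apply, this]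
  rfl

theorem convLeft_id_mul (p q : DualAlg k C) (c : C) :
    convLeft (p * q).ofConv LinearMap.id c =
      convLeft q.ofConv LinearMap.id (convLeft p.ofConv LinearMap.id c) := by
  let F : (C ⊗[k] C) ⊗[k] C →ₗ[k] C := (TensorProduct.lid k C).toLinearMap ∘ₗ
    (LinearMap.mul' k k ∘ₗ TensorProduct.map p.ofConv q.ofConv).rTensor C
  have h1 : convLeft (p * q).ofConv LinearMap.id =
      F ∘ₗ (Coalgebra.comul (R := k)).rTensor C ∘ₗ Coalgebra.comul := by
    have h : F ∘ₗ (Coalgebra.comul (R := k)).rTensor C =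
        (TensorProduct.lid k C).toLinearMap ∘ₗ (p * q).ofConv.rTensor C := by
      simp only [F, LinearMap.comp_assoc, ← LinearMap.rTensor_comp]
      rfl
    rw [← LinearMap.comp_assoc, h]
    rfl
  have h2 : F ∘ₗ (TensorProduct.assoc k C C C).symm.toLinearMap =
      (TensorProduct.lid k C).toLinearMap ∘ₗ (TensorProduct.map q.ofConv LinearMap.id) ∘ₗ
        (TensorProduct.lid k (C ⊗[k] C)).toLinearMap ∘ₗ p.ofConv.rTensor (C ⊗[k] C) := by
    ext x y z
    simp [F, smul_smul]
  have h3 : (TensorProduct.lid k (C ⊗[k] C)).toLinearMap ∘ₗ p.ofConv.rTensor (C ⊗[k] C) ∘ₗ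
      (Coalgebra.comul (R := k)).lTensor C = Coalgebra.comul ∘ₗ
        (TensorProduct.lid k C).toLinearMap ∘ₗ TensorProduct.map p.ofConv LinearMap.id := by
    ext x y
    simp
  rw [h1, ← Coalgebra.coassoc_symm, ← LinearMap.comp_assoc, h2]
  have := fun t => LinearMap.congr_fun h3 t
  simp only [LinearMap.comp_apply] at this
  simp only [LinearMap.comp_apply, this]
  rfl

/-- `C` as a left `C^*`-module: `p ⇀ c = ∑ p(c₂) c₁`. -/
instance leftModule : Module (DualAlg k C) C where
  smul p c := convRight LinearMap.id p.ofConv c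
  one_smul c := by
    change convRight LinearMap.id (1 : DualAlg k C).ofConv c = c
    change TensorProduct.rid k C ((Coalgebra.counit (R := k)).lTensor C (Coalgebra.comul c)) = c
    simp
  mul_smul p q c := convRight_id_mul p q c
  smul_zero p := map_zero _
  smul_add p := map_add _
  add_smul p q c := by
    change convRight LinearMap.id (p + q).ofConv c =
      convRight LinearMap.id p.ofConv c + convRight LinearMap.id q.ofConv c
    simp [convRight, TensorProduct.map_add_right]
  zero_smul c := by
    change convRight LinearMap.id (0 : DualAlg k C).ofConv c = 0
    simp [convRight]

/-- `C` as a right `C^*`-module: `c ↼ p = ∑ p(c₁) c₂`. -/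
instance rightModule : Module (DualAlg k C)ᵐᵒᵖ C where
  smul p c := convLeft p.unop.ofConv LinearMap.id c
  one_smul c := by
    change TensorProduct.lid k C ((Coalgebra.counit (R := k)).rTensor C (Coalgebra.comul c)) = c
    simp
  mul_smul p q c := convLeft_id_mul q.unop p.unop c
  smul_zero p := map_zero _
  smul_add p := map_add _
  add_smul p q c := by
    change convLeft (p.unop + q.unop).ofConv LinearMap.id c =
      convLeft p.unop.ofConv LinearMap.id c + convLeft q.unop.ofConv LinearMap.id c
    simp [convLeft, TensorProduct.map_add_left]
  zero_smul c := by
    change convLeft (0 : DualAlg k C).ofConv LinearMap.id c = 0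
    simp [convLeft]

end DualModule

section CoFrobenius

variable (k C : Type u) [Field k] [AddCommGroup C] [Module k C] [Coalgebra k C]

/-- There is an injective morphism of left `C^*`-modules from `C` to `C^*`. -/
def IsLeftCoFrobenius : Prop :=
  ∃ f : C →ₗ[DualAlg k C] DualAlg k C, Function.Injective f

/-- There is an injective morphism of right `C^*`-modules from `C` to `C^*`. -/
def IsRightCoFrobenius : Prop :=
  ∃ f : C →ₗ[(DualAlg k C)ᵐᵒᵖ] DualAlg k C, Function.Injective f

/-- There is an injective morphism of left `C^*`-modules from `C` to a free left `C^*`-module. -/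
def IsLeftQcF : Prop :=
  ∃ (ι : Type u) (f : C →ₗ[DualAlg k C] (ι →₀ DualAlg k C)), Function.Injective f

/-- There is an injective morphism of right `C^*`-modules from `C` to a free right
`C^*`-module. -/
def IsRightQcF : Prop :=
  ∃ (ι : Type u) (f : C →ₗ[(DualAlg k C)ᵐᵒᵖ] (ι →₀ DualAlg k C)), Function.Injective f

end CoFrobenius

/-! ### The categories of comodules -/

/-- Left comodules over a coalgebra `C`. -/
structure LeftComod (k C : Type u) [Field k] [AddCommGroup C] [Module k C]
    [Coalgebra k C] : Type (u + 1) where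
  carrier : Type u
  [addCommGroup : AddCommGroup carrier]
  [module : Module k carrier]
  /-- The coaction `m ↦ ∑ m₍₋₁₎ ⊗ m₍₀₎`. -/
  coact : carrier →ₗ[k] C ⊗[k] carrier
  coassoc : (TensorProduct.assoc k C C carrier).toLinearMap ∘ₗ
    (Coalgebra.comul (R := k) (A := C)).rTensor carrier ∘ₗ coact = coact.lTensor C ∘ₗ coact
  counit_coact : (TensorProduct.lid k carrier).toLinearMap ∘ₗ
    (Coalgebra.counit (R := k) (A := C)).rTensor carrier ∘ₗ coact = LinearMap.id

/-- Right comodules over a coalgebra `C`. -/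
structure RightComod (k C : Type u) [Field k] [AddCommGroup C] [Module k C]
    [Coalgebra k C] : Type (u + 1) where
  carrier : Type u
  [addCommGroup : AddCommGroup carrier]
  [module : Module k carrier]
  /-- The coaction `m ↦ ∑ m₍₀₎ ⊗ m₍₁₎`. -/
  coact : carrier →ₗ[k] carrier ⊗[k] C
  coassoc : (TensorProduct.assoc k carrier C C).toLinearMap ∘ₗ coact.rTensor C ∘ₗ coact =
    (Coalgebra.comul (R := k) (A := C)).lTensor carrier ∘ₗ coact
  counit_coact : (TensorProduct.rid k carrier).toLinearMap ∘ₗ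
    (Coalgebra.counit (R := k) (A := C)).lTensor carrier ∘ₗ coact = LinearMap.id

attribute [instance] LeftComod.addCommGroup LeftComod.module
  RightComod.addCommGroup RightComod.module

section Comod

variable {k C : Type u} [Field k] [AddCommGroup C] [Module k C] [Coalgebra k C]

/-- Morphisms of left comodules: colinear maps. -/
@[ext]
structure LeftComod.Hom (M N : LeftComod k C) where
  toLinearMap : M.carrier →ₗ[k] N.carrier
  colinear : N.coact ∘ₗ toLinearMap = toLinearMap.lTensor C ∘ₗ M.coact

/-- Morphisms of right comodules: colinear maps. -/
@[ext]
structure RightComod.Hom (M N : RightComod k C) where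
  toLinearMap : M.carrier →ₗ[k] N.carrier
  colinear : N.coact ∘ₗ toLinearMap = toLinearMap.rTensor C ∘ₗ M.coact

instance : Category (LeftComod k C) where
  Hom := LeftComod.Hom
  id M := ⟨LinearMap.id, by simp⟩
  comp f g := ⟨g.toLinearMap ∘ₗ f.toLinearMap, by
    rw [← LinearMap.comp_assoc, g.colinear, LinearMap.comp_assoc, f.colinear,
      ← LinearMap.comp_assoc, LinearMap.lTensor_comp]⟩

instance : Category (RightComod k C) where
  Hom := RightComod.Hom
  id M := ⟨LinearMap.id, by simp⟩
  comp f g := ⟨g.toLinearMap ∘ₗ f.toLinearMap, by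
    rw [← LinearMap.comp_assoc, g.colinear, LinearMap.comp_assoc, f.colinear,
      ← LinearMap.comp_assoc, LinearMap.rTensor_comp]⟩

variable (k C)

/-- `C` as a left comodule over itself, via the comultiplication. -/
def LeftComod.regular : LeftComod k C where
  carrier := C
  coact := Coalgebra.comul
  coassoc := Coalgebra.coassoc
  counit_coact := by ext; simp

/-- `C` as a right comodule over itself, via the comultiplication. -/
def RightComod.regular : RightComod k C where
  carrier := C
  coact := Coalgebra.comul
  coassoc := Coalgebra.coassoc
  counit_coact := by ext; simp

/-- The category of left `C`-comodules has enough projectives. -/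
def IsLeftSemiperfect : Prop := EnoughProjectives (LeftComod k C)

/-- The category of right `C`-comodules has enough projectives. -/
def IsRightSemiperfect : Prop := EnoughProjectives (RightComod k C)

end Comod

end DualQuasi

end

/-!
Everything is computed with comatrices, the matrices `C` of coefficients of finite dimensional
comodules, with `Δ(C i j) = ∑ l, C i l ⊗ C l j`. By local finiteness of comodules
(`RightComod.exists_isCoeff`, `comatrix_ext`) linear identities need only be checked on their
entries, where convolution products become products of matrices.

In a Hopf algebra, `u ⊗ a ↦ ∑ u₀ ⊗ u₁a` identifies `U ⊗ A` with a direct sum of copies of `A`.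
Here this is corrected by the form `χ(c, a) = ∑ φ⁻¹(S(c₁), α(c₂)c₃, a)`, and the inverse by
`Ψ(c, a) = ∑ φ(c₁, β(c₂)S(c₃), a)`. The lemmas `psi_mul` and `chi_mul` express the compatibility of `Ψ`
and `χ` with the multiplication, and `chi_psi` and `psi_chi` that they are inverse to each other,
which follows from the pentagon identity and the axioms of the antipode.

These forms give the two implications on which the theorem rests.

* From a nonzero right integral `T` one builds a bilinear form `B` which is injective in its first
  variable and balanced, `∑ c₁ B(c₂, a) = ∑ B(c, a₁) a₂` (`exists_balanced_of_integral`). Such a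
  form is the same as an embedding of right `A^*`-modules `A → A^*`, so `A` is right co-Frobenius.
  For every element `m` of a right comodule it gives a colinear map `a ↦ ∑ B(m₁, a) m₀`, and these
  maps detect elements, so `A` is a generator. They also show that some finite dimensional
  comodule maps onto `k` by a map which factors through every surjection onto `k`. If it is of
  minimal dimension, it is projective (`RightComod.IsLifting.isProj_of_minimal`). As `P ⊗ M` is
  projective for projective `P` (`RightComod.IsProj.tensor`, by duality for finite dimensional `M`
  and by Zorn's lemma in general) and `A` is a direct summand of `P ⊗ A`
  (`RightComod.IsProj.isProj_reg`), the comodule `A` is projective, and every comodule `M` is a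
  quotient of the projective comodule `A ⊗ M`, where the second factor has the trivial coaction.
* Conversely, a nonzero colinear map from `A` to a finite dimensional right comodule yields a
  nonzero right integral (`exists_integral_of_isCoordinate`). A generator `A` has such a map to
  `k`, and a projective `A` has one because it embeds in a direct sum of finite dimensional
  comodules.

The connection between left and right is made by the quasi-co-Frobenius property: an embedding of
`A` in a free right `A^*`-module gives a nonzero balanced form, which in its second variable is
colinear for the left comodule structure, so that there is a nonzero left integral
(`exists_leftIntegral_of_isRightQcF`). The remaining implications for left comodules are those for
right comodules over `A^{op,cop}`, which is again a dual quasi-Hopf algebra, and whose right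
comodules are the left comodules over `A` (`toOpCop`).
-/

noncomputable section
namespace DualQuasi

/-! ### Comatrices and the structure maps of a dual quasi-bialgebra -/

section Comatrix

variable {k D E ι κ : Type*} [Field k] [AddCommGroup D] [Module k D] [Coalgebra k D]
  [AddCommGroup E] [Module k E] [Coalgebra k E] [Fintype ι] [DecidableEq ι] [Fintype κ]
  [DecidableEq κ]

/-- A comatrix over a coalgebra: `Δ(C i j) = ∑ l, C i l ⊗ C l j` and `ε(C i j) = δ i j`. These are
the matrices of coefficients of finite dimensional comodules. -/
structure IsComatrix (k : Type*) {D ι : Type*} [Field k] [AddCommGroup D] [Module k D]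
    [Coalgebra k D] [Fintype ι] [DecidableEq ι] (C : ι → ι → D) : Prop where
  comul : ∀ i j, Coalgebra.comul (R := k) (C i j) = ∑ l, C i l ⊗ₜ[k] C l j
  counit : ∀ i j, Coalgebra.counit (R := k) (C i j) = (1 : Matrix ι ι k) i j

theorem IsComatrix.map {C : ι → ι → D} (hC : IsComatrix k C) (f : D →ₗc[k] E) :
    IsComatrix k (fun i j => f (C i j)) where
  comul i j := by
    rw [← CoalgHomClass.map_comp_comul_apply, hC.comul]
    simp
  counit i j := by simp [hC.counit]

theorem IsComatrix.tmul {C : ι → ι → D} (hC : IsComatrix k C) {C' : κ → κ → E}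
    (hC' : IsComatrix k C') :
    IsComatrix k (fun (a b : ι × κ) => C a.1 b.1 ⊗ₜ[k] C' a.2 b.2) where
  comul i j := by
    simp only [TensorProduct.comul_tmul, hC.comul, hC'.comul,
      Fintype.sum_prod_type, TensorProduct.sum_tmul, TensorProduct.tmul_sum, map_sum]
    rw [Finset.sum_comm]
    rfl
  counit i j := by
    simp [hC.counit, hC'.counit, Matrix.one_apply, Prod.ext_iff, ite_and]

theorem IsComatrix.convMul {C : ι → ι → D} (hC : IsComatrix k C) (p q : DualAlg k D) :
    (.of fun i j => (p * q).ofConv (C i j)) =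
      (.of fun i j => p.ofConv (C i j) : Matrix ι ι k) * .of fun i j => q.ofConv (C i j) := by
  ext i j
  simp [LinearMap.convMul_def, hC.comul, Matrix.mul_apply]

theorem IsComatrix.convOne {C : ι → ι → D} (hC : IsComatrix k C) :
    (.of fun i j => (1 : DualAlg k D).ofConv (C i j) : Matrix ι ι k) = 1 := by
  ext i j
  simp [LinearMap.convOne_def, hC.counit]

end Comatrix

section Bialgebra

variable {k A : Type*} [Field k] [AddCommGroup A] [Module k A] [Coalgebra k A]

variable (k A) in
/-- The multiplication of a dual quasi-bialgebra as a bilinear map. -/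
def mulHom [DualQuasiBialgebra k A] : A →ₗ[k] A →ₗ[k] A :=
  TensorProduct.curry (DualQuasiBialgebra.mul (k := k) (A := A)).toLinearMap

variable (k A) in
/-- The reassociator as a trilinear form. -/
def phi [DualQuasiBialgebra k A] : A →ₗ[k] A →ₗ[k] A →ₗ[k] k :=
  TensorProduct.lcurry (.id k) A A k ∘ₗ
    TensorProduct.curry (DualQuasiBialgebra.reassoc (k := k) (A := A)).val.ofConv

variable (k A) in
/-- The convolution inverse of the reassociator as a trilinear form. -/
def phiInv [DualQuasiBialgebra k A] : A →ₗ[k] A →ₗ[k] A →ₗ[k] k :=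
  TensorProduct.lcurry (.id k) A A k ∘ₗ
    TensorProduct.curry (DualQuasiBialgebra.reassoc (k := k) (A := A)).inv.ofConv

variable [DualQuasiBialgebra k A]

theorem mulHom_apply (a b : A) :
    mulHom k A a b = (DualQuasiBialgebra.mul (k := k) (A := A)).toLinearMap (a ⊗ₜ b) := rfl

theorem phi_apply (a b c : A) :
    phi k A a b c =
      (DualQuasiBialgebra.reassoc (k := k) (A := A)).val.ofConv (a ⊗ₜ (b ⊗ₜ c)) := rfl

theorem phiInv_apply (a b c : A) :
    phiInv k A a b c =
      (DualQuasiBialgebra.reassoc (k := k) (A := A)).inv.ofConv (a ⊗ₜ (b ⊗ₜ c)) := rfl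

local notation "𝟙A" => DualQuasiBialgebra.one k A
local notation "φ" => phi k A
local notation "φ⁻" => phiInv k A

theorem one_mulHom (a : A) : mulHom k A 𝟙A a = a := DualQuasiBialgebra.one_mul a
theorem mulHom_one (a : A) : mulHom k A a 𝟙A = a := DualQuasiBialgebra.mul_one a

theorem comul_one : Coalgebra.comul (R := k) 𝟙A = 𝟙A ⊗ₜ 𝟙A := by
  have := CoalgHomClass.map_comp_comul_apply (DualQuasiBialgebra.unit (k := k) (A := A)) 1
  simpa [DualQuasiBialgebra.one] using this.symm

theorem counit_one : Coalgebra.counit (R := k) 𝟙A = 1 := by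
  simp [DualQuasiBialgebra.one]

theorem isComatrix_one : IsComatrix k (fun (_ _ : Unit) => 𝟙A) where
  comul i j := by simp [comul_one]
  counit i j := by simp [counit_one]

variable {ι κ μ ν : Type*} [Fintype ι] [DecidableEq ι] [Fintype κ]
  [DecidableEq κ] [Fintype μ] [DecidableEq μ] [Fintype ν] [DecidableEq ν]
  {X : ι → ι → A} {Y : κ → κ → A} {Z : μ → μ → A} {W : ν → ν → A}

theorem IsComatrix.mul (hX : IsComatrix k X) (hY : IsComatrix k Y) :
    IsComatrix k (fun (a b : ι × κ) => mulHom k A (X a.1 b.1) (Y a.2 b.2)) :=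
  (hX.tmul hY).map DualQuasiBialgebra.mul

theorem comul_mulHom (hX : IsComatrix k X) (hY : IsComatrix k Y) (i j p q) :
    Coalgebra.comul (R := k) (mulHom k A (X i j) (Y p q)) =
      ∑ l, ∑ r, mulHom k A (X i l) (Y p r) ⊗ₜ[k] mulHom k A (X l j) (Y r q) := by
  have := (hX.mul hY).comul (i, p) (j, q)
  simpa [Fintype.sum_prod_type] using this

/-- The matrix of a trilinear form at three comatrices. -/
def triMatrix (f : A →ₗ[k] A →ₗ[k] A →ₗ[k] k) (X : ι → ι → A) (Y : κ → κ → A)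
    (Z : μ → μ → A) : Matrix (ι × κ × μ) (ι × κ × μ) k :=
  .of fun a b => f (X a.1 b.1) (Y a.2.1 b.2.1) (Z a.2.2 b.2.2)

theorem triMatrix_phi_mul_phiInv (hX : IsComatrix k X) (hY : IsComatrix k Y)
    (hZ : IsComatrix k Z) : triMatrix (φ) X Y Z * triMatrix (φ⁻) X Y Z = 1 := by
  have h := (hX.tmul (hY.tmul hZ)).convMul
    (DualQuasiBialgebra.reassoc (k := k) (A := A)).val DualQuasiBialgebra.reassoc.inv
  rw [Units.val_inv, (hX.tmul (hY.tmul hZ)).convOne] at h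
  exact h.symm

theorem triMatrix_phiInv_mul_phi (hX : IsComatrix k X) (hY : IsComatrix k Y)
    (hZ : IsComatrix k Z) : triMatrix (φ⁻) X Y Z * triMatrix (φ) X Y Z = 1 :=
  mul_eq_one_comm.mp (triMatrix_phi_mul_phiInv hX hY hZ)

/-- `∑ a₁(b₁c₁) φ(a₂, b₂, c₂) = ∑ φ(a₁, b₁, c₁) (a₂b₂)c₂` on entries of comatrices. -/
theorem quasi_assoc_comatrix (hX : IsComatrix k X) (hY : IsComatrix k Y)
    (hZ : IsComatrix k Z) (i j p q s t) :
    ∑ a, ∑ b, ∑ c, φ (X a j) (Y b q) (Z c t) • (mulHom k A (X i a) (mulHom k A (Y p b) (Z s c)))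
     = ∑ a, ∑ b, ∑ c, φ (X i a) (Y p b) (Z s c) • (mulHom k A (mulHom k A (X a j) (Y b q)) (Z c t))
    := by
  have h := LinearMap.congr_fun (DualQuasiBialgebra.quasi_assoc (k := k) (A := A))
    (X i j ⊗ₜ (Y p q ⊗ₜ Z s t))
  have h2 := (hX.tmul (hY.tmul hZ)).comul (i, p, s) (j, q, t)
  simp only [convLeft, convRight, LinearMap.comp_apply, h2, map_sum, TensorProduct.map_tmul,
    LinearEquiv.coe_coe, TensorProduct.lid_tmul, TensorProduct.rid_tmul,
    Fintype.sum_prod_type] at h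
  exact h

theorem pentagon_comatrix (hX : IsComatrix k X) (hY : IsComatrix k Y)
    (hZ : IsComatrix k Z) (hW : IsComatrix k W) :
    ((.of fun a b => φ (X a.1 b.1) (Y a.2.1 b.2.1)
        (mulHom k A (Z a.2.2.1 b.2.2.1) (W a.2.2.2 b.2.2.2))) *
      (.of fun a b => φ (mulHom k A (X a.1 b.1) (Y a.2.1 b.2.1)) (Z a.2.2.1 b.2.2.1)
        (W a.2.2.2 b.2.2.2)) : Matrix (ι × κ × μ × ν) (ι × κ × μ × ν) k) =
    (.of fun a b => (1 : Matrix ι ι k) a.1 b.1 * φ (Y a.2.1 b.2.1) (Z a.2.2.1 b.2.2.1)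
        (W a.2.2.2 b.2.2.2)) *
    (.of fun a b => φ (X a.1 b.1) (mulHom k A (Y a.2.1 b.2.1) (Z a.2.2.1 b.2.2.1))
        (W a.2.2.2 b.2.2.2)) *
    (.of fun a b => φ (X a.1 b.1) (Y a.2.1 b.2.1) (Z a.2.2.1 b.2.2.1) *
        (1 : Matrix ν ν k) a.2.2.2 b.2.2.2) := by
  have h := congrArg (fun p => (Matrix.of fun (a b : ι × κ × μ × ν) =>
    p.ofConv (X a.1 b.1 ⊗ₜ[k] (Y a.2.1 b.2.1 ⊗ₜ[k] (Z a.2.2.1 b.2.2.1 ⊗ₜ[k] W a.2.2.2 b.2.2.2)))))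
    (DualQuasiBialgebra.cocycle (k := k) (A := A))
  have hc := hX.tmul (hY.tmul (hZ.tmul hW))
  simp only [hc.convMul] at h
  refine h.trans (congrArg₂ (· * ·) (congrArg₂ (· * ·) ?_ rfl) ?_)
  · ext a b
    simp [hX.counit, phi_apply]
  · ext a b
    simp [hW.counit, phi_apply, mul_comm]

theorem phi_one_mid (a c : A) :
    φ a 𝟙A c = Coalgebra.counit (R := k) a * Coalgebra.counit (R := k) c :=
  DualQuasiBialgebra.reassoc_one a c

end Bialgebra

end DualQuasi
end

noncomputable section
namespace DualQuasi

/-! ### Reordering finite sums -/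

section SumComm

variable {M α β γ δ ε ζ : Type*} [AddCommMonoid M] [Fintype α] [Fintype β] [Fintype γ] [Fintype δ]
  [Fintype ε] [Fintype ζ]

theorem sum_comm_two_one (f : α → β → γ → M) :
    ∑ a, ∑ b, ∑ c, f a b c = ∑ c, ∑ a, ∑ b, f a b c := by
  simp_rw [Finset.sum_comm (γ := γ)]

theorem sum_comm_three_one (f : α → β → γ → δ → M) :
    ∑ a, ∑ b, ∑ c, ∑ d, f a b c d = ∑ d, ∑ a, ∑ b, ∑ c, f a b c d := by
  simp_rw [sum_comm_two_one (γ := δ)]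
  rw [Finset.sum_comm]

theorem sum_comm_two_two (f : α → β → γ → δ → M) :
    ∑ a, ∑ b, ∑ c, ∑ d, f a b c d = ∑ c, ∑ d, ∑ a, ∑ b, f a b c d := by
  rw [sum_comm_two_one]
  exact Finset.sum_congr rfl fun c _ => sum_comm_two_one _

theorem sum_comm_two_three (f : α → β → γ → δ → ε → M) :
    ∑ a, ∑ b, ∑ c, ∑ d, ∑ e, f a b c d e = ∑ c, ∑ d, ∑ e, ∑ a, ∑ b, f a b c d e := by
  rw [sum_comm_two_one]
  exact Finset.sum_congr rfl fun c _ => sum_comm_two_two _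

theorem sum_comm_three_three (f : α → β → γ → δ → ε → ζ → M) :
    ∑ a, ∑ b, ∑ c, ∑ d, ∑ e, ∑ z, f a b c d e z = ∑ d, ∑ e, ∑ z, ∑ a, ∑ b, ∑ c, f a b c d e z := by
  rw [sum_comm_three_one]
  refine Finset.sum_congr rfl fun d _ => ?_
  rw [sum_comm_three_one]
  exact Finset.sum_congr rfl fun e _ => sum_comm_three_one _

theorem sum_comm_three_two (f : α → β → γ → δ → ε → M) :
    ∑ a, ∑ b, ∑ c, ∑ d, ∑ e, f a b c d e = ∑ d, ∑ e, ∑ a, ∑ b, ∑ c, f a b c d e :=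
  (sum_comm_two_three fun d e a b c => f a b c d e).symm

end SumComm

/-! ### Normalization of the reassociator -/

section Normalization

variable {k A : Type*} [Field k] [AddCommGroup A] [Module k A] [Coalgebra k A]
  [DualQuasiBialgebra k A]
local notation "𝟙A" => DualQuasiBialgebra.one k A
local notation "φ" => phi k A
local notation "φ⁻" => phiInv k A
variable {ι κ μ ν : Type*} [Fintype ι] [DecidableEq ι] [Fintype κ]
  [DecidableEq κ] [Fintype μ] [DecidableEq μ] [Fintype ν] [DecidableEq ν]
  {X : ι → ι → A} {Y : κ → κ → A} {Z : μ → μ → A} {W : ν → ν → A}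

theorem triMatrix_phiInv_eq_one (hX : IsComatrix k X) (hY : IsComatrix k Y)
    (hZ : IsComatrix k Z) (h : triMatrix (φ) X Y Z = 1) : triMatrix (φ⁻) X Y Z = 1 := by
  have := triMatrix_phi_mul_phiInv hX hY hZ
  rwa [h, one_mul] at this

/-- The reassociator is trivial on comatrices where it is idempotent, being invertible. -/
theorem triMatrix_phi_eq_one (hX : IsComatrix k X) (hY : IsComatrix k Y)
    (hZ : IsComatrix k Z) (h : triMatrix (φ) X Y Z = triMatrix (φ) X Y Z * triMatrix (φ) X Y Z) :
    triMatrix (φ) X Y Z = 1 := by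
  have h2 := congrArg (fun M => triMatrix (φ⁻) X Y Z * M) h
  simp only [← mul_assoc, triMatrix_phiInv_mul_phi hX hY hZ, one_mul] at h2
  exact h2.symm

theorem triMatrix_phi_one_mid (hX : IsComatrix k X) (hY : IsComatrix k Y) :
    triMatrix (φ) X (fun (_ _ : Unit) => 𝟙A) Y = 1 := by
  ext ⟨i, _, p⟩ ⟨j, _, q⟩
  simp [triMatrix, phi_one_mid, hX.counit, hY.counit, Matrix.one_apply, Prod.ext_iff, ite_and]
  split_ifs <;> rfl

/-- The reassociator is also normalized in its first argument. By the pentagon identity at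
`(1, 1, x, y)`, its restriction `φ(1, x, y)` is an invertible idempotent for the convolution. -/
theorem triMatrix_phi_one_left (hX : IsComatrix k X) (hY : IsComatrix k Y) :
    triMatrix (φ) (fun (_ _ : Unit) => 𝟙A) X Y = 1 := by
  refine triMatrix_phi_eq_one isComatrix_one hX hY ?_
  ext ⟨_, i, p⟩ ⟨_, j, q⟩
  have h := congrFun (congrFun (pentagon_comatrix isComatrix_one isComatrix_one hX hY)
    ((), (), i, p)) ((), (), j, q)
  have hc := fun i p j q => (hX.mul hY).counit (i, p) (j, q)
  simpa [Matrix.mul_apply, Fintype.sum_prod_type, triMatrix, phi_one_mid, counit_one, one_mulHom,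
    hX.counit, hc, Matrix.one_apply, ite_and] using h

/-- The reassociator is also normalized in its last argument, by the pentagon identity at
`(x, y, 1, 1)`. -/
theorem triMatrix_phi_one_right (hX : IsComatrix k X) (hY : IsComatrix k Y) :
    triMatrix (φ) X Y (fun (_ _ : Unit) => 𝟙A) = 1 := by
  refine triMatrix_phi_eq_one hX hY isComatrix_one ?_
  ext ⟨i, p, _⟩ ⟨j, q, _⟩
  have h := congrFun (congrFun (pentagon_comatrix hX hY isComatrix_one isComatrix_one)
    (i, p, (), ())) (j, q, (), ())
  have hc := fun i p j q => (hX.mul hY).counit (i, p) (j, q)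
  simpa [Matrix.mul_apply, Fintype.sum_prod_type, triMatrix, phi_one_mid, counit_one, one_mulHom,
    mulHom_one, hY.counit, hc, Matrix.one_apply, ite_and] using h

theorem phi_one_left (hX : IsComatrix k X) (hY : IsComatrix k Y) (i j p q) :
    φ 𝟙A (X i j) (Y p q) = (1 : Matrix ι ι k) i j * (1 : Matrix κ κ k) p q := by
  rw [mul_comm]
  have := congrFun (congrFun (triMatrix_phi_one_left hX hY) ((), i, p)) ((), j, q)
  simpa [triMatrix, Matrix.one_apply, ite_and] using this

theorem phiInv_one_left (hX : IsComatrix k X) (hY : IsComatrix k Y) (i j p q) :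
    φ⁻ 𝟙A (X i j) (Y p q) = (1 : Matrix ι ι k) i j * (1 : Matrix κ κ k) p q := by
  rw [mul_comm]
  have := congrFun (congrFun (triMatrix_phiInv_eq_one isComatrix_one hX hY
    (triMatrix_phi_one_left hX hY)) ((), i, p)) ((), j, q)
  simpa [triMatrix, Matrix.one_apply, ite_and] using this

theorem phiInv_one_right (hX : IsComatrix k X) (hY : IsComatrix k Y) (i j p q) :
    φ⁻ (X i j) (Y p q) 𝟙A = (1 : Matrix ι ι k) i j * (1 : Matrix κ κ k) p q := by
  rw [mul_comm]
  have := congrFun (congrFun (triMatrix_phiInv_eq_one hX hY isComatrix_one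
    (triMatrix_phi_one_right hX hY)) (i, p, ())) (j, q, ())
  simpa [triMatrix, Matrix.one_apply, ite_and] using this

theorem phiInv_one_mid (hX : IsComatrix k X) (hY : IsComatrix k Y) (i j p q) :
    φ⁻ (X i j) 𝟙A (Y p q) = (1 : Matrix ι ι k) i j * (1 : Matrix κ κ k) p q := by
  rw [mul_comm]
  have := congrFun (congrFun (triMatrix_phiInv_eq_one hX isComatrix_one hY
    (triMatrix_phi_one_mid hX hY)) (i, (), p)) (j, (), q)
  simpa [triMatrix, Matrix.one_apply, ite_and] using this

/-! ### Forms of the pentagon identity -/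

section Pentagon

variable (f : A →ₗ[k] A →ₗ[k] A →ₗ[k] k) (X Y Z W)

/-- The values of `f(x, y, zw)` at four comatrices. -/
def pentX_Y_ZW : Matrix (ι × κ × μ × ν) (ι × κ × μ × ν) k :=
  .of fun a b => f (X a.1 b.1) (Y a.2.1 b.2.1)
    (mulHom k A (Z a.2.2.1 b.2.2.1) (W a.2.2.2 b.2.2.2))

/-- The values of `f(xy, z, w)` at four comatrices. -/
def pentXY_Z_W : Matrix (ι × κ × μ × ν) (ι × κ × μ × ν) k :=
  .of fun a b => f (mulHom k A (X a.1 b.1) (Y a.2.1 b.2.1)) (Z a.2.2.1 b.2.2.1)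
    (W a.2.2.2 b.2.2.2)

/-- The values of `f(x, yz, w)` at four comatrices. -/
def pentX_YZ_W : Matrix (ι × κ × μ × ν) (ι × κ × μ × ν) k :=
  .of fun a b => f (X a.1 b.1) (mulHom k A (Y a.2.1 b.2.1) (Z a.2.2.1 b.2.2.1))
    (W a.2.2.2 b.2.2.2)

variable (ι) in
/-- The values of `ε(x) f(y, z, w)` at four comatrices. -/
def pentY_Z_W : Matrix (ι × κ × μ × ν) (ι × κ × μ × ν) k :=
  .of fun a b => (1 : Matrix ι ι k) a.1 b.1 *
    f (Y a.2.1 b.2.1) (Z a.2.2.1 b.2.2.1) (W a.2.2.2 b.2.2.2)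

variable (ν) in
/-- The values of `f(x, y, z) ε(w)` at four comatrices. -/
def pentX_Y_Z : Matrix (ι × κ × μ × ν) (ι × κ × μ × ν) k :=
  .of fun a b => f (X a.1 b.1) (Y a.2.1 b.2.1) (Z a.2.2.1 b.2.2.1) *
    (1 : Matrix ν ν k) a.2.2.2 b.2.2.2

variable {X Y Z W}

theorem pentX_Y_ZW_inv (hX : IsComatrix k X) (hY : IsComatrix k Y)
    (hZ : IsComatrix k Z) (hW : IsComatrix k W) :
    pentX_Y_ZW X Y Z W (φ) * pentX_Y_ZW X Y Z W (φ⁻) = 1 := by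
  have h (f : A →ₗ[k] A →ₗ[k] A →ₗ[k] k) : pentX_Y_ZW X Y Z W f =
      triMatrix f X Y (fun (a b : μ × ν) => mulHom k A (Z a.1 b.1) (W a.2 b.2)) := rfl
  rw [h, h]
  exact (triMatrix_phi_mul_phiInv hX hY (hZ.mul hW)).trans rfl

theorem pentXY_Z_W_inv (hX : IsComatrix k X) (hY : IsComatrix k Y)
    (hZ : IsComatrix k Z) (hW : IsComatrix k W) :
    pentXY_Z_W X Y Z W (φ) * pentXY_Z_W X Y Z W (φ⁻) = 1 := by
  let e : ι × κ × μ × ν ≃ (ι × κ) × μ × ν :=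
    (Equiv.prodAssoc ι κ (μ × ν)).symm
  have h (f : A →ₗ[k] A →ₗ[k] A →ₗ[k] k) :
      pentXY_Z_W X Y Z W f = (triMatrix f (fun (a b : ι × κ) =>
        mulHom k A (X a.1 b.1) (Y a.2 b.2)) Z W).submatrix e e := rfl
  rw [h, h, Matrix.submatrix_mul_equiv, triMatrix_phi_mul_phiInv (hX.mul hY) hZ hW,
    Matrix.submatrix_one_equiv]

theorem pentX_YZ_W_inv (hX : IsComatrix k X) (hY : IsComatrix k Y)
    (hZ : IsComatrix k Z) (hW : IsComatrix k W) :
    pentX_YZ_W X Y Z W (φ) * pentX_YZ_W X Y Z W (φ⁻) = 1 := by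
  let e : ι × κ × μ × ν ≃ ι × (κ × μ) × ν :=
    (Equiv.refl ι).prodCongr (Equiv.prodAssoc κ μ ν).symm
  have h (f : A →ₗ[k] A →ₗ[k] A →ₗ[k] k) :
      pentX_YZ_W X Y Z W f = (triMatrix f X (fun (a b : κ × μ) =>
        mulHom k A (Y a.1 b.1) (Z a.2 b.2)) W).submatrix e e := rfl
  rw [h, h, Matrix.submatrix_mul_equiv, triMatrix_phi_mul_phiInv hX (hY.mul hZ) hW,
    Matrix.submatrix_one_equiv]

open Kronecker in
theorem pentY_Z_W_inv (hY : IsComatrix k Y) (hZ : IsComatrix k Z) (hW : IsComatrix k W) :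
    pentY_Z_W ι Y Z W (φ) * pentY_Z_W ι Y Z W (φ⁻) = 1 := by
  have := Matrix.mul_kronecker_mul (1 : Matrix ι ι k) (1 : Matrix ι ι k) (triMatrix (φ) Y Z W)
    (triMatrix (φ⁻) Y Z W)
  rw [triMatrix_phi_mul_phiInv hY hZ hW, one_mul, Matrix.one_kronecker_one] at this
  exact this.symm

open Kronecker in
theorem pentX_Y_Z_inv (hX : IsComatrix k X) (hY : IsComatrix k Y) (hZ : IsComatrix k Z) :
    pentX_Y_Z ν X Y Z (φ) * pentX_Y_Z ν X Y Z (φ⁻) = 1 := by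
  let e : ι × κ × μ × ν ≃ (ι × κ × μ) × ν :=
    ((Equiv.refl ι).prodCongr (Equiv.prodAssoc κ μ ν).symm).trans (Equiv.prodAssoc ι _ _).symm
  have h (f : A →ₗ[k] A →ₗ[k] A →ₗ[k] k) :
      pentX_Y_Z ν X Y Z f = (triMatrix f X Y Z ⊗ₖ (1 : Matrix ν ν k)).submatrix e e := rfl
  rw [h, h, Matrix.submatrix_mul_equiv, ← Matrix.mul_kronecker_mul,
    triMatrix_phi_mul_phiInv hX hY hZ, one_mul, Matrix.one_kronecker_one,
    Matrix.submatrix_one_equiv]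

/-- The pentagon identity in the form
`φ⁻¹(x, y, zw) φ(y, z, w) = φ(xy, z, w) φ⁻¹(x, y, z) φ⁻¹(x, yz, w)`. The outer factors on the right
contain `xy` and `yz`, to which the axioms of the antipode apply. -/
theorem pentagon_phiInv_left (hX : IsComatrix k X) (hY : IsComatrix k Y)
    (hZ : IsComatrix k Z) (hW : IsComatrix k W) :
    pentX_Y_ZW X Y Z W (φ⁻) * pentY_Z_W ι Y Z W (φ) =
      pentXY_Z_W X Y Z W (φ) * (pentX_Y_Z ν X Y Z (φ⁻) * pentX_YZ_W X Y Z W (φ⁻)) := by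
  have h : pentX_Y_ZW X Y Z W (φ) * pentXY_Z_W X Y Z W (φ) =
      pentY_Z_W ι Y Z W (φ) * pentX_YZ_W X Y Z W (φ) * pentX_Y_Z ν X Y Z (φ) :=
    pentagon_comatrix hX hY hZ hW
  have h1 := mul_eq_one_comm.mp (pentX_Y_ZW_inv hX hY hZ hW)
  calc _ = pentX_Y_ZW X Y Z W (φ⁻) * (pentY_Z_W ι Y Z W (φ) * pentX_YZ_W X Y Z W (φ) *
        pentX_Y_Z ν X Y Z (φ)) * (pentX_Y_Z ν X Y Z (φ⁻) * pentX_YZ_W X Y Z W (φ⁻)) := by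
        simp only [mul_assoc]
        rw [← mul_assoc (pentX_Y_Z ν X Y Z (φ)), pentX_Y_Z_inv hX hY hZ, one_mul,
          pentX_YZ_W_inv hX hY hZ hW, mul_one]
    _ = _ := by
        rw [← h]
        simp only [← mul_assoc]
        rw [h1, one_mul]

/-- The pentagon identity in the form
`φ⁻¹(y, z, w) φ(x, y, zw) = φ(x, yz, w) φ(x, y, z) φ⁻¹(xy, z, w)`. -/
theorem pentagon_phiInv_right (hX : IsComatrix k X) (hY : IsComatrix k Y)
    (hZ : IsComatrix k Z) (hW : IsComatrix k W) :
    pentY_Z_W ι Y Z W (φ⁻) * pentX_Y_ZW X Y Z W (φ) =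
      pentX_YZ_W X Y Z W (φ) * (pentX_Y_Z ν X Y Z (φ) * pentXY_Z_W X Y Z W (φ⁻)) := by
  have h : pentX_Y_ZW X Y Z W (φ) * pentXY_Z_W X Y Z W (φ) =
      pentY_Z_W ι Y Z W (φ) * pentX_YZ_W X Y Z W (φ) * pentX_Y_Z ν X Y Z (φ) :=
    pentagon_comatrix hX hY hZ hW
  have h3 := mul_eq_one_comm.mp (pentY_Z_W_inv (ι := ι) hY hZ hW)
  calc _ = pentY_Z_W ι Y Z W (φ⁻) * (pentX_Y_ZW X Y Z W (φ) * pentXY_Z_W X Y Z W (φ)) *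
        pentXY_Z_W X Y Z W (φ⁻) := by
        simp only [mul_assoc]
        rw [pentXY_Z_W_inv hX hY hZ hW, mul_one]
    _ = _ := by
        rw [h]
        simp only [← mul_assoc]
        rw [h3, one_mul]

end Pentagon

end Normalization
end DualQuasi
end

noncomputable section
namespace DualQuasi

/-! ### The forms `χ` and `Ψ` -/

section Forms

variable {k A : Type*} [Field k] [AddCommGroup A] [Module k A] [Coalgebra k A]

theorem convLeft_comatrix {ι V : Type*} [Fintype ι] [DecidableEq ι] [AddCommGroup V] [Module k V]
    {C : ι → ι → A} (hC : IsComatrix k C) (p : A →ₗ[k] k) (g : A →ₗ[k] V) (i j) :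
    convLeft p g (C i j) = ∑ l, p (C i l) • g (C l j) := by
  simp [convLeft, hC.comul]

theorem convRight_comatrix {ι V : Type*} [Fintype ι] [DecidableEq ι] [AddCommGroup V] [Module k V]
    {C : ι → ι → A} (hC : IsComatrix k C) (g : A →ₗ[k] V) (p : A →ₗ[k] k) (i j) :
    convRight g p (C i j) = ∑ l, p (C l j) • g (C i l) := by
  simp [convRight, hC.comul]

/-- The transpose of the image of a comatrix under the antipode: the coefficients of the dual
comodule. -/
def antiMatrix (k : Type*) {A ι : Type*} [Field k] [AddCommGroup A] [Module k A] [Coalgebra k A]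
    [DualQuasiHopfAlgebra k A] (C : ι → ι → A) : ι → ι → A :=
  fun i j => DualQuasiHopfAlgebra.antipode (k := k) (C j i)

theorem antiMatrix_apply {ι : Type*} [DualQuasiHopfAlgebra k A] (C : ι → ι → A) (i j : ι) :
    antiMatrix k C i j = DualQuasiHopfAlgebra.antipode (k := k) (C j i) := rfl

variable [DualQuasiHopfAlgebra k A]
local notation "𝟙A" => DualQuasiBialgebra.one k A
local notation "φ" => phi k A
local notation "φ⁻" => phiInv k A
local notation "𝐒" => DualQuasiHopfAlgebra.antipode (k := k) (A := A)
local notation "𝛂" => DualQuasiHopfAlgebra.α (k := k) (A := A)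
local notation "𝛃" => DualQuasiHopfAlgebra.β (k := k) (A := A)

variable {ι κ : Type*} [Fintype ι] [DecidableEq ι] [Fintype κ] [DecidableEq κ]
  {C : ι → ι → A} {D : κ → κ → A}

theorem IsComatrix.antiMatrix (hC : IsComatrix k C) : IsComatrix k (antiMatrix k C) where
  comul i j := by
    have := LinearMap.congr_fun (DualQuasiHopfAlgebra.comul_antipode (k := k) (A := A)) (C j i)
    simp only [LinearMap.comp_apply] at this
    rw [antiMatrix_apply, this, hC.comul]
    simp [antiMatrix_apply]
  counit i j := by
    have := LinearMap.congr_fun (DualQuasiHopfAlgebra.counit_antipode (k := k) (A := A)) (C j i)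
    simp only [LinearMap.comp_apply] at this
    rw [antiMatrix_apply, this, hC.counit]
    simp [Matrix.one_apply, eq_comm]

theorem antipode_left_comatrix (hC : IsComatrix k C) (i j) :
    ∑ l, ∑ m, 𝛂 (C l m) • mulHom k A (𝐒 (C i l)) (C m j) = 𝛂 (C i j) • 𝟙A := by
  have := DualQuasiHopfAlgebra.antipode_left (k := k) (C i j)
  simpa only [hC.comul, map_sum, TensorProduct.map_tmul, convLeft_comatrix hC,
    TensorProduct.tmul_sum, TensorProduct.tmul_smul, map_smul, ← mulHom_apply,
    LinearMap.id_apply] using this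

theorem antipode_right_comatrix (hC : IsComatrix k C) (i j) :
    ∑ l, ∑ m, 𝛃 (C l m) • mulHom k A (C i l) (𝐒 (C m j)) = 𝛃 (C i j) • 𝟙A := by
  have := DualQuasiHopfAlgebra.antipode_right (k := k) (C i j)
  simpa only [hC.comul, map_sum, TensorProduct.map_tmul, convLeft_comatrix hC,
    TensorProduct.tmul_sum, TensorProduct.tmul_smul, map_smul, ← mulHom_apply,
    LinearMap.id_apply] using this

variable (k A) in
/-- The bilinear form `χ(c, a) = ∑ φ⁻¹(S(c₁), α(c₂)c₃, a)`. For a comodule `U`,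
`u ⊗ a ↦ ∑ χ(u₁, a₁) u₀ ⊗ u₂a₂` is an isomorphism from `U ⊗ A` to a direct sum of copies of `A`. -/
def chi : A →ₗ[k] A →ₗ[k] k :=
  TensorProduct.lift (φ⁻) ∘ₗ TensorProduct.map (𝐒) (convLeft (𝛂) LinearMap.id) ∘ₗ
    Coalgebra.comul

variable (k A) in
/-- The bilinear form `Ψ(c, a) = ∑ φ(c₁, β(c₂)S(c₃), a)`. For a comodule `U`,
`u ⊗ a ↦ ∑ Ψ(u₁, a₂) u₀ ⊗ S(u₂)a₁` is the inverse of the isomorphism given by `chi`. -/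
def psi : A →ₗ[k] A →ₗ[k] k :=
  TensorProduct.lift (φ) ∘ₗ TensorProduct.map LinearMap.id (convLeft (𝛃) (𝐒)) ∘ₗ
    Coalgebra.comul

theorem chi_comatrix (hC : IsComatrix k C) (i j) (a : A) :
    chi k A (C i j) a = ∑ l, ∑ m, 𝛂 (C l m) * φ⁻ (𝐒 (C i l)) (C m j) a := by
  simp [chi, hC.comul, convLeft_comatrix hC, TensorProduct.tmul_sum]

theorem psi_comatrix (hC : IsComatrix k C) (i j) (a : A) :
    psi k A (C i j) a = ∑ l, ∑ m, 𝛃 (C l m) * φ (C i l) (𝐒 (C m j)) a := by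
  simp [psi, hC.comul, convLeft_comatrix hC, TensorProduct.tmul_sum]

theorem chi_one (hC : IsComatrix k C) (i j) : chi k A (C i j) 𝟙A = 𝛂 (C i j) := by
  rw [chi_comatrix hC]
  have := fun i l m j => phiInv_one_right hC.antiMatrix hC i l m j
  simp only [antiMatrix_apply] at this
  simp [this, Matrix.one_apply]

/-- `∑ Ψ(c₁, α(c₂)c₃) = ε(c)`. -/
theorem psi_antipode (hC : IsComatrix k C) (i j) :
    ∑ l, ∑ m, 𝛂 (C l m) * psi k A (C i l) (C m j) = (1 : Matrix ι ι k) i j := by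
  have := DualQuasiHopfAlgebra.reassoc_antipode (k := k) (C i j)
  rw [hC.counit] at this
  rw [← this]
  simp only [psi_comatrix hC, hC.comul, map_sum, TensorProduct.map_tmul, LinearMap.comp_apply,
    convLeft_comatrix hC, convRight_comatrix hC, TensorProduct.tmul_sum, TensorProduct.sum_tmul,
    TensorProduct.tmul_smul, ← TensorProduct.smul_tmul', LinearMap.id_apply, Finset.mul_sum,
    ← phi_apply, map_smul, smul_eq_mul]
  rw [sum_comm_two_two, Finset.sum_comm]
  exact Finset.sum_congr rfl fun y _ => (sum_comm_two_one _).symm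

/-- `∑ φ⁻¹(S(c₁), α(c₂)c₃, β(c₄)S(c₅)) = ε(c)`. -/
theorem phiInv_antipode (hC : IsComatrix k C) (i j) :
    ∑ l, ∑ m, ∑ a, ∑ b, 𝛂 (C l m) * 𝛃 (C a b) * φ⁻ (𝐒 (C i l)) (C m a) (𝐒 (C b j)) =
      (1 : Matrix ι ι k) i j := by
  have := DualQuasiHopfAlgebra.reassoc_inv_antipode (k := k) (C i j)
  rw [hC.counit] at this
  rw [← this]
  simp only [hC.comul, map_sum, TensorProduct.map_tmul, LinearMap.comp_apply,
    convLeft_comatrix hC, TensorProduct.tmul_sum, TensorProduct.sum_tmul,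
    TensorProduct.tmul_smul, ← TensorProduct.smul_tmul', LinearMap.id_apply, Finset.mul_sum,
    ← phiInv_apply, map_smul, smul_eq_mul, mul_assoc]
  refine Finset.sum_congr rfl fun l _ => ?_
  rw [Finset.sum_comm]
  refine Finset.sum_congr rfl fun a _ => ?_
  rw [Finset.sum_comm]
  simp only [mul_left_comm]

/-- `∑ c₁(S(c₃)a₁) Ψ(c₂, a₂) = ∑ Ψ(c, a₁) a₂`. -/
theorem psi_mul (hC : IsComatrix k C) (hD : IsComatrix k D) (i j p q) :
    ∑ l, ∑ m, ∑ r, psi k A (C l m) (D r q) • mulHom k A (C i l) (mulHom k A (𝐒 (C m j)) (D p r)) =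
      ∑ r, psi k A (C i j) (D p r) • D r q := by
  have h := fun l m => quasi_assoc_comatrix hC hC.antiMatrix hD i l j m p q
  simp only [antiMatrix_apply] at h
  have h2 := Finset.sum_congr (rfl : (Finset.univ : Finset (ι × ι)) = Finset.univ)
    fun x _ => congrArg (𝛃 (C x.1 x.2) • ·) (h x.1 x.2)
  simp only [Fintype.sum_prod_type, Finset.smul_sum, smul_smul] at h2
  simp only [psi_comatrix hC, Finset.sum_smul]
  refine (sum_comm_two_three _).symm.trans (h2.trans ((sum_comm_two_three _).trans ?_))
  calc _ = ∑ a, ∑ b, ∑ c, φ (C i a) (𝐒 (C b j)) (D p c) • mulHom k A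
        (∑ l, ∑ m, 𝛃 (C l m) • mulHom k A (C a l) (𝐒 (C m b))) (D c q) := by
        simp only [map_sum, map_smul, LinearMap.sum_apply, LinearMap.smul_apply, Finset.smul_sum,
          smul_smul, mul_comm]
    _ = _ := by
        simp only [antipode_right_comatrix hC, map_smul, LinearMap.smul_apply, one_mulHom,
          smul_smul]
        rw [sum_comm_two_one]
        simp only [mul_comm]

/-- `∑ φ⁻¹(a₁, b₁, c₁) a₂(b₂c₂) = ∑ (a₁b₁)c₁ φ⁻¹(a₂, b₂, c₂)` on entries of comatrices. -/
theorem quasi_assoc_inv_comatrix {μ : Type*} [Fintype μ] [DecidableEq μ]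
    {X : ι → ι → A} {Y : κ → κ → A} {Z : μ → μ → A} (hX : IsComatrix k X)
    (hY : IsComatrix k Y) (hZ : IsComatrix k Z) (i j p q s t) :
    ∑ a, ∑ b, ∑ c, φ⁻ (X i a) (Y p b) (Z s c) • mulHom k A (X a j) (mulHom k A (Y b q) (Z c t))
     = ∑ a, ∑ b, ∑ c, φ⁻ (X a j) (Y b q) (Z c t) •
        mulHom k A (mulHom k A (X i a) (Y p b)) (Z s c) := by
  rw [← sub_eq_zero, ← Module.forall_dual_apply_eq_zero_iff k]
  intro f
  rw [map_sub, sub_eq_zero]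
  let M : Matrix (ι × κ × μ) (ι × κ × μ) k := .of fun a b =>
    f (mulHom k A (X a.1 b.1) (mulHom k A (Y a.2.1 b.2.1) (Z a.2.2 b.2.2)))
  let N : Matrix (ι × κ × μ) (ι × κ × μ) k := .of fun a b =>
    f (mulHom k A (mulHom k A (X a.1 b.1) (Y a.2.1 b.2.1)) (Z a.2.2 b.2.2))
  have h : M * triMatrix (φ) X Y Z = triMatrix (φ) X Y Z * N := by
    ext a b
    have := congrArg f (quasi_assoc_comatrix hX hY hZ a.1 b.1 a.2.1 b.2.1 a.2.2 b.2.2)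
    simp only [map_sum, map_smul, smul_eq_mul] at this
    simp only [M, N, Matrix.mul_apply, triMatrix, Fintype.sum_prod_type, Matrix.of_apply]
    simpa only [mul_comm] using this
  have h' : triMatrix (φ⁻) X Y Z * M = N * triMatrix (φ⁻) X Y Z := by
    have h1 := congrArg (fun P => triMatrix (φ⁻) X Y Z * (P * triMatrix (φ⁻) X Y Z)) h
    simp only [mul_assoc, triMatrix_phi_mul_phiInv hX hY hZ, mul_one] at h1
    rw [h1, ← mul_assoc, triMatrix_phiInv_mul_phi hX hY hZ, one_mul]
  have := congrFun (congrFun h' (i, p, s)) (j, q, t)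
  simp only [M, N, Matrix.mul_apply, triMatrix, Fintype.sum_prod_type, Matrix.of_apply] at this
  simp only [map_sum, map_smul, smul_eq_mul]
  simpa only [mul_comm] using this

/-- `∑ χ(c₂, a₁) S(c₁)(c₃a₂) = ∑ χ(c, a₂) a₁`. -/
theorem chi_mul (hC : IsComatrix k C) (hD : IsComatrix k D) (i j p q) :
    ∑ l, ∑ m, ∑ r, chi k A (C l m) (D p r) • mulHom k A (𝐒 (C i l)) (mulHom k A (C m j) (D r q)) =
      ∑ r, chi k A (C i j) (D r q) • D p r := by
  have h := fun l m => quasi_assoc_inv_comatrix hC.antiMatrix hC hD l i m j p q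
  simp only [antiMatrix_apply] at h
  have h2 := Finset.sum_congr (rfl : (Finset.univ : Finset (ι × ι)) = Finset.univ)
    fun x _ => congrArg (𝛂 (C x.1 x.2) • ·) (h x.1 x.2)
  simp only [Fintype.sum_prod_type, Finset.smul_sum, smul_smul] at h2
  simp only [chi_comatrix hC, Finset.sum_smul]
  refine (sum_comm_two_three _).symm.trans (h2.trans ((sum_comm_two_three _).trans ?_))
  calc _ = ∑ a, ∑ b, ∑ c, φ⁻ (𝐒 (C i a)) (C b j) (D c q) • mulHom k A
        (∑ l, ∑ m, 𝛂 (C l m) • mulHom k A (𝐒 (C a l)) (C m b)) (D p c) := by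
        simp only [map_sum, map_smul, LinearMap.sum_apply, LinearMap.smul_apply, Finset.smul_sum,
          smul_smul, mul_comm]
    _ = _ := by
        simp only [antipode_left_comatrix hC, map_smul, LinearMap.smul_apply, one_mulHom,
          smul_smul]
        rw [sum_comm_two_one]
        simp only [mul_comm]

/-- The outer factors of a product disappear between a row and a column vector fixed by them. -/
theorem dotProduct_three_mul {n : Type*} [Fintype n] {a b : n → k} {P Q R : Matrix n n k}
    (ha : Matrix.vecMul a P = a) (hb : R.mulVec b = b) :
    a ⬝ᵥ (P * (Q * R)).mulVec b = a ⬝ᵥ Q.mulVec b := by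
  rw [← Matrix.mulVec_mulVec, ← Matrix.mulVec_mulVec, hb, Matrix.dotProduct_mulVec, ha]

/-- `∑ χ(c₁, S(c₃)a₁) Ψ(c₂, a₂) = ε(c)ε(a)`. This is `pentagon_phiInv_left` at
`(S(c), c, S(c), a)`, contracted with `α` in the first two and with `β` in the second and third
arguments. By the axioms of the antipode, the outer factors `φ(xy, z, w)` and `φ⁻¹(x, yz, w)` are
absorbed by these contractions, and the middle factor contributes
`∑ φ⁻¹(S(c₁), α(c₂)c₃, β(c₄)S(c₅)) = ε(c)`. -/
theorem chi_psi (hC : IsComatrix k C) (hD : IsComatrix k D) (i j p q) :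
    ∑ l, ∑ m, ∑ r, chi k A (C i l) (mulHom k A (𝐒 (C m j)) (D p r)) * psi k A (C l m) (D r q) =
      (1 : Matrix ι ι k) i j * (1 : Matrix κ κ k) p q := by
  -- contraction with `α` and with `β`, as a row and a column vector
  let a : ι × ι × ι × κ → k := fun x =>
    𝛂 (C x.1 x.2.1) * ((1 : Matrix ι ι k) j x.2.2.1 * (1 : Matrix κ κ k) p x.2.2.2)
  let b : ι × ι × ι × κ → k := fun x =>
    𝛃 (C x.2.1 x.2.2.1) * ((1 : Matrix ι ι k) x.1 i * (1 : Matrix κ κ k) x.2.2.2 q)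
  have ha : Matrix.vecMul a (pentXY_Z_W (antiMatrix k C) C (antiMatrix k C) D (φ)) = a := by
    ext ⟨x, y, z, w⟩
    have h1 := congrArg (fun v => φ v (antiMatrix k C j z) (D p w)) (antipode_left_comatrix hC x y)
    simp only [map_smul, LinearMap.smul_apply, phi_one_left hC.antiMatrix hD, map_sum,
      LinearMap.sum_apply, smul_eq_mul] at h1
    simpa [a, Matrix.vecMul, dotProduct, pentXY_Z_W, Fintype.sum_prod_type, antiMatrix_apply,
      Matrix.one_apply] using h1
  have hb : (pentX_YZ_W (antiMatrix k C) C (antiMatrix k C) D (φ⁻)).mulVec b = b := by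
    ext ⟨x, y, z, w⟩
    have h1 := congrArg (fun v => φ⁻ (antiMatrix k C x i) v (D w q))
      (antipode_right_comatrix hC y z)
    simp only [map_smul, LinearMap.smul_apply, phiInv_one_mid hC.antiMatrix hD, map_sum,
      LinearMap.sum_apply, smul_eq_mul] at h1
    simpa [b, Matrix.mulVec, dotProduct, pentX_YZ_W, Fintype.sum_prod_type, antiMatrix_apply,
      Matrix.one_apply, mul_comm] using h1
  have h := congrArg (fun P => a ⬝ᵥ P.mulVec b)
    (pentagon_phiInv_left hC.antiMatrix hC hC.antiMatrix hD)
  simp only [dotProduct_three_mul ha hb] at h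
  rw [← Matrix.mulVec_mulVec, Matrix.dotProduct_mulVec] at h
  have hL : Matrix.vecMul a (pentX_Y_ZW (antiMatrix k C) C (antiMatrix k C) D (φ⁻)) = fun x =>
      chi k A (C x.1 x.2.1) (mulHom k A (𝐒 (C x.2.2.1 j)) (D p x.2.2.2)) := by
    ext x
    simp [a, Matrix.vecMul, dotProduct, pentX_Y_ZW, Fintype.sum_prod_type, antiMatrix_apply,
      Matrix.one_apply, chi_comatrix hC]
  have hR : (pentY_Z_W ι C (antiMatrix k C) D (φ)).mulVec b = fun x =>
      (1 : Matrix ι ι k) x.1 i * psi k A (C x.2.1 x.2.2.1) (D x.2.2.2 q) := by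
    ext x
    simp [b, Matrix.mulVec, dotProduct, pentY_Z_W, Fintype.sum_prod_type, antiMatrix_apply,
      Matrix.one_apply, psi_comatrix hC, mul_comm]
  have hM : a ⬝ᵥ (pentX_Y_Z κ (antiMatrix k C) C (antiMatrix k C) (φ⁻)).mulVec b =
      (1 : Matrix ι ι k) i j * (1 : Matrix κ κ k) p q := by
    rw [← phiInv_antipode hC]
    simp [a, b, Matrix.mulVec, dotProduct, pentX_Y_Z, Fintype.sum_prod_type, antiMatrix_apply,
      Matrix.one_apply]
    simp only [Finset.mul_sum, mul_assoc, mul_comm (𝛃 _)]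
  rw [hL, hR, hM] at h
  rw [← h]
  simp [dotProduct, Fintype.sum_prod_type, Matrix.one_apply]

/-- `∑ Ψ(c₁, c₃a₂) χ(c₂, a₁) = ε(c)ε(a)`. This is `pentagon_phiInv_right` at `(c, S(c), c, a)`,
contracted with `β` in the first two and with `α` in the second and third arguments, as in
`chi_psi`. -/
theorem psi_chi (hC : IsComatrix k C) (hD : IsComatrix k D) (i j p q) :
    ∑ l, ∑ m, ∑ r, chi k A (C l m) (D p r) * psi k A (C i l) (mulHom k A (C m j) (D r q)) =
      (1 : Matrix ι ι k) i j * (1 : Matrix κ κ k) p q := by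
  -- contraction with `α` and with `β`, as a row and a column vector
  let a : ι × ι × ι × κ → k := fun x =>
    𝛂 (C x.2.1 x.2.2.1) * ((1 : Matrix ι ι k) i x.1 * (1 : Matrix κ κ k) p x.2.2.2)
  let b : ι × ι × ι × κ → k := fun x =>
    𝛃 (C x.1 x.2.1) * ((1 : Matrix ι ι k) x.2.2.1 j * (1 : Matrix κ κ k) x.2.2.2 q)
  have ha : Matrix.vecMul a (pentX_YZ_W C (antiMatrix k C) C D (φ)) = a := by
    ext ⟨x, y, z, w⟩
    have h1 := congrArg (fun v => φ (C i x) v (D p w)) (antipode_left_comatrix hC y z)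
    simp only [map_smul, LinearMap.smul_apply, phi_one_mid, hC.counit, hD.counit, map_sum,
      LinearMap.sum_apply, smul_eq_mul] at h1
    simpa [a, Matrix.vecMul, dotProduct, pentX_YZ_W, Fintype.sum_prod_type, antiMatrix_apply,
      Matrix.one_apply] using h1
  have hb : (pentXY_Z_W C (antiMatrix k C) C D (φ⁻)).mulVec b = b := by
    ext ⟨x, y, z, w⟩
    have h1 := congrArg (fun v => φ⁻ v (C z j) (D w q)) (antipode_right_comatrix hC x y)
    simp only [map_smul, LinearMap.smul_apply, phiInv_one_left hC hD, map_sum,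
      LinearMap.sum_apply, smul_eq_mul] at h1
    simpa [b, Matrix.mulVec, dotProduct, pentXY_Z_W, Fintype.sum_prod_type, antiMatrix_apply,
      Matrix.one_apply, mul_comm] using h1
  have h := congrArg (fun P => a ⬝ᵥ P.mulVec b) (pentagon_phiInv_right hC hC.antiMatrix hC hD)
  simp only [dotProduct_three_mul ha hb] at h
  rw [← Matrix.mulVec_mulVec, Matrix.dotProduct_mulVec] at h
  have hL : Matrix.vecMul a (pentY_Z_W ι (antiMatrix k C) C D (φ⁻)) = fun x =>
      (1 : Matrix ι ι k) i x.1 * chi k A (C x.2.1 x.2.2.1) (D p x.2.2.2) := by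
    ext x
    simp [a, Matrix.vecMul, dotProduct, pentY_Z_W, Fintype.sum_prod_type, antiMatrix_apply,
      Matrix.one_apply, chi_comatrix hC]
  have hR : (pentX_Y_ZW C (antiMatrix k C) C D (φ)).mulVec b = fun x =>
      psi k A (C x.1 x.2.1) (mulHom k A (C x.2.2.1 j) (D x.2.2.2 q)) := by
    ext x
    simp [b, Matrix.mulVec, dotProduct, pentX_Y_ZW, Fintype.sum_prod_type, antiMatrix_apply,
      Matrix.one_apply, psi_comatrix hC, mul_comm]
  have hM : a ⬝ᵥ (pentX_Y_Z κ C (antiMatrix k C) C (φ)).mulVec b =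
      (1 : Matrix ι ι k) i j * (1 : Matrix κ κ k) p q := by
    rw [← psi_antipode hC]
    simp [a, b, Matrix.mulVec, dotProduct, pentX_Y_Z, Fintype.sum_prod_type, antiMatrix_apply,
      Matrix.one_apply, psi_comatrix hC]
    simp only [Finset.mul_sum, mul_comm (𝛃 _)]
  rw [hL, hR, hM] at h
  rw [← h]
  simp [dotProduct, Fintype.sum_prod_type, Matrix.one_apply]

end Forms
end DualQuasi
end

noncomputable section
namespace DualQuasi

/-! ### Right comodules and their coefficients -/

section Slice

variable {k A V W : Type*} [Field k] [AddCommGroup A] [Module k A] [AddCommGroup V] [Module k V]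
  [AddCommGroup W] [Module k W]

/-- `v ⊗ a ↦ p(a) v`. -/
def slice (V : Type*) [AddCommGroup V] [Module k V] (p : A →ₗ[k] k) : V ⊗[k] A →ₗ[k] V :=
  (TensorProduct.rid k V).toLinearMap ∘ₗ p.lTensor V

@[simp]
theorem slice_tmul (p : A →ₗ[k] k) (v : V) (a : A) : slice V p (v ⊗ₜ a) = p a • v := by
  simp [slice]

theorem slice_rTensor (p : A →ₗ[k] k) (f : V →ₗ[k] W) (x : V ⊗[k] A) :
    slice W p (f.rTensor A x) = f (slice V p x) := by
  have : slice W p ∘ₗ f.rTensor A = f ∘ₗ slice V p := by ext; simp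
  exact LinearMap.congr_fun this x

/-- Functionals on `A` separate the elements of `V ⊗ A`. -/
theorem slice_ext {x y : V ⊗[k] A} (h : ∀ p, slice V p x = slice V p y) : x = y := by
  classical
  let b := Module.Basis.ofVectorSpace k A
  refine (TensorProduct.equivFinsuppOfBasisRight (M := V) b).injective (Finsupp.ext fun i => ?_)
  rw [TensorProduct.equivFinsuppOfBasisRight_apply, TensorProduct.equivFinsuppOfBasisRight_apply]
  exact h (b.coord i)

/-- An element of `V ⊗ A` all of whose slices lie in `N` comes from `N ⊗ A`. -/
theorem mem_range_rTensor {N : Submodule k V} {x : V ⊗[k] A} (h : ∀ p, slice V p x ∈ N) :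
    x ∈ LinearMap.range (N.subtype.rTensor A) := by
  rw [← rTensor_mkQ, LinearMap.mem_ker]
  refine slice_ext fun p => ?_
  rw [slice_rTensor, map_zero]
  simpa using h p

theorem exists_tmul_basis {ι : Type*} [Fintype ι] (b : Module.Basis ι k V) (x : V ⊗[k] A) :
    ∃ a : ι → A, x = ∑ i, b i ⊗ₜ a i := by
  induction x with
  | zero => exact ⟨0, by simp⟩
  | tmul v a =>
    refine ⟨fun i => b.repr v i • a, ?_⟩
    simp_rw [TensorProduct.tmul_smul, TensorProduct.smul_tmul', ← TensorProduct.sum_tmul,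
      b.sum_repr]
  | add x y hx hy =>
    obtain ⟨a, rfl⟩ := hx
    obtain ⟨a', rfl⟩ := hy
    exact ⟨a + a', by simp [TensorProduct.tmul_add, Finset.sum_add_distrib]⟩

theorem tmul_left_injective {ι : Type*} [Fintype ι] [DecidableEq ι] {e : ι → V}
    (he : LinearIndependent k e) {x y : ι → W} (h : ∑ i, e i ⊗ₜ[k] x i = ∑ i, e i ⊗ₜ[k] y i) :
    x = y := by
  obtain ⟨g, hg⟩ := (Fintype.linearCombination k e).exists_leftInverse_of_injective
    (by
      rw [LinearMap.ker_eq_bot]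
      exact linearIndependent_iff_injective_fintypeLinearCombination.mp he)
  have hge (i) : g (e i) = Pi.single i 1 := by
    have := LinearMap.congr_fun hg (Pi.single i 1)
    simpa [Fintype.linearCombination_apply, Pi.single_apply] using this
  ext j
  have := congrArg (TensorProduct.lid k W ∘ (LinearMap.proj j ∘ₗ g).rTensor W) h
  simpa [hge, Pi.single_apply] using this

end Slice

variable {k A : Type u} [Field k] [AddCommGroup A] [Module k A] [Coalgebra k A]

namespace RightComod

variable (M N P : RightComod k A)

/-- The action `p ⇀ m = ∑ p(m₁) m₀` of functionals on a right comodule. -/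
def act (p : A →ₗ[k] k) : M.carrier →ₗ[k] M.carrier := slice M.carrier p ∘ₗ M.coact

variable {M N P}

theorem act_act (p q : A →ₗ[k] k) (m : M.carrier) :
    M.act p (M.act q m) = M.act (WithConv.toConv p * WithConv.toConv q : DualAlg k A).ofConv m := by
  let F : M.carrier ⊗[k] (A ⊗[k] A) →ₗ[k] M.carrier :=
    (TensorProduct.rid k M.carrier).toLinearMap ∘ₗ
      (LinearMap.mul' k k ∘ₗ TensorProduct.map p q).lTensor M.carrier
  have h1 : slice M.carrier p ∘ₗ M.coact ∘ₗ slice M.carrier q =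
      F ∘ₗ (TensorProduct.assoc k M.carrier A A).toLinearMap ∘ₗ M.coact.rTensor A := by
    have h2 : F ∘ₗ (TensorProduct.assoc k M.carrier A A).toLinearMap =
        slice M.carrier p ∘ₗ slice (M.carrier ⊗[k] A) q := by
      ext
      simp [F, smul_smul, mul_comm]
    refine LinearMap.ext fun x => Eq.trans ?_ (LinearMap.congr_fun h2 (M.coact.rTensor A x)).symm
    simp only [LinearMap.comp_apply, slice_rTensor]
  have h3 : F ∘ₗ (Coalgebra.comul (R := k)).lTensor M.carrier =
      slice M.carrier (WithConv.toConv p * WithConv.toConv q : DualAlg k A).ofConv := by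
    simp only [F, slice, LinearMap.comp_assoc, ← LinearMap.lTensor_comp]
    rfl
  have h4 := LinearMap.congr_fun M.coassoc m
  simp only [LinearMap.comp_apply] at h4
  have h5 := LinearMap.congr_fun h1 (M.coact m)
  simp only [LinearMap.comp_apply, h4] at h5
  simp only [act, LinearMap.comp_apply, h5, ← h3]

theorem act_counit (m : M.carrier) : M.act (Coalgebra.counit (R := k)) m = m :=
  LinearMap.congr_fun M.counit_coact m

/-- A linear map is colinear if and only if it commutes with the action of all functionals. -/
theorem colinear_iff {f : M.carrier →ₗ[k] N.carrier} :
    N.coact ∘ₗ f = f.rTensor A ∘ₗ M.coact ↔ ∀ p m, f (M.act p m) = N.act p (f m) := by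
  constructor
  · intro h p m
    have := LinearMap.congr_fun h m
    simp only [LinearMap.comp_apply] at this
    simp [act, this, slice_rTensor]
  · intro h
    refine LinearMap.ext fun m => slice_ext fun p => ?_
    simp only [LinearMap.comp_apply, slice_rTensor]
    exact (h p m).symm

theorem Hom.map_act (f : Hom M N) (p : A →ₗ[k] k) (m : M.carrier) :
    f.toLinearMap (M.act p m) = N.act p (f.toLinearMap m) :=
  colinear_iff.mp f.colinear p m

/-- A family `e` in a comodule has coefficients `C` if `ρ(e j) = ∑ i, e i ⊗ C i j`. -/
structure IsCoeff {ι : Type*} [Fintype ι] [DecidableEq ι] (M : RightComod k A)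
    (e : ι → M.carrier) (C : ι → ι → A) : Prop extends IsComatrix k C where
  coact_eq : ∀ j, M.coact (e j) = ∑ i, e i ⊗ₜ[k] C i j

theorem IsCoeff.act_eq {ι : Type*} [Fintype ι] [DecidableEq ι] {e : ι → M.carrier}
    {C : ι → ι → A} (h : M.IsCoeff e C) (p : A →ₗ[k] k) (j) :
    M.act p (e j) = ∑ i, p (C i j) • e i := by
  simp [act, h.coact_eq]

theorem isCoeff_of_linearIndependent {ι : Type*} [Fintype ι] [DecidableEq ι]
    {e : ι → M.carrier} {C : ι → ι → A} (he : LinearIndependent k e)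
    (h : ∀ j, M.coact (e j) = ∑ i, e i ⊗ₜ[k] C i j) : M.IsCoeff e C where
  coact_eq := h
  comul i j := by
    have h1 := LinearMap.congr_fun M.coassoc (e j)
    simp only [LinearMap.comp_apply, h, map_sum, LinearMap.rTensor_tmul, LinearMap.lTensor_tmul,
      TensorProduct.sum_tmul, LinearEquiv.coe_coe, TensorProduct.assoc_tmul] at h1
    rw [Finset.sum_comm] at h1
    simp only [← TensorProduct.tmul_sum] at h1
    exact (congrFun (tmul_left_injective he h1) i).symm
  counit i j := by
    have h1 := LinearMap.congr_fun M.counit_coact (e j)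
    simp only [LinearMap.comp_apply, h, map_sum, LinearMap.lTensor_tmul, LinearEquiv.coe_coe,
      TensorProduct.rid_tmul, LinearMap.id_apply] at h1
    have h2 := congrFun (linearIndependent_iff_injective_fintypeLinearCombination.mp he
      (a₁ := fun i => Coalgebra.counit (R := k) (C i j)) (a₂ := Pi.single j 1)
      (by simp [Fintype.linearCombination_apply, h1, Pi.single_apply])) i
    simpa [Pi.single_apply, Matrix.one_apply] using h2

variable (M) in
/-- The subcomodule generated by `m`, the set of all `p ⇀ m`. -/
def orbit (m : M.carrier) : Submodule k M.carrier :=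
  LinearMap.range ({ toFun := fun p => M.act p m
                     map_add' := fun p q => by simp [act, slice, LinearMap.lTensor_add]
                     map_smul' := fun c p => by simp [act, slice, LinearMap.lTensor_smul] } :
    (A →ₗ[k] k) →ₗ[k] M.carrier)

theorem mem_orbit {m x : M.carrier} : x ∈ M.orbit m ↔ ∃ p, M.act p m = x := Iff.rfl

theorem self_mem_orbit (m : M.carrier) : m ∈ M.orbit m := ⟨_, act_counit m⟩

theorem act_mem_orbit {m x : M.carrier} (hx : x ∈ M.orbit m) (p : A →ₗ[k] k) :
    M.act p x ∈ M.orbit m := by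
  obtain ⟨q, rfl⟩ := mem_orbit.mp hx
  exact ⟨_, (act_act p q m).symm⟩

theorem finite_orbit (m : M.carrier) : Module.Finite k (M.orbit m) := by
  obtain ⟨S, hS⟩ := TensorProduct.exists_finset (M.coact m)
  have : M.orbit m ≤ Submodule.span k ((fun x => x.1) '' (S : Set (M.carrier × A))) := by
    rintro _ ⟨p, rfl⟩
    change slice _ p (M.coact m) ∈ _
    rw [hS, map_sum]
    refine Submodule.sum_mem _ fun x hx => ?_
    rw [slice_tmul]
    exact Submodule.smul_mem _ _ (Submodule.subset_span ⟨x, hx, rfl⟩)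
  have hfin : Module.Finite k (Submodule.span k ((fun x => x.1) '' (S : Set (M.carrier × A)))) :=
    FiniteDimensional.span_of_finite k (S.finite_toSet.image _)
  exact Submodule.finiteDimensional_of_le this

/-- Every element of a comodule lies in the span of a finite linearly independent family with
coefficients in a comatrix. -/
theorem exists_isCoeff (m : M.carrier) : ∃ (n : ℕ) (e : Fin n → M.carrier)
    (C : Fin n → Fin n → A), LinearIndependent k e ∧ M.IsCoeff e C ∧
      m ∈ Submodule.span k (Set.range e) ∧ ∀ i, e i ∈ M.orbit m := by
  have := finite_orbit m
  let b := Module.finBasis k (M.orbit m)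
  have h : ∀ j, ∃ c : Fin _ → A, M.coact (b j) = ∑ i, (b i : M.carrier) ⊗ₜ c i := by
    intro j
    obtain ⟨y, hy⟩ := mem_range_rTensor (N := M.orbit m) (x := M.coact (b j))
      fun p => act_mem_orbit (b j).2 p
    obtain ⟨c, rfl⟩ := exists_tmul_basis b y
    exact ⟨c, by simp [← hy]⟩
  choose C hC using h
  have he : LinearIndependent k fun i => (b i : M.carrier) :=
    b.linearIndependent.map' (M.orbit m).subtype (Submodule.ker_subtype _)
  refine ⟨_, fun i => b i, fun i j => C j i, he, isCoeff_of_linearIndependent he hC, ?_,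
    fun i => (b i).2⟩
  have h2 : Submodule.map (M.orbit m).subtype (Submodule.span k (Set.range b)) =
      Submodule.span k (Set.range fun i => (b i : M.carrier)) := by
    rw [Submodule.map_span, ← Set.range_comp]
    rfl
  rw [← h2, b.span_eq, Submodule.map_top, Submodule.range_subtype]
  exact self_mem_orbit m

/-- Two linear maps on a comodule agree if they agree on all families with coefficients. -/
theorem linearMap_ext {V : Type*} [AddCommGroup V] [Module k V] {f g : M.carrier →ₗ[k] V}
    (h : ∀ (n : ℕ) (e : Fin n → M.carrier) (C : Fin n → Fin n → A), M.IsCoeff e C →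
      ∀ j, f (e j) = g (e j)) : f = g := by
  ext m
  obtain ⟨n, e, C, -, hC, hm, -⟩ := exists_isCoeff m
  exact LinearMap.eqOn_span (Set.forall_mem_range.mpr (h n e C hC)) hm

end RightComod

/-- A family in the coalgebra itself is a combination of the entries of its coefficients. -/
theorem eq_sum_counit {n : ℕ} {e : Fin n → A} {C : Fin n → Fin n → A}
    (h : (RightComod.regular k A).IsCoeff e C) (j) :
    e j = ∑ i, Coalgebra.counit (R := k) (e i) • C i j := by
  have h2 := Coalgebra.rTensor_counit_comul (R := k) (A := A) (e j)
  have h3 : Coalgebra.comul (R := k) (A := A) (e j) = ∑ i, e i ⊗ₜ[k] C i j := h.coact_eq j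
  have h4 := congrArg (TensorProduct.lid k A) h2
  rw [h3] at h4
  simpa using h4.symm

/-- Two linear maps on a coalgebra agree if they agree on the entries of all comatrices. -/
theorem comatrix_ext {V : Type*} [AddCommGroup V] [Module k V] {f g : A →ₗ[k] V}
    (h : ∀ (n : ℕ) (C : Fin n → Fin n → A), IsComatrix k C → ∀ i j, f (C i j) = g (C i j)) :
    f = g := by
  refine RightComod.linearMap_ext (M := RightComod.regular k A) fun n (e : Fin n → A) C hC j => ?_
  change f (e j) = g (e j)
  rw [eq_sum_counit hC j, map_sum, map_sum]
  simp only [map_smul, h n C hC.toIsComatrix]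

end DualQuasi
end

noncomputable section
namespace DualQuasi

variable {k A : Type u} [Field k] [AddCommGroup A] [Module k A] [Coalgebra k A]

namespace RightComod

/-! ### Comodules given by coefficients -/

/-- The element `v` belongs to a finite family on which `ρ` is given by a comatrix. -/
def HasCoeff {V : Type u} [AddCommGroup V] [Module k V] (ρ : V →ₗ[k] V ⊗[k] A) (v : V) : Prop :=
  ∃ (ι : Type) (_ : Fintype ι) (_ : DecidableEq ι) (e : ι → V) (C : ι → ι → A),
    IsComatrix k C ∧ (∀ j, ρ (e j) = ∑ i, e i ⊗ₜ[k] C i j) ∧ ∃ j, e j = v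

/-- A linear map `V → V ⊗ A` which is given by comatrices on a spanning set is a coaction. -/
abbrev ofCoeff {V : Type u} [AddCommGroup V] [Module k V] (ρ : V →ₗ[k] V ⊗[k] A)
    (h : Submodule.span k {v | HasCoeff ρ v} = ⊤) : RightComod k A where
  carrier := V
  coact := ρ
  coassoc := by
    refine LinearMap.ext_on h ?_
    rintro _ ⟨ι, _, _, e, C, hC, he, j, rfl⟩
    simp only [LinearMap.comp_apply, he, map_sum, LinearMap.rTensor_tmul, LinearMap.lTensor_tmul,
      TensorProduct.sum_tmul, LinearEquiv.coe_coe, TensorProduct.assoc_tmul, hC.comul,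
      TensorProduct.tmul_sum]
    rw [Finset.sum_comm]
  counit_coact := by
    refine LinearMap.ext_on h ?_
    rintro _ ⟨ι, _, _, e, C, hC, he, j, rfl⟩
    simp [he, hC.counit, Matrix.one_apply]

theorem span_hasCoeff (M : RightComod k A) : Submodule.span k {v | HasCoeff M.coact v} = ⊤ := by
  rw [eq_top_iff]
  intro m _
  obtain ⟨n, e, C, -, hC, hm, -⟩ := exists_isCoeff m
  refine Submodule.span_mono ?_ hm
  rintro _ ⟨j, rfl⟩
  exact ⟨Fin n, _, _, e, C, hC.toIsComatrix, hC.coact_eq, j, rfl⟩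

/-- Linear maps out of a tensor product of two comodules agree if they agree on tensors of
members of families with coefficients. -/
theorem tensor_ext {M N : RightComod k A} {V : Type*} [AddCommGroup V] [Module k V]
    {f g : M.carrier ⊗[k] N.carrier →ₗ[k] V}
    (h : ∀ (n : ℕ) (e : Fin n → M.carrier) (C : Fin n → Fin n → A) (_ : M.IsCoeff e C)
      (m : ℕ) (d : Fin m → N.carrier) (D : Fin m → Fin m → A) (_ : N.IsCoeff d D),
      ∀ i j, f (e i ⊗ₜ d j) = g (e i ⊗ₜ d j)) : f = g :=
  TensorProduct.ext <| linearMap_ext fun n e C hC i => linearMap_ext fun m d D hD j =>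
    h n e C hC m d D hD i j

/-- The composite of two colinear maps. -/
def Hom.comp {M N P : RightComod k A} (g : Hom N P) (f : Hom M N) : Hom M P :=
  (show M ⟶ P from (show M ⟶ N from f) ≫ (show N ⟶ P from g))

theorem Hom.comp_toLinearMap {M N P : RightComod k A} (g : Hom N P) (f : Hom M N) :
    (g.comp f).toLinearMap = g.toLinearMap ∘ₗ f.toLinearMap := rfl

/-- A linear map which commutes with the action of all functionals, as a colinear map. -/
def Hom.ofAct {M N : RightComod k A} (f : M.carrier →ₗ[k] N.carrier)
    (h : ∀ p m, f (M.act p m) = N.act p (f m)) : Hom M N :=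
  ⟨f, colinear_iff.mpr h⟩

/-! ### Subcomodules and quotients -/

/-- A subspace of a comodule is stable if it is a subcomodule. -/
def IsStable (M : RightComod k A) (N : Submodule k M.carrier) : Prop :=
  ∀ p, ∀ m ∈ N, M.act p m ∈ N

theorem IsStable.orbit_le {M : RightComod k A} {N : Submodule k M.carrier} (h : M.IsStable N)
    {m : M.carrier} (hm : m ∈ N) : M.orbit m ≤ N := by
  rintro _ ⟨p, rfl⟩
  exact h p m hm

theorem IsStable.sup {M : RightComod k A} {N N' : Submodule k M.carrier} (h : M.IsStable N)
    (h' : M.IsStable N') : M.IsStable (N ⊔ N') := by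
  intro p m hm
  obtain ⟨x, hx, y, hy, rfl⟩ := Submodule.mem_sup.mp hm
  rw [map_add]
  exact Submodule.add_mem_sup (h p x hx) (h' p y hy)

theorem Hom.isStable_range {M N : RightComod k A} (f : Hom M N) :
    N.IsStable (LinearMap.range f.toLinearMap) := by
  rintro p _ ⟨m, rfl⟩
  exact ⟨_, f.map_act p m⟩

theorem Hom.isStable_comap {M N : RightComod k A} (f : Hom M N) {N' : Submodule k N.carrier}
    (h : N.IsStable N') : M.IsStable (N'.comap f.toLinearMap) := by
  intro p m hm
  rw [Submodule.mem_comap, f.map_act]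
  exact h p _ hm

theorem rTensor_subtype_injective {k A V : Type*} [Field k] [AddCommGroup A] [Module k A]
    [AddCommGroup V] [Module k V] (N : Submodule k V) : Function.Injective (N.subtype.rTensor A) :=
  Module.Flat.rTensor_preserves_injective_linearMap _ N.injective_subtype

/-- The coaction of a subcomodule. -/
def subCoact (M : RightComod k A) (N : Submodule k M.carrier) (h : M.IsStable N) :
    N →ₗ[k] N ⊗[k] A :=
  (LinearEquiv.ofInjective _ (rTensor_subtype_injective N)).symm.toLinearMap ∘ₗ
    (M.coact ∘ₗ N.subtype).codRestrict (LinearMap.range (N.subtype.rTensor A))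
      fun m => mem_range_rTensor fun p => h p m m.2

theorem subCoact_apply (M : RightComod k A) (N : Submodule k M.carrier) (h : M.IsStable N)
    (m : N) : N.subtype.rTensor A (M.subCoact N h m) = M.coact m :=
  congrArg Subtype.val ((LinearEquiv.ofInjective _ (rTensor_subtype_injective N)).apply_symm_apply
    ((M.coact ∘ₗ N.subtype).codRestrict (LinearMap.range (N.subtype.rTensor A))
      (fun m => mem_range_rTensor fun p => h p m m.2) m))

/-- A stable subspace as a comodule. -/
def sub (M : RightComod k A) (N : Submodule k M.carrier) (h : M.IsStable N) : RightComod k A :=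
  ofCoeff (M.subCoact N h) <| by
    rw [eq_top_iff]
    intro m _
    obtain ⟨n, e, C, -, hC, hm, he⟩ := exists_isCoeff (m : M.carrier)
    have he' (i) : e i ∈ N := h.orbit_le m.2 (he i)
    have h2 : m ∈ Submodule.span k (Set.range fun i => (⟨e i, he' i⟩ : N)) := by
      rw [← Submodule.apply_mem_span_image_iff_mem_span N.injective_subtype, ← Set.range_comp]
      exact hm
    refine Submodule.span_mono ?_ h2
    rintro _ ⟨j, rfl⟩
    refine ⟨Fin n, _, _, fun i => ⟨e i, he' i⟩, C, hC.toIsComatrix, fun i => ?_, j, rfl⟩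
    apply rTensor_subtype_injective N
    rw [subCoact_apply]
    simp [hC.coact_eq]

/-- The inclusion of a subcomodule. -/
def subι (M : RightComod k A) (N : Submodule k M.carrier) (h : M.IsStable N) :
    Hom (M.sub N h) M where
  toLinearMap := N.subtype
  colinear := (LinearMap.ext fun m => M.subCoact_apply N h m).symm

/-- The coaction of a quotient comodule. -/
def quotCoact (M : RightComod k A) (N : Submodule k M.carrier) (h : M.IsStable N) :
    (M.carrier ⧸ N) →ₗ[k] (M.carrier ⧸ N) ⊗[k] A :=
  N.liftQ (N.mkQ.rTensor A ∘ₗ M.coact) fun m hm => by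
    rw [LinearMap.mem_ker]
    refine slice_ext fun p => ?_
    rw [LinearMap.comp_apply, slice_rTensor, map_zero]
    exact (Submodule.Quotient.mk_eq_zero N).mpr (h p m hm)

/-- The quotient of a comodule by a stable subspace. -/
def quot (M : RightComod k A) (N : Submodule k M.carrier) (h : M.IsStable N) : RightComod k A :=
  ofCoeff (M.quotCoact N h) <| by
    have h2 : Submodule.map N.mkQ (Submodule.span k {v | HasCoeff M.coact v}) = ⊤ := by
      rw [M.span_hasCoeff, Submodule.map_top, Submodule.range_mkQ]
    rw [eq_top_iff, ← h2, Submodule.map_span]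
    refine Submodule.span_mono ?_
    rintro _ ⟨_, ⟨ι, i1, i2, e, C, hC, he, j, rfl⟩, rfl⟩
    exact ⟨ι, i1, i2, fun i => N.mkQ (e i), C, hC, fun i => by simp [quotCoact, he], j, rfl⟩

/-- The projection onto a quotient comodule. -/
def quotπ (M : RightComod k A) (N : Submodule k M.carrier) (h : M.IsStable N) :
    Hom M (M.quot N h) where
  toLinearMap := N.mkQ
  colinear := LinearMap.ext fun _ => rfl

/-! ### Epimorphisms and projective objects -/

theorem epi_iff_surjective {M N : RightComod k A} (f : M ⟶ N) :
    Epi f ↔ Function.Surjective (Hom.toLinearMap f) := by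
  constructor
  · intro hf
    let Q := N.quot _ (Hom.isStable_range f)
    let z : N ⟶ Q := Hom.mk 0 (by simp)
    have h : f ≫ N.quotπ _ (Hom.isStable_range f) = f ≫ z :=
      Hom.ext (LinearMap.range_mkQ_comp (f := Hom.toLinearMap f))
    have h2 := congrArg Hom.toLinearMap ((cancel_epi f).mp h)
    have h3 : (LinearMap.range (Hom.toLinearMap f)).mkQ = 0 := h2
    rw [← LinearMap.range_eq_top, ← Submodule.ker_mkQ (LinearMap.range (Hom.toLinearMap f)), h3,
      LinearMap.ker_zero]
  · intro hf
    refine ⟨fun g h hgh => Hom.ext (LinearMap.ext fun n => ?_)⟩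
    obtain ⟨m, rfl⟩ := hf n
    exact LinearMap.congr_fun (congrArg Hom.toLinearMap hgh) m

/-- Colinear maps out of `P` lift through surjective colinear maps. -/
def IsProj (P : RightComod k A) : Prop :=
  ∀ ⦃X Y : RightComod k A⦄ (π : Hom X Y), Function.Surjective π.toLinearMap → ∀ f : Hom P Y,
    ∃ g : Hom P X, π.toLinearMap ∘ₗ g.toLinearMap = f.toLinearMap

theorem projective_iff {P : RightComod k A} : Projective P ↔ P.IsProj := by
  constructor
  · intro hP X Y π hπ f
    have : Epi (C := RightComod k A) (X := X) (Y := Y) π := (epi_iff_surjective _).mpr hπ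
    exact ⟨Projective.factorThru (X := Y) (E := X) f π,
      congrArg Hom.toLinearMap (Projective.factorThru_comp (X := Y) (E := X) f π)⟩
  · intro hP
    refine ⟨fun {E X} f e he => ?_⟩
    obtain ⟨g, hg⟩ := hP e ((epi_iff_surjective _).mp he) f
    exact ⟨g, Hom.ext hg⟩

theorem IsProj.of_retract {P Q : RightComod k A} (hP : P.IsProj) (i : Hom Q P) (r : Hom P Q)
    (h : r.toLinearMap ∘ₗ i.toLinearMap = LinearMap.id) : Q.IsProj := by
  intro X Y π hπ f
  obtain ⟨g, hg⟩ := hP π hπ (f.comp r)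
  refine ⟨g.comp i, ?_⟩
  rw [Hom.comp_toLinearMap, ← LinearMap.comp_assoc, hg, Hom.comp_toLinearMap,
    LinearMap.comp_assoc, h, LinearMap.comp_id]

/-- The product of two comodules. -/
def prod (M N : RightComod k A) : RightComod k A :=
  ofCoeff (V := M.carrier × N.carrier)
    (LinearMap.coprod ((LinearMap.inl k M.carrier N.carrier).rTensor A ∘ₗ M.coact)
      ((LinearMap.inr k M.carrier N.carrier).rTensor A ∘ₗ N.coact)) <| by
    rw [eq_top_iff, ← LinearMap.sup_range_inl_inr, LinearMap.range_eq_map, LinearMap.range_eq_map,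
      ← M.span_hasCoeff, ← N.span_hasCoeff, Submodule.map_span, Submodule.map_span]
    refine sup_le (Submodule.span_mono ?_) (Submodule.span_mono ?_)
    · rintro _ ⟨_, ⟨ι, i1, i2, e, C, hC, he, j, rfl⟩, rfl⟩
      exact ⟨ι, i1, i2, fun i => LinearMap.inl k M.carrier N.carrier (e i), C, hC,
        fun i => by simp [he], j, rfl⟩
    · rintro _ ⟨_, ⟨ι, i1, i2, e, C, hC, he, j, rfl⟩, rfl⟩
      exact ⟨ι, i1, i2, fun i => LinearMap.inr k M.carrier N.carrier (e i), C, hC,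
        fun i => by simp [he], j, rfl⟩

/-- The first projection. -/
def prodFst (M N : RightComod k A) : Hom (M.prod N) M where
  toLinearMap := LinearMap.fst k M.carrier N.carrier
  colinear := LinearMap.ext fun x => by
    change M.coact x.1 = LinearMap.rTensor A (LinearMap.fst k M.carrier N.carrier)
      ((LinearMap.inl k M.carrier N.carrier).rTensor A (M.coact x.1) +
      (LinearMap.inr k M.carrier N.carrier).rTensor A (N.coact x.2))
    rw [map_add, ← LinearMap.rTensor_comp_apply, ← LinearMap.rTensor_comp_apply,
      LinearMap.fst_comp_inl, LinearMap.fst_comp_inr]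
    simp

/-- The second projection. -/
def prodSnd (M N : RightComod k A) : Hom (M.prod N) N where
  toLinearMap := LinearMap.snd k M.carrier N.carrier
  colinear := LinearMap.ext fun x => by
    change N.coact x.2 = LinearMap.rTensor A (LinearMap.snd k M.carrier N.carrier)
      ((LinearMap.inl k M.carrier N.carrier).rTensor A (M.coact x.1) +
      (LinearMap.inr k M.carrier N.carrier).rTensor A (N.coact x.2))
    rw [map_add, ← LinearMap.rTensor_comp_apply, ← LinearMap.rTensor_comp_apply,
      LinearMap.snd_comp_inl, LinearMap.snd_comp_inr]
    simp

/-- A comodule is projective if all surjections onto it split. -/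
theorem isProj_of_split {P : RightComod k A}
    (h : ∀ (X : RightComod k A) (π : Hom X P), Function.Surjective π.toLinearMap →
      ∃ s : Hom P X, π.toLinearMap ∘ₗ s.toLinearMap = LinearMap.id) : P.IsProj := by
  intro X Y π hπ f
  -- the pullback of `π` and `f`
  let d : (X.prod P).carrier →ₗ[k] Y.carrier :=
    π.toLinearMap ∘ₗ (X.prodFst P).toLinearMap - f.toLinearMap ∘ₗ (X.prodSnd P).toLinearMap
  have hd : (X.prod P).IsStable (LinearMap.ker d) := by
    intro p m hm
    rw [LinearMap.mem_ker, LinearMap.sub_apply, sub_eq_zero] at hm ⊢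
    simp only [LinearMap.comp_apply, Hom.map_act] at hm ⊢
    rw [hm]
  let K := (X.prod P).sub _ hd
  obtain ⟨s, hs⟩ := h K ((X.prodSnd P).comp ((X.prod P).subι _ hd)) (by
    intro y
    obtain ⟨x, hx⟩ := hπ (f.toLinearMap y)
    have hxy : d (x, y) = 0 := sub_eq_zero.mpr hx
    exact ⟨(⟨(x, y), hxy⟩ : LinearMap.ker d), rfl⟩)
  refine ⟨(X.prodFst P).comp (((X.prod P).subι _ hd).comp s), LinearMap.ext fun y => ?_⟩
  have h1 : d ((s.toLinearMap y : K.carrier) : LinearMap.ker d).1 = 0 :=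
    ((s.toLinearMap y : K.carrier) : LinearMap.ker d).2
  rw [LinearMap.sub_apply, sub_eq_zero] at h1
  refine Eq.trans h1 ?_
  change f.toLinearMap ((LinearMap.snd k _ _ ∘ₗ (LinearMap.ker d).subtype ∘ₗ s.toLinearMap) y) = _
  exact congrArg f.toLinearMap (LinearMap.congr_fun hs y)

end RightComod
end DualQuasi
end

noncomputable section
namespace DualQuasi

/-! ### Antimorphisms of coalgebras -/

section Anti

variable {k D E F G : Type*} [Field k] [AddCommGroup D] [Module k D] [Coalgebra k D]
  [AddCommGroup E] [Module k E] [Coalgebra k E] [AddCommGroup F] [Module k F] [Coalgebra k F]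
  [AddCommGroup G] [Module k G] [Coalgebra k G]

/-- Antimorphisms of coalgebras: `Δ(r(x)) = ∑ r(x₂) ⊗ r(x₁)`. -/
structure IsAnti (r : E →ₗ[k] D) : Prop where
  comul : Coalgebra.comul ∘ₗ r =
    (TensorProduct.comm k D D).toLinearMap ∘ₗ TensorProduct.map r r ∘ₗ Coalgebra.comul
  counit : Coalgebra.counit ∘ₗ r = (Coalgebra.counit : E →ₗ[k] k)

theorem IsAnti.comul_apply {r : E →ₗ[k] D} (h : IsAnti r) (x : E) :
    Coalgebra.comul (R := k) (r x) =
      TensorProduct.comm k D D (TensorProduct.map r r (Coalgebra.comul x)) :=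
  LinearMap.congr_fun h.comul x

theorem IsAnti.counit_apply {r : E →ₗ[k] D} (h : IsAnti r) (x : E) :
    Coalgebra.counit (R := k) (r x) = Coalgebra.counit (R := k) x :=
  LinearMap.congr_fun h.counit x

theorem IsAnti.comp_hom {r : E →ₗ[k] D} (h : IsAnti r) (f : D →ₗc[k] F) :
    IsAnti (f.toLinearMap ∘ₗ r) where
  comul := by
    rw [← LinearMap.comp_assoc, ← f.map_comp_comul, LinearMap.comp_assoc, h.comul,
      TensorProduct.map_comp]
    refine LinearMap.ext fun x => ?_
    simp only [LinearMap.comp_apply, LinearEquiv.coe_coe]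
    generalize TensorProduct.map r r (Coalgebra.comul x) = y
    exact LinearMap.congr_fun (TensorProduct.ext' (fun _ _ => rfl) :
      TensorProduct.map f.toLinearMap f.toLinearMap ∘ₗ (TensorProduct.comm k D D).toLinearMap =
      (TensorProduct.comm k F F).toLinearMap ∘ₗ TensorProduct.map f.toLinearMap f.toLinearMap) y
  counit := by rw [← LinearMap.comp_assoc, f.counit_comp, h.counit]

/-- The composite of two antimorphisms is a morphism. -/
def IsAnti.comp {s : D →ₗ[k] F} {r : E →ₗ[k] D} (hs : IsAnti s) (hr : IsAnti r) : E →ₗc[k] F where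
  toLinearMap := s ∘ₗ r
  counit_comp := by rw [← LinearMap.comp_assoc, hs.counit, hr.counit]
  map_comp_comul := by
    refine LinearMap.ext fun x => ?_
    simp only [LinearMap.comp_apply, hs.comul_apply, hr.comul_apply]
    generalize Coalgebra.comul (R := k) x = y
    induction y with
    | zero => simp
    | tmul a b => simp
    | add a b ha hb => simp only [map_add, ha, hb]

theorem IsAnti.comm_map {r : E →ₗ[k] D} {s : F →ₗ[k] G} (hr : IsAnti r) (hs : IsAnti s) :
    IsAnti ((TensorProduct.comm k D G).toLinearMap ∘ₗ TensorProduct.map r s) where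
  comul := by
    refine TensorProduct.ext' fun x y => ?_
    simp only [LinearMap.comp_apply, LinearEquiv.coe_coe, TensorProduct.map_tmul,
      TensorProduct.comm_tmul, TensorProduct.comul_tmul, hr.comul_apply, hs.comul_apply]
    generalize Coalgebra.comul (R := k) x = u
    generalize Coalgebra.comul (R := k) y = v
    induction u with
    | zero => simp
    | add a b ha hb => simp only [map_add, TensorProduct.add_tmul, TensorProduct.tmul_add, ha, hb]
    | tmul a b =>
      induction v with
      | zero => simp
      | add a b ha hb => simp only [map_add, TensorProduct.add_tmul, TensorProduct.tmul_add, ha, hb]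
      | tmul c d => simp
  counit := by
    refine TensorProduct.ext' fun x y => ?_
    simp [hr.counit_apply, hs.counit_apply, mul_comm]

theorem IsAnti.mul_comp {r : E →ₗ[k] D} (h : IsAnti r) (p q : D →ₗ[k] k) :
    (WithConv.toConv (p ∘ₗ r) * WithConv.toConv (q ∘ₗ r) : DualAlg k E) =
      WithConv.toConv ((WithConv.toConv q * WithConv.toConv p : DualAlg k D).ofConv ∘ₗ r) := by
  refine congrArg WithConv.toConv (LinearMap.ext fun x => ?_)
  simp only [LinearMap.convMul_def, LinearMap.comp_apply, h.comul_apply]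
  generalize Coalgebra.comul (R := k) x = y
  induction y with
  | zero => simp
  | tmul a b => simp [mul_comm]
  | add a b ha hb => simp only [map_add, ha, hb]

theorem IsAnti.one_comp {r : E →ₗ[k] D} (h : IsAnti r) :
    WithConv.toConv ((1 : DualAlg k D).ofConv ∘ₗ r) = (1 : DualAlg k E) := by
  refine congrArg WithConv.toConv (LinearMap.ext fun x => ?_)
  simp [LinearMap.convOne_def, h.counit_apply]

theorem IsAnti.convRight_comp {V : Type*} [AddCommGroup V] [Module k V] {r : E →ₗ[k] D}
    (h : IsAnti r) (g : D →ₗ[k] V) (p : D →ₗ[k] k) :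
    convRight (g ∘ₗ r) (p ∘ₗ r) = convLeft p g ∘ₗ r := by
  refine LinearMap.ext fun x => ?_
  simp only [convLeft, convRight, LinearMap.comp_apply, h.comul_apply]
  generalize Coalgebra.comul (R := k) x = y
  induction y with
  | zero => simp
  | tmul a b => simp
  | add a b ha hb => simp only [map_add, ha, hb]

theorem IsAnti.convLeft_comp {V : Type*} [AddCommGroup V] [Module k V] {r : E →ₗ[k] D}
    (h : IsAnti r) (g : D →ₗ[k] V) (p : D →ₗ[k] k) :
    convLeft (p ∘ₗ r) (g ∘ₗ r) = convRight g p ∘ₗ r := by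
  refine LinearMap.ext fun x => ?_
  simp only [convLeft, convRight, LinearMap.comp_apply, h.comul_apply]
  generalize Coalgebra.comul (R := k) x = y
  induction y with
  | zero => simp
  | tmul a b => simp
  | add a b ha hb => simp only [map_add, ha, hb]

theorem IsComatrix.anti {ι : Type*} [Fintype ι] [DecidableEq ι] {C : ι → ι → E}
    (hC : IsComatrix k C) {r : E →ₗ[k] D} (h : IsAnti r) :
    IsComatrix k fun i j => r (C j i) where
  comul i j := by simp [h.comul_apply, hC.comul]
  counit i j := by simp [h.counit_apply, hC.counit, Matrix.one_apply, eq_comm]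

end Anti

/-! ### The dual quasi-Hopf algebra `A^{op,cop}` -/

/-- The opposite and coopposite `A^{op,cop}` of a dual quasi-bialgebra `A`. -/
def OpCop (A : Type*) : Type _ := A

section OpCop

variable {k A : Type u} [Field k] [AddCommGroup A] [Module k A]

instance : AddCommGroup (OpCop A) := inferInstanceAs (AddCommGroup A)
instance : Module k (OpCop A) := inferInstanceAs (Module k A)

variable (k A) in
/-- The identity map from `A^{op,cop}` to `A`. -/
def opEquiv : OpCop A ≃ₗ[k] A := LinearEquiv.refl k A

variable (k A) in
/-- The flip `x ⊗ y ↦ y ⊗ x` from `A^{op,cop} ⊗ A^{op,cop}` to `A ⊗ A`. -/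
def flipTwo : OpCop A ⊗[k] OpCop A →ₗ[k] A ⊗[k] A :=
  (TensorProduct.comm k A A).toLinearMap ∘ₗ
    TensorProduct.map (opEquiv k A).toLinearMap (opEquiv k A).toLinearMap

variable [Coalgebra k A]

/-- The coopposite comultiplication. -/
def opComul : OpCop A →ₗ[k] OpCop A ⊗[k] OpCop A :=
  (TensorProduct.comm k (OpCop A) (OpCop A)).toLinearMap ∘ₗ
    TensorProduct.map (opEquiv k A).symm.toLinearMap (opEquiv k A).symm.toLinearMap ∘ₗ
      Coalgebra.comul ∘ₗ (opEquiv k A).toLinearMap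

theorem opComul_comatrix {ι : Type*} [Fintype ι] [DecidableEq ι] {C : ι → ι → A}
    (hC : IsComatrix k C) (i j) : opComul ((opEquiv k A).symm (C i j)) =
      ∑ l, (opEquiv k A).symm (C l j) ⊗ₜ[k] (opEquiv k A).symm (C i l) := by
  simp [opComul, hC.comul]

theorem opCop_ext {V : Type*} [AddCommGroup V] [Module k V] {f g : OpCop A →ₗ[k] V}
    (h : ∀ (n : ℕ) (C : Fin n → Fin n → A), IsComatrix k C → ∀ i j,
      f ((opEquiv k A).symm (C i j)) = g ((opEquiv k A).symm (C i j))) : f = g := by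
  have : f ∘ₗ (opEquiv k A).symm.toLinearMap = g ∘ₗ (opEquiv k A).symm.toLinearMap :=
    comatrix_ext h
  refine LinearMap.ext fun x => ?_
  simpa using LinearMap.congr_fun this (opEquiv k A x)

instance : Coalgebra k (OpCop A) where
  comul := opComul
  counit := Coalgebra.counit ∘ₗ (opEquiv k A).toLinearMap
  coassoc := by
    refine opCop_ext fun n C hC i j => ?_
    simp only [LinearMap.comp_apply, opComul_comatrix hC, map_sum, LinearMap.rTensor_tmul,
      LinearMap.lTensor_tmul, TensorProduct.sum_tmul, TensorProduct.tmul_sum, LinearEquiv.coe_coe,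
      TensorProduct.assoc_tmul]
    rw [Finset.sum_comm]
  rTensor_counit_comp_comul := by
    refine opCop_ext fun n C hC i j => ?_
    simp [opComul_comatrix hC, hC.counit, Matrix.one_apply, TensorProduct.ite_tmul]
  lTensor_counit_comp_comul := by
    refine opCop_ext fun n C hC i j => ?_
    simp [opComul_comatrix hC, hC.counit, Matrix.one_apply, TensorProduct.tmul_ite]

theorem op_counit (x : OpCop A) : Coalgebra.counit (R := k) (opEquiv k A x) =
    Coalgebra.counit (R := k) x := rfl

theorem isAnti_opEquiv : IsAnti (opEquiv k A).toLinearMap where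
  comul := by
    refine opCop_ext fun n C hC i j => ?_
    have h : Coalgebra.comul (R := k) ((opEquiv k A).symm (C i j)) = _ := opComul_comatrix hC i j
    simp [h, hC.comul]
  counit := rfl

theorem isAnti_opEquiv_symm : IsAnti (opEquiv k A).symm.toLinearMap where
  comul := by
    refine comatrix_ext fun n C hC i j => ?_
    have h : Coalgebra.comul (R := k) ((opEquiv k A).symm (C i j)) = _ := opComul_comatrix hC i j
    simp [h, hC.comul]
  counit := rfl

variable (k A)

/-- The flip `x ⊗ (y ⊗ z) ↦ z ⊗ (y ⊗ x)`. -/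
def flipThree : OpCop A ⊗[k] (OpCop A ⊗[k] OpCop A) →ₗ[k] A ⊗[k] (A ⊗[k] A) :=
  (Coalgebra.TensorProduct.assoc k k A A A :
    (A ⊗[k] A) ⊗[k] A →ₗc[k] A ⊗[k] (A ⊗[k] A)).toLinearMap ∘ₗ
  (TensorProduct.comm k A (A ⊗[k] A)).toLinearMap ∘ₗ
    TensorProduct.map (opEquiv k A).toLinearMap (flipTwo k A)

/-- The flip `x ⊗ (y ⊗ (z ⊗ w)) ↦ w ⊗ (z ⊗ (y ⊗ x))`. -/
def flipFour : OpCop A ⊗[k] (OpCop A ⊗[k] (OpCop A ⊗[k] OpCop A)) →ₗ[k]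
    A ⊗[k] (A ⊗[k] (A ⊗[k] A)) :=
  (Coalgebra.TensorProduct.map (CoalgHom.id k A)
    (Coalgebra.TensorProduct.assoc k k A A A :
      (A ⊗[k] A) ⊗[k] A →ₗc[k] A ⊗[k] (A ⊗[k] A))).toLinearMap ∘ₗ
  (Coalgebra.TensorProduct.assoc k k A (A ⊗[k] A) A :
    (A ⊗[k] (A ⊗[k] A)) ⊗[k] A →ₗc[k] A ⊗[k] ((A ⊗[k] A) ⊗[k] A)).toLinearMap ∘ₗ
  (TensorProduct.comm k A (A ⊗[k] (A ⊗[k] A))).toLinearMap ∘ₗ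
    TensorProduct.map (opEquiv k A).toLinearMap (flipThree k A)

variable {k A}

theorem isAnti_flipTwo : IsAnti (flipTwo k A) := isAnti_opEquiv.comm_map isAnti_opEquiv

theorem isAnti_flipThree : IsAnti (flipThree k A) :=
  (isAnti_opEquiv.comm_map isAnti_flipTwo).comp_hom _

theorem isAnti_flipFour : IsAnti (flipFour k A) :=
  ((isAnti_opEquiv.comm_map isAnti_flipThree).comp_hom _).comp_hom _

theorem flipThree_tmul (x y z : OpCop A) :
    flipThree k A (x ⊗ₜ (y ⊗ₜ z)) = opEquiv k A z ⊗ₜ (opEquiv k A y ⊗ₜ opEquiv k A x) := rfl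

theorem flipFour_tmul (x y z w : OpCop A) :
    flipFour k A (x ⊗ₜ (y ⊗ₜ (z ⊗ₜ w))) =
      opEquiv k A w ⊗ₜ (opEquiv k A z ⊗ₜ (opEquiv k A y ⊗ₜ opEquiv k A x)) := rfl

theorem IsComatrix.ofOpCop {ι : Type*} [Fintype ι] [DecidableEq ι] {C : ι → ι → OpCop A}
    (hC : IsComatrix k C) : IsComatrix k fun i j => opEquiv k A (C j i) :=
  hC.anti isAnti_opEquiv

section Bialgebra

variable [DualQuasiBialgebra k A]

open DualQuasiBialgebra

variable (k A) in
/-- The opposite multiplication. -/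
def opMul : OpCop A ⊗[k] OpCop A →ₗc[k] OpCop A :=
  isAnti_opEquiv_symm.comp (isAnti_flipTwo.comp_hom mul)

theorem opMul_tmul (x y : OpCop A) : opMul k A (x ⊗ₜ y) =
    (opEquiv k A).symm (mul (k := k) (A := A) (opEquiv k A y ⊗ₜ opEquiv k A x)) := rfl

variable (k A) in
/-- The unit of `A^{op,cop}`. -/
def opUnit : k →ₗc[k] OpCop A :=
  isAnti_opEquiv_symm.comp (r := (unit (k := k) (A := A)).toLinearMap)
    { comul := by
        have h : Coalgebra.comul (R := k) (unit (k := k) (A := A) 1) = _ := comul_one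
        ext
        simp [h]
      counit := CoalgHom.counit_comp _ }

variable (k A) in
/-- The reassociator of `A^{op,cop}`. -/
def opReassoc : (DualAlg k (OpCop A ⊗[k] (OpCop A ⊗[k] OpCop A)))ˣ where
  val := WithConv.toConv ((reassoc (k := k) (A := A)).val.ofConv ∘ₗ flipThree k A)
  inv := WithConv.toConv ((reassoc (k := k) (A := A)).inv.ofConv ∘ₗ flipThree k A)
  val_inv := by
    rw [isAnti_flipThree.mul_comp, WithConv.toConv_ofConv, WithConv.toConv_ofConv, Units.inv_val,
      isAnti_flipThree.one_comp]
  inv_val := by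
    rw [isAnti_flipThree.mul_comp, WithConv.toConv_ofConv, WithConv.toConv_ofConv, Units.val_inv,
      isAnti_flipThree.one_comp]

theorem opReassoc_val : (opReassoc k A).val.ofConv =
  (reassoc (k := k) (A := A)).val.ofConv ∘ₗ flipThree k A := rfl

theorem opMul_lTensor : (opMul k A).toLinearMap ∘ₗ (opMul k A).toLinearMap.lTensor (OpCop A) =
    ((opEquiv k A).symm.toLinearMap ∘ₗ ((mul (k := k) (A := A)).toLinearMap ∘ₗ
      (mul (k := k) (A := A)).toLinearMap.rTensor A ∘ₗ
          (TensorProduct.assoc k A A A).symm.toLinearMap)) ∘ₗ flipThree k A := by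
  refine TensorProduct.ext_threefold' fun x y z => ?_
  simp [opMul_tmul, flipThree_tmul]

theorem opMul_rTensor : (opMul k A).toLinearMap ∘ₗ (opMul k A).toLinearMap.rTensor (OpCop A) ∘ₗ
      (TensorProduct.assoc k (OpCop A) (OpCop A) (OpCop A)).symm.toLinearMap =
    ((opEquiv k A).symm.toLinearMap ∘ₗ ((mul (k := k) (A := A)).toLinearMap ∘ₗ
      (mul (k := k) (A := A)).toLinearMap.lTensor A)) ∘ₗ flipThree k A := by
  refine TensorProduct.ext_threefold' fun x y z => ?_
  simp [opMul_tmul, flipThree_tmul]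

theorem one_opMul (a : OpCop A) : opMul k A (opUnit k A 1 ⊗ₜ a) = a := by
  rw [opMul_tmul]
  exact DualQuasiBialgebra.mul_one (opEquiv k A a)

theorem opMul_one (a : OpCop A) : opMul k A (a ⊗ₜ opUnit k A 1) = a := by
  rw [opMul_tmul]
  exact DualQuasiBialgebra.one_mul (opEquiv k A a)

theorem op_quasi_assoc :
    convRight ((opMul k A).toLinearMap ∘ₗ (opMul k A).toLinearMap.lTensor (OpCop A))
      (opReassoc k A).val.ofConv =
    convLeft (opReassoc k A).val.ofConv
      ((opMul k A).toLinearMap ∘ₗ (opMul k A).toLinearMap.rTensor (OpCop A) ∘ₗ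
        (TensorProduct.assoc k (OpCop A) (OpCop A) (OpCop A)).symm.toLinearMap) := by
  rw [opMul_lTensor, opMul_rTensor, opReassoc_val,
    isAnti_flipThree.convRight_comp, isAnti_flipThree.convLeft_comp]
  have h (f : A ⊗[k] (A ⊗[k] A) →ₗ[k] A) (p : A ⊗[k] (A ⊗[k] A) →ₗ[k] k) :
      convLeft p ((opEquiv k A).symm.toLinearMap ∘ₗ f) =
        (opEquiv k A).symm.toLinearMap ∘ₗ convLeft p f := rfl
  have h' (f : A ⊗[k] (A ⊗[k] A) →ₗ[k] A) (p : A ⊗[k] (A ⊗[k] A) →ₗ[k] k) :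
      convRight ((opEquiv k A).symm.toLinearMap ∘ₗ f) p =
        (opEquiv k A).symm.toLinearMap ∘ₗ convRight f p := rfl
  rw [h, h', DualQuasiBialgebra.quasi_assoc]

open Coalgebra in
/-- The flip of four factors is an antimorphism, so that it reverses convolution products. It
exchanges `φ(x, y, zw)` with `φ(xy, z, w)` and `φ(y, z, w)` with `φ(x, y, z)`, which turns the
pentagon identity of `A` into that of `A^{op,cop}`. -/
theorem op_cocycle :
    (WithConv.toConv ((opReassoc k A).val.ofConv ∘ₗ
          ((opMul k A).toLinearMap.lTensor (OpCop A)).lTensor (OpCop A)) *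
        WithConv.toConv ((opReassoc k A).val.ofConv ∘ₗ
          (opMul k A).toLinearMap.rTensor (OpCop A ⊗[k] OpCop A) ∘ₗ
          (TensorProduct.assoc k (OpCop A) (OpCop A) (OpCop A ⊗[k] OpCop A)).symm.toLinearMap) :
        DualAlg k (OpCop A ⊗[k] (OpCop A ⊗[k] (OpCop A ⊗[k] OpCop A)))) =
      WithConv.toConv ((TensorProduct.lid k k).toLinearMap ∘ₗ
          TensorProduct.map counit (opReassoc k A).val.ofConv) *
        WithConv.toConv ((opReassoc k A).val.ofConv ∘ₗ
          ((opMul k A).toLinearMap.rTensor (OpCop A) ∘ₗ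
            (TensorProduct.assoc k (OpCop A) (OpCop A) (OpCop A)).symm.toLinearMap).lTensor
              (OpCop A)) *
        WithConv.toConv ((opReassoc k A).val.ofConv ∘ₗ
          (((TensorProduct.rid k (OpCop A)).toLinearMap ∘ₗ
            counit.lTensor (OpCop A)).lTensor (OpCop A)).lTensor (OpCop A)) := by
  have hcoc := DualQuasiBialgebra.cocycle (k := k) (A := A)
  set f₁ := (reassoc (k := k) (A := A)).val.ofConv ∘ₗ
    ((mul (k := k) (A := A)).toLinearMap.lTensor A).lTensor A with h₁
  set f₂ := (reassoc (k := k) (A := A)).val.ofConv ∘ₗ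
    (mul (k := k) (A := A)).toLinearMap.rTensor (A ⊗[k] A) ∘ₗ
      (TensorProduct.assoc k A A (A ⊗[k] A)).symm.toLinearMap with h₂
  set f₃ := (TensorProduct.lid k k).toLinearMap ∘ₗ
    TensorProduct.map (counit (R := k) (A := A)) (reassoc (k := k) (A := A)).val.ofConv with h₃
  set f₄ := (reassoc (k := k) (A := A)).val.ofConv ∘ₗ
    ((mul (k := k) (A := A)).toLinearMap.rTensor A ∘ₗ
      (TensorProduct.assoc k A A A).symm.toLinearMap).lTensor A with h₄
  set f₅ := (reassoc (k := k) (A := A)).val.ofConv ∘ₗ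
    (((TensorProduct.rid k A).toLinearMap ∘ₗ
      (counit (R := k) (A := A)).lTensor A).lTensor A).lTensor A with h₅
  have ext4 {V : Type u} [AddCommGroup V] [Module k V]
      {f g : OpCop A ⊗[k] (OpCop A ⊗[k] (OpCop A ⊗[k] OpCop A)) →ₗ[k] V}
      (h : ∀ x y z w, f (x ⊗ₜ (y ⊗ₜ (z ⊗ₜ w))) = g (x ⊗ₜ (y ⊗ₜ (z ⊗ₜ w)))) : f = g := by
    ext x y z w
    exact h x y z w
  have e₁ : (opReassoc k A).val.ofConv ∘ₗ
      ((opMul k A).toLinearMap.lTensor (OpCop A)).lTensor (OpCop A) = f₂ ∘ₗ flipFour k A := by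
    refine ext4 fun x y z w => ?_
    simp [opReassoc_val, h₂, opMul_tmul, flipThree_tmul, flipFour_tmul]
  have e₂ : (opReassoc k A).val.ofConv ∘ₗ
      (opMul k A).toLinearMap.rTensor (OpCop A ⊗[k] OpCop A) ∘ₗ
      (TensorProduct.assoc k (OpCop A) (OpCop A) (OpCop A ⊗[k] OpCop A)).symm.toLinearMap =
        f₁ ∘ₗ flipFour k A := by
    refine ext4 fun x y z w => ?_
    simp [opReassoc_val, h₁, opMul_tmul, flipThree_tmul, flipFour_tmul]
  have e₃ : (TensorProduct.lid k k).toLinearMap ∘ₗ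
      TensorProduct.map counit (opReassoc k A).val.ofConv = f₅ ∘ₗ flipFour k A := by
    refine ext4 fun x y z w => ?_
    simp [opReassoc_val, h₅, flipThree_tmul, flipFour_tmul, op_counit]
  have e₄ : (opReassoc k A).val.ofConv ∘ₗ ((opMul k A).toLinearMap.rTensor (OpCop A) ∘ₗ
      (TensorProduct.assoc k (OpCop A) (OpCop A) (OpCop A)).symm.toLinearMap).lTensor
        (OpCop A) = f₄ ∘ₗ flipFour k A := by
    refine ext4 fun x y z w => ?_
    simp [opReassoc_val, h₄, opMul_tmul, flipThree_tmul, flipFour_tmul]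
  have e₅ : (opReassoc k A).val.ofConv ∘ₗ (((TensorProduct.rid k (OpCop A)).toLinearMap ∘ₗ
      counit.lTensor (OpCop A)).lTensor (OpCop A)).lTensor (OpCop A) = f₃ ∘ₗ flipFour k A := by
    refine ext4 fun x y z w => ?_
    simp [opReassoc_val, h₃, flipThree_tmul, flipFour_tmul, op_counit]
  rw [e₁, e₂, e₃, e₄, e₅]
  rw [isAnti_flipFour.mul_comp, isAnti_flipFour.mul_comp, isAnti_flipFour.mul_comp, hcoc,
    WithConv.toConv_ofConv, mul_assoc]

instance : DualQuasiBialgebra k (OpCop A) where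
  mul := opMul k A
  unit := opUnit k A
  reassoc := opReassoc k A
  quasi_assoc := op_quasi_assoc
  one_mul := one_opMul
  mul_one := opMul_one
  cocycle := op_cocycle
  reassoc_one a b := by
    have := reassoc_one (k := k) (opEquiv k A b) (opEquiv k A a)
    rw [mul_comm, op_counit, op_counit] at this
    exact this

theorem one_opCop : DualQuasiBialgebra.one k (OpCop A) =
    (opEquiv k A).symm (DualQuasiBialgebra.one k A) := rfl

end Bialgebra

section Hopf

variable [DualQuasiHopfAlgebra k A]

open DualQuasiHopfAlgebra

/-- `∑ φ(c₁, β(c₂)S(c₃), α(c₄)c₅) = ε(c)`. -/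
theorem phi_antipode {ι : Type*} [Fintype ι] [DecidableEq ι] {C : ι → ι → A}
    (hC : IsComatrix k C) (i j) :
    ∑ l, ∑ m, ∑ a, ∑ b, α (C l m) * β (C a b) *
        phi k A (C i a) (antipode (k := k) (C b l)) (C m j) =
      (1 : Matrix ι ι k) i j := by
  rw [← psi_antipode hC]
  simp only [psi_comatrix hC, Finset.mul_sum, mul_assoc]

variable (k A) in
/-- The antipode of `A^{op,cop}`. -/
def opAntipode : OpCop A →ₗ[k] OpCop A :=
  (opEquiv k A).symm.toLinearMap ∘ₗ antipode ∘ₗ (opEquiv k A).toLinearMap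

theorem op_counit_antipode :
    Coalgebra.counit ∘ₗ opAntipode k A = (Coalgebra.counit : OpCop A →ₗ[k] k) :=
  LinearMap.ext fun x =>
    LinearMap.congr_fun (counit_antipode (k := k) (A := A)) (opEquiv k A x)

theorem isAnti_antipode : IsAnti (antipode (k := k) (A := A)) := ⟨comul_antipode, counit_antipode⟩

theorem op_comul_antipode : Coalgebra.comul ∘ₗ opAntipode k A =
    (TensorProduct.comm k (OpCop A) (OpCop A)).toLinearMap ∘ₗ
      TensorProduct.map (opAntipode k A) (opAntipode k A) ∘ₗ Coalgebra.comul := by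
  refine LinearMap.ext fun x => ?_
  have h := (isAnti_opEquiv_symm (k := k) (A := A)).comul_apply (antipode (k := k) (opEquiv k A x))
  have h2 := (isAnti_opEquiv (k := k) (A := A)).comul_apply x
  simp only [LinearEquiv.coe_coe] at h2
  rw [isAnti_antipode.comul_apply, h2] at h
  refine Eq.trans h ?_
  simp only [LinearMap.comp_apply, LinearEquiv.coe_coe]
  generalize Coalgebra.comul (R := k) x = y
  induction y with
  | zero => simp
  | tmul a b => simp [opAntipode]
  | add a b ha hb => simp only [map_add, ha, hb]

theorem mulHom_opCop (x y : OpCop A) :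
    mulHom k (OpCop A) x y = (opEquiv k A).symm (mulHom k A (opEquiv k A y) (opEquiv k A x)) := rfl

/-- Functionals on `A` as functionals on `A^{op,cop}`. -/
def opDual (p : A →ₗ[k] k) : OpCop A →ₗ[k] k := p ∘ₗ (opEquiv k A).toLinearMap

theorem op_antipode_left (x : OpCop A) :
    (DualQuasiBialgebra.mul (k := k) (A := OpCop A)).toLinearMap (TensorProduct.map
      (opAntipode k A) (convLeft (opDual (β (k := k) (A := A))) LinearMap.id)
        (Coalgebra.comul (R := k) x)) =
    opDual (β (k := k) (A := A)) x • DualQuasiBialgebra.one k (OpCop A) := by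
  refine LinearMap.congr_fun (f := (DualQuasiBialgebra.mul (k := k) (A := OpCop A)).toLinearMap ∘ₗ
    TensorProduct.map (opAntipode k A) (convLeft (opDual (β (k := k) (A := A))) LinearMap.id) ∘ₗ
      Coalgebra.comul)
    (g := (opDual (β (k := k) (A := A))).smulRight (DualQuasiBialgebra.one k (OpCop A)))
    (comatrix_ext fun n C hC i j => ?_) x
  have h := congrArg (opEquiv k A).symm (antipode_right_comatrix hC.ofOpCop j i)
  simp only [map_sum, map_smul, ← one_opCop] at h
  simp only [hC.comul, LinearMap.comp_apply, map_sum, TensorProduct.map_tmul, convLeft_comatrix hC,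
    TensorProduct.tmul_sum, TensorProduct.tmul_smul, map_smul, ← mulHom_apply,
    LinearMap.id_apply, mulHom_opCop]
  rw [Finset.sum_comm]
  exact h

theorem op_antipode_right (x : OpCop A) :
    (DualQuasiBialgebra.mul (k := k) (A := OpCop A)).toLinearMap (TensorProduct.map
      LinearMap.id (convLeft (opDual (α (k := k) (A := A))) (opAntipode k A))
        (Coalgebra.comul (R := k) x)) =
    opDual (α (k := k) (A := A)) x • DualQuasiBialgebra.one k (OpCop A) := by
  refine LinearMap.congr_fun (f := (DualQuasiBialgebra.mul (k := k) (A := OpCop A)).toLinearMap ∘ₗ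
    TensorProduct.map LinearMap.id (convLeft (opDual (α (k := k) (A := A))) (opAntipode k A)) ∘ₗ
      Coalgebra.comul)
    (g := (opDual (α (k := k) (A := A))).smulRight (DualQuasiBialgebra.one k (OpCop A)))
    (comatrix_ext fun n C hC i j => ?_) x
  have h := congrArg (opEquiv k A).symm (antipode_left_comatrix hC.ofOpCop j i)
  simp only [map_sum, map_smul, ← one_opCop] at h
  rw [Finset.sum_comm] at h
  simp only [hC.comul, LinearMap.comp_apply, map_sum, TensorProduct.map_tmul, convLeft_comatrix hC,
    TensorProduct.tmul_sum, TensorProduct.tmul_smul, map_smul, ← mulHom_apply,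
    LinearMap.id_apply, mulHom_opCop]
  exact h

theorem op_reassoc_antipode (x : OpCop A) :
    (DualQuasiBialgebra.reassoc (k := k) (A := OpCop A)).val.ofConv (TensorProduct.map
      (convRight LinearMap.id (opDual (α (k := k) (A := A)))) (TensorProduct.map (opAntipode k A)
        (convLeft (opDual (β (k := k) (A := A))) LinearMap.id) ∘ₗ Coalgebra.comul)
      (Coalgebra.comul (R := k) x)) =
    Coalgebra.counit (R := k) x := by
  refine LinearMap.congr_fun (f := (DualQuasiBialgebra.reassoc (k := k)
    (A := OpCop A)).val.ofConv ∘ₗ TensorProduct.map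
      (convRight LinearMap.id (opDual (α (k := k) (A := A)))) (TensorProduct.map (opAntipode k A)
        (convLeft (opDual (β (k := k) (A := A))) LinearMap.id) ∘ₗ Coalgebra.comul) ∘ₗ
          Coalgebra.comul)
    (g := Coalgebra.counit) (comatrix_ext fun n C hC i j => ?_) x
  have h := phi_antipode hC.ofOpCop j i
  rw [hC.counit, show (1 : Matrix (Fin n) (Fin n) k) i j = (1 : Matrix (Fin n) (Fin n) k) j i by
    simp [Matrix.one_apply, eq_comm], ← h]
  simp only [hC.comul, LinearMap.comp_apply, map_sum, TensorProduct.map_tmul, convLeft_comatrix hC,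
    convRight_comatrix hC,
    TensorProduct.tmul_sum, TensorProduct.sum_tmul, TensorProduct.tmul_smul,
    ← TensorProduct.smul_tmul', map_smul, ← phi_apply, smul_eq_mul, Finset.mul_sum,
    LinearMap.id_apply]
  refine Finset.sum_congr rfl fun _ _ => ?_
  refine (Finset.sum_congr rfl fun _ _ => Finset.sum_comm).trans (Finset.sum_comm.trans
    (Finset.sum_congr rfl fun _ _ => Finset.sum_comm.trans ?_))
  refine Finset.sum_congr rfl fun _ _ => Finset.sum_congr rfl fun _ _ => ?_
  rw [← mul_assoc, mul_comm (opDual _ _)]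
  rfl

theorem op_reassoc_inv_antipode (x : OpCop A) :
    (DualQuasiBialgebra.reassoc (k := k) (A := OpCop A)).inv.ofConv (TensorProduct.map
      (opAntipode k A) (TensorProduct.map (convLeft (opDual (β (k := k) (A := A))) LinearMap.id)
        (convLeft (opDual (α (k := k) (A := A))) (opAntipode k A)) ∘ₗ Coalgebra.comul)
      (Coalgebra.comul (R := k) x)) =
    Coalgebra.counit (R := k) x := by
  refine LinearMap.congr_fun (f := (DualQuasiBialgebra.reassoc (k := k)
    (A := OpCop A)).inv.ofConv ∘ₗ TensorProduct.map
      (opAntipode k A) (TensorProduct.map (convLeft (opDual (β (k := k) (A := A))) LinearMap.id)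
        (convLeft (opDual (α (k := k) (A := A))) (opAntipode k A)) ∘ₗ Coalgebra.comul) ∘ₗ
          Coalgebra.comul)
    (g := Coalgebra.counit) (comatrix_ext fun n C hC i j => ?_) x
  have h := phiInv_antipode hC.ofOpCop j i
  rw [hC.counit, show (1 : Matrix (Fin n) (Fin n) k) i j = (1 : Matrix (Fin n) (Fin n) k) j i by
    simp [Matrix.one_apply, eq_comm], ← h]
  simp only [hC.comul, LinearMap.comp_apply, map_sum, TensorProduct.map_tmul, convLeft_comatrix hC,
    TensorProduct.tmul_sum, TensorProduct.sum_tmul, TensorProduct.tmul_smul,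
    ← TensorProduct.smul_tmul', map_smul, ← phiInv_apply, smul_eq_mul, Finset.mul_sum,
    LinearMap.id_apply]
  refine (Finset.sum_congr rfl fun _ _ => Finset.sum_comm).trans (Finset.sum_comm.trans
    (Finset.sum_congr rfl fun _ _ => Finset.sum_comm.trans
      (Finset.sum_congr rfl fun _ _ => Finset.sum_comm.trans ?_)))
  refine Finset.sum_congr rfl fun _ _ => Finset.sum_congr rfl fun _ _ => ?_
  rw [← mul_assoc]
  rfl

/-- The antipode of `A^{op,cop}` is `S`, with the roles of `α` and `β` exchanged. -/
instance : DualQuasiHopfAlgebra k (OpCop A) where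
  antipode := opAntipode k A
  α := opDual (β (k := k) (A := A))
  β := opDual (α (k := k) (A := A))
  counit_antipode := op_counit_antipode
  comul_antipode := op_comul_antipode
  antipode_left := op_antipode_left
  antipode_right := op_antipode_right
  reassoc_antipode := op_reassoc_antipode
  reassoc_inv_antipode := op_reassoc_inv_antipode

end Hopf
end OpCop
end DualQuasi
end

noncomputable section
namespace DualQuasi

/-! ### Balanced forms -/

section Convolution

variable (k A : Type*) [Field k] [AddCommGroup A] [Module k A] [Coalgebra k A]

/-- The convolution product of functionals as a bilinear map. -/
def convBil : (A →ₗ[k] k) →ₗ[k] (A →ₗ[k] k) →ₗ[k] (A →ₗ[k] k) :=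
  LinearMap.mk₂ k (fun f g => (WithConv.toConv f * WithConv.toConv g : DualAlg k A).ofConv)
    (by intros; simp [add_mul])
    (by intros; simp [LinearMap.convMul_def, TensorProduct.map_smul_left, LinearMap.comp_smul,
      LinearMap.smul_comp])
    (by intros; simp [mul_add])
    (by intros; simp [LinearMap.convMul_def, TensorProduct.map_smul_right, LinearMap.comp_smul,
      LinearMap.smul_comp])

variable {k A}

theorem convBil_comatrix {ι : Type*} [Fintype ι] [DecidableEq ι] {C : ι → ι → A}
    (hC : IsComatrix k C) (f g : A →ₗ[k] k) (i j) :
    convBil k A f g (C i j) = ∑ l, f (C i l) * g (C l j) := by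
  simp [convBil, LinearMap.convMul_def, hC.comul]

end Convolution

section Pairing

variable {k A : Type u} [Field k] [AddCommGroup A] [Module k A] [Coalgebra k A]

/-- The condition `∑ c₁ B(c₂, a) = ∑ B(c, a₁) a₂` on a bilinear form `B`, in terms of comatrices. It
says that `c ↦ B(c, ·)` is a morphism of right `A^*`-modules, and that `a ↦ ∑ B(v₁, a) v₀` is
colinear for all elements `v` of right comodules. -/
def IsBalanced (B : A →ₗ[k] A →ₗ[k] k) : Prop :=
  ∀ ⦃n : ℕ⦄ ⦃C : Fin n → Fin n → A⦄, IsComatrix k C → ∀ ⦃m : ℕ⦄ ⦃D : Fin m → Fin m → A⦄,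
    IsComatrix k D → ∀ i j p q, ∑ l, B (C l j) (D p q) • C i l = ∑ r, B (C i j) (D p r) • D r q

theorem IsBalanced.of_coeff {B : A →ₗ[k] A →ₗ[k] k} (hB : IsBalanced B) {n : ℕ} {e : Fin n → A}
    {C : Fin n → Fin n → A} (h : (RightComod.regular k A).IsCoeff e C) {m : ℕ}
    {D : Fin m → Fin m → A} (hD : IsComatrix k D) (j p q) :
    ∑ l, B (C l j) (D p q) • e l = ∑ r, B (e j) (D p r) • D r q := by
  calc _ = ∑ i, Coalgebra.counit (R := k) (e i) • ∑ l, B (C l j) (D p q) • C i l := by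
        simp_rw [Finset.smul_sum]
        rw [Finset.sum_comm]
        refine Finset.sum_congr rfl fun l _ => ?_
        conv_lhs => rw [eq_sum_counit h l, Finset.smul_sum]
        exact Finset.sum_congr rfl fun i _ => smul_comm _ _ _
    _ = _ := by
        simp_rw [hB h.toIsComatrix hD, Finset.smul_sum]
        rw [Finset.sum_comm]
        refine Finset.sum_congr rfl fun r _ => ?_
        rw [eq_sum_counit h j, map_sum, LinearMap.sum_apply, Finset.sum_smul]
        simp only [map_smul, LinearMap.smul_apply, smul_smul, smul_eq_mul]

end Pairing

section Coordinates

variable {k A : Type u} [Field k] [AddCommGroup A] [Module k A] [Coalgebra k A]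
  {ι κ : Type} [Fintype ι] [Fintype κ] [DecidableEq κ] {C : ι → ι → A} {D : κ → κ → A}
  {f : ι → (A →ₗ[k] k)}

/-- The functionals `f i` are the coordinates of a colinear map from `A` to the comodule with
basis `ι` and coefficients `C`: `∑ f i (a₁) a₂ = ∑ j, f j (a) C i j`. -/
def IsCoordinate (f : ι → (A →ₗ[k] k)) (C : ι → ι → A) : Prop :=
  ∀ (m : ℕ) (D : Fin m → Fin m → A), IsComatrix k D → ∀ i p q,
    ∑ r, f i (D p r) • D r q = ∑ j, f j (D p q) • C i j

/-- A coordinate family at comatrices with arbitrary index type. -/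
theorem IsCoordinate.comatrix (hf : IsCoordinate f C) (hD : IsComatrix k D) (i p q) :
    ∑ r, f i (D p r) • D r q = ∑ j, f j (D p q) • C i j := by
  let e := Fintype.equivFin κ
  have hD' : IsComatrix k fun i j => D (e.symm i) (e.symm j) :=
    { comul := fun i j => by
        rw [hD.comul]
        exact Fintype.sum_equiv e _ _ fun x => by simp
      counit := fun i j => by simp [hD.counit, Matrix.one_apply] }
  have := hf _ _ hD' i (e p) (e q)
  simp only [Equiv.symm_apply_apply] at this
  rw [← this]
  exact Fintype.sum_equiv e _ _ fun x => by simp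

end Coordinates

/-! ### The injective balanced form of a nonzero right integral -/

section Hopf

variable {k A : Type u} [Field k] [AddCommGroup A] [Module k A] [Coalgebra k A]
  [DualQuasiHopfAlgebra k A]
local notation "𝟙A" => DualQuasiBialgebra.one k A
local notation "𝐒" => DualQuasiHopfAlgebra.antipode (k := k) (A := A)
local notation "𝛂" => DualQuasiHopfAlgebra.α (k := k) (A := A)

variable {ι κ : Type} [Fintype ι] [DecidableEq ι] [Fintype κ] [DecidableEq κ]
  {C : ι → ι → A} {D : κ → κ → A}

/-- `T` is a right integral if and only if `∑ T(a₁) a₂ = T(a) 1`, that is, if and only if it is a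
colinear map from `A` to the trivial comodule. -/
theorem isRightIntegral_iff {T : A →ₗ[k] k} : IsRightIntegral (WithConv.toConv T) ↔
    ∀ (n : ℕ) (D : Fin n → Fin n → A), IsComatrix k D → ∀ p q,
      ∑ r, T (D p r) • D r q = T (D p q) • 𝟙A := by
  have key (g : A →ₗ[k] k) (n : ℕ) (D : Fin n → Fin n → A) (hD : IsComatrix k D) (p q) :
      (WithConv.toConv T * WithConv.toConv g : DualAlg k A).ofConv (D p q) =
        g (∑ r, T (D p r) • D r q) := by
    simp [LinearMap.convMul_def, hD.comul]
  constructor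
  · intro h n D hD p q
    rw [← sub_eq_zero, ← Module.forall_dual_apply_eq_zero_iff k]
    intro g
    have h1 := congrArg (fun x : DualAlg k A => x.ofConv (D p q)) (h (WithConv.toConv g))
    simp only [key g n D hD] at h1
    rw [map_sub, h1]
    simp [mul_comm]
  · intro h p
    refine congrArg WithConv.toConv (comatrix_ext fun n D hD i j => ?_)
    have := key p.ofConv n D hD i j
    rw [h n D hD] at this
    exact this.trans (by simp [mul_comm])

/-- The defining property of right integrals at comatrices with arbitrary index type. -/
theorem integral_comatrix {T : A →ₗ[k] k} (hT : IsRightIntegral (WithConv.toConv T))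
    (hD : IsComatrix k D) (p q) : ∑ r, T (D p r) • D r q = T (D p q) • 𝟙A := by
  rw [← sub_eq_zero, ← Module.forall_dual_apply_eq_zero_iff k]
  intro g
  have h1 := congrArg (fun x : DualAlg k A => x.ofConv (D p q)) (hT (WithConv.toConv g))
  rw [map_sub]
  simp only [LinearMap.convMul_def, hD.comul, LinearMap.comp_apply, map_sum,
    TensorProduct.map_tmul, LinearMap.mul'_apply] at h1
  simp only [map_sum, map_smul, smul_eq_mul, h1, sub_eq_zero]
  exact mul_comm _ _

variable (k A) in
/-- The form `t(c, a) = ∑ χ(S(c₂), a₁) T(S(c₁)a₂)`. -/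
def tForm (T : A →ₗ[k] k) : A →ₗ[k] A →ₗ[k] k :=
  TensorProduct.lift ((convBil k A).compl₁₂ (chi k A ∘ₗ 𝐒) ((mulHom k A).compr₂ T ∘ₗ 𝐒)).flip ∘ₗ
    Coalgebra.comul

variable (k A) in
/-- The form `B(c, a) = ∑ t(c₂, a₁) Ψ(c₁, a₂)` attached to a right integral. It is
balanced because the factor `t` produces an invariant by `tForm_mul` and `Ψ` undoes the
multiplication by `S` by `psi_mul`. -/
def bForm (T : A →ₗ[k] k) : A →ₗ[k] A →ₗ[k] k :=
  TensorProduct.lift ((convBil k A).compl₁₂ (tForm k A T) (psi k A)).flip ∘ₗ Coalgebra.comul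

theorem tForm_comatrix (T : A →ₗ[k] k) (hC : IsComatrix k C) (hD : IsComatrix k D) (i j p q) :
    tForm k A T (C i j) (D p q) =
      ∑ l, ∑ r, chi k A (𝐒 (C l j)) (D p r) * T (mulHom k A (𝐒 (C i l)) (D r q)) := by
  simp [tForm, hC.comul, convBil_comatrix hD]

theorem bForm_comatrix (T : A →ₗ[k] k) (hC : IsComatrix k C) (hD : IsComatrix k D) (i j p q) :
    bForm k A T (C i j) (D p q) =
      ∑ l, ∑ r, tForm k A T (C l j) (D p r) * psi k A (C i l) (D r q) := by
  simp [bForm, hC.comul, convBil_comatrix hD]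

variable {T : A →ₗ[k] k}

/-- `∑ t(c₂, a₁) S(c₁)a₂ = t(c, a) 1`. -/
theorem tForm_mul (hT : IsRightIntegral (WithConv.toConv T)) (hC : IsComatrix k C)
    (hD : IsComatrix k D) (i j p q) :
    ∑ m, ∑ r, tForm k A T (C m j) (D p r) • mulHom k A (𝐒 (C i m)) (D r q) =
      tForm k A T (C i j) (D p q) • 𝟙A := by
  have h := fun l s => integral_comatrix hT (hC.antiMatrix.mul hD) (l, s) (i, q)
  simp only [Fintype.sum_prod_type, antiMatrix_apply] at h
  simp only [tForm_comatrix T hC hD, Finset.sum_smul]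
  rw [sum_comm_two_two]
  simp only [mul_smul, ← Finset.smul_sum, h]

/-- `∑ c₁ B(c₂, a) = ∑ B(c, a₁) a₂`, by `psi_mul` and `tForm_mul`. -/
theorem isBalanced_bForm (hT : IsRightIntegral (WithConv.toConv T)) :
    IsBalanced (bForm k A T) := by
  intro n C hC m D hD i j p q
  symm
  calc _ = ∑ l, ∑ s, tForm k A T (C l j) (D p s) • ∑ r, psi k A (C i l) (D s r) • D r q := by
        simp only [bForm_comatrix T hC hD, Finset.sum_smul, Finset.smul_sum, smul_smul]
        rw [← sum_comm_two_one]
    _ = ∑ a, ∑ m, ∑ r, psi k A (C a m) (D r q) • mulHom k A (C i a)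
          (∑ l, ∑ s, tForm k A T (C l j) (D p s) • mulHom k A (𝐒 (C m l)) (D s r)) := by
        simp only [← psi_mul hC hD, Finset.smul_sum, smul_smul, map_sum, map_smul]
        rw [sum_comm_two_three]
        simp only [mul_comm]
    _ = _ := by
        simp only [tForm_mul hT hC hD, map_smul, mulHom_one, bForm_comatrix T hC hD,
          Finset.sum_smul, smul_smul, mul_comm]

/-- `∑ α(c₁) B(c₂, a) = t(c, a)`: the form `t` is recovered from `B`. -/
theorem sum_alpha_bForm (hT : IsRightIntegral (WithConv.toConv T)) (hC : IsComatrix k C)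
    (hD : IsComatrix k D) (i j p q) :
    ∑ l, 𝛂 (C i l) * bForm k A T (C l j) (D p q) = tForm k A T (C i j) (D p q) := by
  calc _ = ∑ l, ∑ m, ∑ r, chi k A (C i l) (tForm k A T (C m j) (D p r) • 𝟙A) *
          psi k A (C l m) (D r q) := by
        simp only [bForm_comatrix T hC hD, map_smul, chi_one hC, Finset.mul_sum, smul_eq_mul]
        refine Finset.sum_congr rfl fun l _ => Finset.sum_congr rfl fun m _ =>
          Finset.sum_congr rfl fun r _ => by ring
    _ = ∑ n, ∑ s, tForm k A T (C n j) (D p s) * ∑ l, ∑ m, ∑ r,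
          chi k A (C i l) (mulHom k A (𝐒 (C m n)) (D s r)) * psi k A (C l m) (D r q) := by
        simp only [← tForm_mul hT hC hD, Finset.mul_sum, Finset.sum_mul, map_sum, map_smul,
          smul_eq_mul]
        rw [sum_comm_three_two]
        simp only [mul_assoc]
    _ = _ := by
        simp [chi_psi hC hD, Matrix.one_apply]

/-- `∑ t(c₃, S²(c₁)a₁) Ψ(S(c₂), a₂) = ε(c) T(a)`: the integral is recovered from `t`. -/
theorem sum_tForm_psi (hC : IsComatrix k C) (hD : IsComatrix k D) (i j p q) :
    ∑ l, ∑ m, ∑ r, tForm k A T (C l j) (mulHom k A (𝐒 (𝐒 (C i m))) (D p r)) *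
      psi k A (𝐒 (C m l)) (D r q) = (1 : Matrix ι ι k) i j * T (D p q) := by
  have hK := hC.antiMatrix
  have h1 := fun l m r => tForm_comatrix T hC (hK.antiMatrix.mul hD) l j (i, p) (m, r)
  simp only [Fintype.sum_prod_type, antiMatrix_apply] at h1
  have h2 := fun n x s => congrArg T (psi_mul hK hD n x s q)
  simp only [map_sum, map_smul, antiMatrix_apply, smul_eq_mul] at h2
  have h3 := fun r => chi_psi hK hD j i p r
  simp only [antiMatrix_apply] at h3
  calc _ = ∑ n, ∑ x, ∑ s, chi k A (𝐒 (C n j)) (mulHom k A (𝐒 (𝐒 (C i x))) (D p s)) *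
        ∑ l, ∑ m, ∑ r, psi k A (𝐒 (C m l)) (D r q) *
          T (mulHom k A (𝐒 (C l n)) (mulHom k A (𝐒 (𝐒 (C x m))) (D s r))) := by
        simp only [h1, Finset.sum_mul, Finset.mul_sum]
        rw [sum_comm_three_three]
        simp only [mul_assoc, mul_comm (psi k A _ _)]
    _ = ∑ r, T (D r q) * ∑ n, ∑ x, ∑ s, chi k A (𝐒 (C n j)) (mulHom k A (𝐒 (𝐒 (C i x))) (D p s)) *
          psi k A (𝐒 (C x n)) (D s r) := by
        simp only [h2, Finset.mul_sum]
        rw [sum_comm_three_one]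
        refine Finset.sum_congr rfl fun _ _ => Finset.sum_congr rfl fun _ _ =>
          Finset.sum_congr rfl fun _ _ => Finset.sum_congr rfl fun _ _ => by ring
    _ = _ := by
        simp only [h3]
        simp [Matrix.one_apply, eq_comm]

/-- If `B(c, ·) = 0` for `c = ∑ μ j e j`, where the `e j` are linearly independent with coefficients
`C`, then `∑ μ j B(C i j, ·) = 0` for all `i`, as `B` is balanced. As `t` is recovered from `B` and
`T` from `t`, the same combination of the `t(C i j, ·)` vanishes and then `μ i T = 0` for all `i`.
-/
theorem bForm_injective (hT : IsRightIntegral (WithConv.toConv T)) (hT0 : T ≠ 0) :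
    Function.Injective (bForm k A T) := by
  rw [injective_iff_map_eq_zero]
  intro c hc
  obtain ⟨n, (e : Fin n → A), C, he, hC, hm, -⟩ :=
    RightComod.exists_isCoeff (M := RightComod.regular k A) c
  obtain ⟨μ, hμ⟩ := (Submodule.mem_span_range_iff_exists_fun k).mp hm
  have hμ' : ∑ j, μ j • e j = c := hμ
  have h1 (i a) : ∑ j, μ j * bForm k A T (C i j) a = 0 := by
    suffices h : ∑ j, μ j • bForm k A T (C i j) = 0 by
      simpa using LinearMap.congr_fun h a
    refine comatrix_ext fun m D hD p q => ?_
    have h2 : ∑ l, (∑ j, μ j * bForm k A T (C l j) (D p q)) • e l = 0 := by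
      calc _ = ∑ j, μ j • ∑ l, bForm k A T (C l j) (D p q) • e l := by
            simp only [Finset.sum_smul, Finset.smul_sum, smul_smul]
            rw [Finset.sum_comm]
        _ = ∑ r, bForm k A T c (D p r) • D r q := by
            simp only [(isBalanced_bForm hT).of_coeff hC hD, ← hμ', Finset.smul_sum, map_sum,
              map_smul, LinearMap.sum_apply, LinearMap.smul_apply, Finset.sum_smul, smul_smul,
              smul_eq_mul]
            rw [Finset.sum_comm]
        _ = 0 := by simp [hc]
    simpa using Fintype.linearIndependent_iff.mp he _ h2 i
  have h3 (i : Fin n) (a) : ∑ j, μ j * tForm k A T (C i j) a = 0 := by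
    suffices h : ∑ j, μ j • tForm k A T (C i j) = 0 by
      simpa using LinearMap.congr_fun h a
    refine comatrix_ext fun m D hD p q => ?_
    calc _ = ∑ j, μ j * tForm k A T (C i j) (D p q) := by simp
      _ = ∑ l, 𝛂 (C i l) * ∑ j, μ j * bForm k A T (C l j) (D p q) := by
        simp only [← sum_alpha_bForm hT hC.toIsComatrix hD, Finset.mul_sum]
        rw [Finset.sum_comm]
        exact Finset.sum_congr rfl fun _ _ => Finset.sum_congr rfl fun _ _ => by ring
      _ = 0 := by simp [h1]
  have h4 (i : Fin n) : μ i • T = 0 := by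
    refine comatrix_ext fun m D hD p q => ?_
    calc μ i * T (D p q) = ∑ j, μ j * ((1 : Matrix (Fin n) (Fin n) k) i j * T (D p q)) := by
          simp [Matrix.one_apply]
      _ = ∑ l, ∑ x, ∑ r, (∑ j, μ j * tForm k A T (C l j)
            (mulHom k A (𝐒 (𝐒 (C i x))) (D p r))) * psi k A (𝐒 (C x l)) (D r q) := by
          simp only [← sum_tForm_psi hC.toIsComatrix hD, Finset.mul_sum, Finset.sum_mul]
          rw [← sum_comm_three_one]
          simp only [mul_assoc]
      _ = 0 := by simp [h3]
  have h5 (i) : μ i = 0 := (smul_eq_zero.mp (h4 i)).resolve_right hT0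
  rw [← hμ']
  simp [h5]

/-- A nonzero right integral yields an injective balanced form. -/
theorem exists_balanced_of_integral
    (h : ∃ T : DualAlg k A, T ≠ 0 ∧ IsRightIntegral T) :
    ∃ B : A →ₗ[k] A →ₗ[k] k, IsBalanced B ∧ Function.Injective B := by
  obtain ⟨T, hT0, hT⟩ := h
  exact ⟨bForm k A T.ofConv, isBalanced_bForm hT, bForm_injective hT fun h => hT0 (by
    rw [← WithConv.toConv_ofConv T, h]; rfl)⟩

/-! ### Integrals from colinear maps to finite dimensional comodules -/

section Coordinates

variable {f : ι → (A →ₗ[k] k)}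

variable (k A) in
/-- The functionals `G i (a) = ∑ f i (a₁) α(a₂)`. -/
def gCoord (f : ι → (A →ₗ[k] k)) (i : ι) : A →ₗ[k] k := convBil k A (f i) 𝛂

variable (k) in
/-- The right integrals `T i (a) = ∑ j l, Ψ(S(C j l), a₂) G l (S²(C i j) a₁)`. -/
def tCoord (f : ι → (A →ₗ[k] k)) (C : ι → ι → A) (i : ι) : A →ₗ[k] k :=
  ∑ l, ∑ j, convBil k A (gCoord k A f l ∘ₗ mulHom k A (𝐒 (𝐒 (C i j)))) (psi k A (𝐒 (C j l)))

theorem gCoord_comatrix (hD : IsComatrix k D) (i p q) :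
    gCoord k A f i (D p q) = ∑ r, f i (D p r) * 𝛂 (D r q) := convBil_comatrix hD _ _ _ _

/-- `∑ l, ∑ G l (a₁) S(C i l) a₂ = G i (a) 1`. -/
theorem gCoord_mul (hf : IsCoordinate f C) (hD : IsComatrix k D) (i p q) :
    ∑ l, ∑ r, gCoord k A f l (D p r) • mulHom k A (𝐒 (C i l)) (D r q) =
      gCoord k A f i (D p q) • 𝟙A := by
  calc _ = ∑ s, ∑ r, 𝛂 (D s r) • mulHom k A (𝐒 (∑ l, f l (D p s) • C i l)) (D r q) := by
        simp only [gCoord_comatrix hD, Finset.sum_smul, map_sum, map_smul, LinearMap.sum_apply,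
          LinearMap.smul_apply, Finset.smul_sum, smul_smul, mul_comm]
        rw [← sum_comm_two_one, Finset.sum_comm]
    _ = ∑ x, f i (D p x) • ∑ s, ∑ r, 𝛂 (D s r) • mulHom k A (𝐒 (D x s)) (D r q) := by
        simp only [← hf.comatrix hD, map_sum, map_smul, LinearMap.sum_apply,
          LinearMap.smul_apply, Finset.smul_sum, smul_smul, mul_comm]
        rw [sum_comm_two_one]
    _ = _ := by
        simp only [antipode_left_comatrix hD, gCoord_comatrix hD, smul_smul, Finset.sum_smul]

theorem tCoord_comatrix (hD : IsComatrix k D) (i p q) :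
    tCoord k f C i (D p q) = ∑ l, ∑ j, ∑ r, gCoord k A f l (mulHom k A (𝐒 (𝐒 (C i j))) (D p r)) *
      psi k A (𝐒 (C j l)) (D r q) := by
  simp [tCoord, LinearMap.sum_apply, convBil_comatrix hD]

/-- The proof is that of `isBalanced_bForm`, with `G` in place of `t`. -/
theorem isRightIntegral_tCoord (hC : IsComatrix k C) (hf : IsCoordinate f C) (i) :
    IsRightIntegral (WithConv.toConv (tCoord k f C i)) := by
  rw [isRightIntegral_iff]
  intro n D hD p q
  have hK := hC.antiMatrix
  have h1 := fun l s j q => psi_mul hK hD l j s q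
  simp only [antiMatrix_apply] at h1
  have h2 := fun a b r => gCoord_mul hf (hK.antiMatrix.mul hD) a (i, p) (b, r)
  simp only [Fintype.sum_prod_type, antiMatrix_apply] at h2
  calc _ = ∑ l, ∑ j, ∑ s, gCoord k A f l (mulHom k A (𝐒 (𝐒 (C i j))) (D p s)) •
          ∑ r, psi k A (𝐒 (C j l)) (D s r) • D r q := by
        simp only [tCoord_comatrix hD, Finset.sum_smul, Finset.smul_sum, smul_smul]
        rw [← sum_comm_three_one]
    _ = ∑ a, ∑ b, ∑ r, psi k A (𝐒 (C b a)) (D r q) • ∑ l, ∑ j, ∑ s,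
          gCoord k A f l (mulHom k A (𝐒 (𝐒 (C i j))) (D p s)) •
            mulHom k A (𝐒 (C a l)) (mulHom k A (𝐒 (𝐒 (C j b))) (D s r)) := by
        simp only [← h1, Finset.smul_sum, smul_smul]
        rw [sum_comm_three_three]
        simp only [mul_comm]
    _ = _ := by
        simp only [h2, tCoord_comatrix hD, Finset.sum_smul, smul_smul, mul_comm]

/-- `∑ j l, χ(S(C j l), a₁) T l (S(C i j) a₂) = G i (a)`. -/
theorem sum_chi_tCoord (hC : IsComatrix k C) (hD : IsComatrix k D) (i p q) :
    ∑ l, ∑ j, ∑ r, chi k A (𝐒 (C j l)) (D p r) *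
      tCoord k f C l (mulHom k A (𝐒 (C i j)) (D r q)) = gCoord k A f i (D p q) := by
  have hK := hC.antiMatrix
  have h1 := fun l j r => tCoord_comatrix (f := f) (C := C) (hK.mul hD) l (j, r) (i, q)
  simp only [Fintype.sum_prod_type, antiMatrix_apply] at h1
  have h2 := fun g m s t => congrArg (gCoord k A f g) (chi_mul hK hD m s p t)
  simp only [map_sum, map_smul, antiMatrix_apply, smul_eq_mul] at h2
  have h3 := fun g r => psi_chi hK hD g i r q
  simp only [antiMatrix_apply] at h3
  calc _ = ∑ g, ∑ m, ∑ s, ∑ t, psi k A (𝐒 (C m g)) (mulHom k A (𝐒 (C i s)) (D t q)) *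
        ∑ l, ∑ j, ∑ r, chi k A (𝐒 (C j l)) (D p r) * gCoord k A f g
          (mulHom k A (𝐒 (𝐒 (C l m))) (mulHom k A (𝐒 (C s j)) (D r t))) := by
        simp only [h1, Finset.mul_sum]
        rw [sum_comm_three_one]
        refine Finset.sum_congr rfl fun _ _ => ?_
        rw [sum_comm_three_three]
        refine Finset.sum_congr rfl fun _ _ => Finset.sum_congr rfl fun _ _ =>
          Finset.sum_congr rfl fun _ _ => Finset.sum_congr rfl fun _ _ =>
          Finset.sum_congr rfl fun _ _ => Finset.sum_congr rfl fun _ _ => by ring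
    _ = ∑ g, ∑ r, gCoord k A f g (D p r) * ∑ m, ∑ s, ∑ t, chi k A (𝐒 (C s m)) (D r t) *
          psi k A (𝐒 (C m g)) (mulHom k A (𝐒 (C i s)) (D t q)) := by
        simp only [h2, Finset.mul_sum]
        refine Finset.sum_congr rfl fun _ _ => ?_
        rw [sum_comm_three_one]
        refine Finset.sum_congr rfl fun _ _ => Finset.sum_congr rfl fun _ _ =>
          Finset.sum_congr rfl fun _ _ => Finset.sum_congr rfl fun _ _ => by ring
    _ = _ := by
        simp only [h3]
        simp [Matrix.one_apply]

/-- `∑ j, ∑ G j (a₁) Ψ(C i j, a₂) = f i (a)`. -/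
theorem sum_gCoord_psi (hf : IsCoordinate f C) (hD : IsComatrix k D)
    (i p q) : ∑ j, ∑ r, gCoord k A f j (D p r) * psi k A (C i j) (D r q) = f i (D p q) := by
  calc _ = ∑ s, ∑ r, 𝛂 (D s r) * psi k A (∑ j, f j (D p s) • C i j) (D r q) := by
        simp only [gCoord_comatrix hD, Finset.sum_mul, map_sum, map_smul, LinearMap.sum_apply,
          LinearMap.smul_apply, Finset.mul_sum, smul_eq_mul]
        rw [← sum_comm_two_one, Finset.sum_comm]
        refine Finset.sum_congr rfl fun _ _ => Finset.sum_congr rfl fun _ _ =>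
          Finset.sum_congr rfl fun _ _ => by ring
    _ = ∑ x, f i (D p x) * ∑ s, ∑ r, 𝛂 (D s r) * psi k A (D x s) (D r q) := by
        simp only [← hf.comatrix hD, map_sum, map_smul, LinearMap.sum_apply,
          LinearMap.smul_apply, Finset.mul_sum, smul_eq_mul]
        rw [sum_comm_two_one]
        refine Finset.sum_congr rfl fun _ _ => Finset.sum_congr rfl fun _ _ =>
          Finset.sum_congr rfl fun _ _ => by ring
    _ = _ := by
        simp only [psi_antipode hD]
        simp [Matrix.one_apply]

/-- A nonzero colinear map from `A` to a finite dimensional comodule yields a nonzero right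
integral: its coordinates are recovered from the functionals `G i`, and these from the integrals
`T i`. -/
theorem exists_integral_of_isCoordinate (hC : IsComatrix k C) (hf : IsCoordinate f C)
    (hf0 : f ≠ 0) : ∃ T : DualAlg k A, T ≠ 0 ∧ IsRightIntegral T := by
  by_contra hT
  push Not at hT
  have h1 (i) : tCoord k f C i = 0 := by
    by_contra h
    exact hT (WithConv.toConv (tCoord k f C i)) (fun h' => h (congrArg WithConv.ofConv h'))
      (isRightIntegral_tCoord hC hf i)
  have h2 (i) : gCoord k A f i = 0 := by
    refine comatrix_ext fun n D hD p q => ?_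
    rw [← sum_chi_tCoord hC hD]
    simp [h1]
  refine hf0 (funext fun i => comatrix_ext fun n D hD p q => ?_)
  rw [← sum_gCoord_psi hf hD]
  simp [h2]

end Coordinates

end Hopf

end DualQuasi
end

noncomputable section
namespace DualQuasi

variable {k A : Type u} [Field k] [AddCommGroup A] [Module k A] [Coalgebra k A]

namespace RightComod

/-! ### Comodules given by comatrices -/

/-- The comodule `k^ι` with coefficients `C`. -/
abbrev matComod {ι : Type} [Fintype ι] [DecidableEq ι] {C : ι → ι → A} (hC : IsComatrix k C) :
    RightComod k A :=
  ofCoeff (V := ι → k) (∑ j, (LinearMap.proj j : (ι → k) →ₗ[k] k).smulRight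
    (∑ i, (Pi.single i 1 : ι → k) ⊗ₜ[k] C i j)) <| by
    rw [← (Pi.basisFun k ι).span_eq]
    refine le_antisymm (by rw [(Pi.basisFun k ι).span_eq]; exact le_top) (Submodule.span_mono ?_)
    rintro _ ⟨j, rfl⟩
    refine ⟨ι, _, _, fun i => Pi.single i 1, C, hC, fun i => ?_, j, by simp⟩
    simp [LinearMap.sum_apply, Pi.single_apply]

theorem isCoeff_matComod {ι : Type} [Fintype ι] [DecidableEq ι] {C : ι → ι → A}
    (hC : IsComatrix k C) : (matComod hC).IsCoeff (fun i => (Pi.single i 1 : ι → k)) C where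
  toIsComatrix := hC
  coact_eq i := by simp [LinearMap.sum_apply, Pi.single_apply]

/-- The colinear map from the comodule with coefficients `C` given by a family with coefficients
`C`. -/
def matHom {ι : Type} [Fintype ι] [DecidableEq ι] {C : ι → ι → A} (hC : IsComatrix k C)
    {M : RightComod k A} {e : ι → M.carrier} (he : M.IsCoeff e C) : Hom (matComod hC) M where
  toLinearMap := Fintype.linearCombination k e
  colinear := by
    refine LinearMap.pi_ext' fun j => LinearMap.ext_ring ?_
    simp [Pi.single_apply, Fintype.linearCombination_apply, he.coact_eq]

/-- The identity map. -/
def Hom.id (M : RightComod k A) : Hom M M := 𝟙 M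

/-! ### Trivial comodules and tensor products -/

section Bialgebra

variable [DualQuasiBialgebra k A]

/-- The trivial comodule `v ↦ v ⊗ 1` on a vector space. -/
abbrev trivialOn (V : Type u) [AddCommGroup V] [Module k V] : RightComod k A :=
  ofCoeff (V := V) ((TensorProduct.mk k V A).flip (DualQuasiBialgebra.one k A)) <| by
    rw [eq_top_iff]
    intro v _
    exact Submodule.subset_span ⟨Unit, _, _, fun _ => v, _, isComatrix_one, fun _ => by simp, (),
      rfl⟩

/-- The coaction `m ⊗ n ↦ ∑ m₀ ⊗ n₀ ⊗ m₁n₁` of a tensor product. -/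
def tensorCoact (M N : RightComod k A) :
    M.carrier ⊗[k] N.carrier →ₗ[k] (M.carrier ⊗[k] N.carrier) ⊗[k] A :=
  (DualQuasiBialgebra.mul (k := k) (A := A)).toLinearMap.lTensor (M.carrier ⊗[k] N.carrier) ∘ₗ
    (TensorProduct.tensorTensorTensorComm k M.carrier A N.carrier A).toLinearMap ∘ₗ
      TensorProduct.map M.coact N.coact

theorem tensorCoact_tmul {M N : RightComod k A} {ι κ : Type*} [Fintype ι] [DecidableEq ι]
    [Fintype κ] [DecidableEq κ] {e : ι → M.carrier} {d : κ → N.carrier} {C : ι → ι → A}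
    {D : κ → κ → A} (hC : ∀ j, M.coact (e j) = ∑ i, e i ⊗ₜ[k] C i j)
    (hD : ∀ j, N.coact (d j) = ∑ i, d i ⊗ₜ[k] D i j) (i j) :
    tensorCoact M N (e i ⊗ₜ d j) = ∑ a : ι × κ, (e a.1 ⊗ₜ d a.2) ⊗ₜ[k]
      mulHom k A (C a.1 i) (D a.2 j) := by
  simp only [tensorCoact, LinearMap.comp_apply, TensorProduct.map_tmul, hC, hD,
    TensorProduct.sum_tmul, TensorProduct.tmul_sum, map_sum, LinearEquiv.coe_coe,
    TensorProduct.tensorTensorTensorComm_tmul, LinearMap.lTensor_tmul, Fintype.sum_prod_type]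
  rw [Finset.sum_comm]
  rfl

/-- The tensor product of two comodules. -/
abbrev tensor (M N : RightComod k A) : RightComod k A :=
  ofCoeff (tensorCoact M N) <| by
    rw [eq_top_iff, ← TensorProduct.map₂_mk_top_top_eq_top, ← M.span_hasCoeff, ← N.span_hasCoeff,
      Submodule.map₂_span_span]
    refine Submodule.span_mono ?_
    rintro _ ⟨_, ⟨ι, i1, i2, e, C, hC, he, i, rfl⟩, _, ⟨κ, j1, j2, d, D, hD, hd, j, rfl⟩, rfl⟩
    exact ⟨ι × κ, inferInstance, inferInstance, fun a => e a.1 ⊗ₜ d a.2, _, hC.mul hD,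
      fun a => tensorCoact_tmul he hd a.1 a.2, (i, j), rfl⟩

theorem IsCoeff.tmul {M N : RightComod k A} {ι κ : Type*} [Fintype ι] [DecidableEq ι]
    [Fintype κ] [DecidableEq κ] {e : ι → M.carrier} {d : κ → N.carrier} {C : ι → ι → A}
    {D : κ → κ → A} (hC : M.IsCoeff e C) (hD : N.IsCoeff d D) :
    (M.tensor N).IsCoeff (fun a : ι × κ => e a.1 ⊗ₜ d a.2)
      (fun a b => mulHom k A (C a.1 b.1) (D a.2 b.2)) where
  toIsComatrix := hC.toIsComatrix.mul hD.toIsComatrix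
  coact_eq a := tensorCoact_tmul hC.coact_eq hD.coact_eq a.1 a.2

/-- The tensor product of two colinear maps. -/
def tensorMap {M M' N N' : RightComod k A} (f : Hom M M') (g : Hom N N') :
    Hom (M.tensor N) (M'.tensor N') where
  toLinearMap := TensorProduct.map f.toLinearMap g.toLinearMap
  colinear := by
    refine tensor_ext fun n e C hC m d D hD i j => ?_
    have hf (j) : M'.coact (f.toLinearMap (e j)) = ∑ i, f.toLinearMap (e i) ⊗ₜ[k] C i j := by
      have := LinearMap.congr_fun f.colinear (e j)
      simpa [hC.coact_eq] using this
    have hg (j) : N'.coact (g.toLinearMap (d j)) = ∑ i, g.toLinearMap (d i) ⊗ₜ[k] D i j := by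
      have := LinearMap.congr_fun g.colinear (d j)
      simpa [hD.coact_eq] using this
    simp only [LinearMap.comp_apply, TensorProduct.map_tmul]
    rw [tensorCoact_tmul hf hg, tensorCoact_tmul hC.coact_eq hD.coact_eq]
    simp

end Bialgebra

/-! ### The duality for finite dimensional comodules -/

section Hopf

variable [DualQuasiHopfAlgebra k A]
local notation "𝐒" => DualQuasiHopfAlgebra.antipode (k := k) (A := A)

variable (k) in
/-- The form `χ` of `A^{op,cop}`. The coefficients of `P ⊗ F` involve multiplication by those of
`F` from the right, whereas `χ` and `Ψ` concern multiplication from the left. -/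
def chiOp (c : A) : A →ₗ[k] k :=
  chi k (OpCop A) ((opEquiv k A).symm c) ∘ₗ (opEquiv k A).symm.toLinearMap

variable (k) in
/-- The form `Ψ` of `A^{op,cop}`. -/
def psiOp (c : A) : A →ₗ[k] k :=
  psi k (OpCop A) ((opEquiv k A).symm c) ∘ₗ (opEquiv k A).symm.toLinearMap

variable {ι κ : Type} [Fintype ι] [DecidableEq ι] [Fintype κ] [DecidableEq κ]
  {C : ι → ι → A} {D : κ → κ → A}

theorem chiOp_mul (hC : IsComatrix k C) (hD : IsComatrix k D) (i j p q) :
    ∑ l, ∑ m, ∑ r, chiOp k (C m l) (D r p) • mulHom k A (mulHom k A (D q r) (C j m)) (𝐒 (C l i)) =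
      ∑ r, chiOp k (C j i) (D q r) • D r p :=
  chi_mul (hC.anti isAnti_opEquiv_symm) (hD.anti isAnti_opEquiv_symm) i j p q

theorem psiOp_mul (hC : IsComatrix k C) (hD : IsComatrix k D) (i j p q) :
    ∑ l, ∑ m, ∑ r, psiOp k (C m l) (D q r) • mulHom k A (mulHom k A (D r p) (𝐒 (C j m))) (C l i) =
      ∑ r, psiOp k (C j i) (D r p) • D q r :=
  psi_mul (hC.anti isAnti_opEquiv_symm) (hD.anti isAnti_opEquiv_symm) i j p q

/-- The identity behind the triangle identity `evLin_coevLin`: it is `psi_chi` over `A^{op,cop}`. -/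
theorem psiOp_chiOp (hC : IsComatrix k C) (hD : IsComatrix k D) (i j p q) :
    ∑ l, ∑ m, ∑ r, chiOp k (C m l) (D r p) * psiOp k (C l i) (mulHom k A (D q r) (C j m)) =
      (1 : Matrix ι ι k) i j * (1 : Matrix κ κ k) p q :=
  psi_chi (hC.anti isAnti_opEquiv_symm) (hD.anti isAnti_opEquiv_symm) i j p q

theorem ev_ext {X : RightComod k A} {V : Type*} [AddCommGroup V] [Module k V]
    {f g : (X.carrier ⊗[k] (ι → k)) ⊗[k] (κ → k) →ₗ[k] V}
    (h : ∀ (n : ℕ) (e : Fin n → X.carrier) (D : Fin n → Fin n → A), X.IsCoeff e D → ∀ r a b,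
      f ((e r ⊗ₜ Pi.single a 1) ⊗ₜ Pi.single b 1) = g ((e r ⊗ₜ Pi.single a 1) ⊗ₜ Pi.single b 1)) :
    f = g :=
  TensorProduct.ext <| TensorProduct.ext <| linearMap_ext fun n e D hD r =>
    LinearMap.pi_ext' fun a => LinearMap.ext_ring <| LinearMap.pi_ext' fun b =>
      LinearMap.ext_ring <| h n e D hD r a b

/-- The linear map underlying the evaluation `evMap`. -/
def evLin (C : ι → ι → A) (X : RightComod k A) :
    (X.carrier ⊗[k] (ι → k)) ⊗[k] (ι → k) →ₗ[k] X.carrier :=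
  ∑ i, ∑ j, X.act (psiOp k (C i j)) ∘ₗ slice X.carrier (LinearMap.proj i) ∘ₗ
    slice (X.carrier ⊗[k] (ι → k)) (LinearMap.proj j)

theorem evLin_tmul {X : RightComod k A} {μ : Type*} [Fintype μ] [DecidableEq μ]
    {e : μ → X.carrier} {D : μ → μ → A} (hD : X.IsCoeff e D) (r a b) :
    evLin C X ((e r ⊗ₜ Pi.single a 1) ⊗ₜ Pi.single b 1) =
      ∑ s, psiOp k (C a b) (D s r) • e s := by
  simp only [evLin, LinearMap.sum_apply, LinearMap.comp_apply, slice_tmul, map_smul,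
    LinearMap.proj_apply, Pi.single_apply]
  simp [hD.act_eq]

/-- The evaluation `(X ⊗ F*) ⊗ F → X`, `(x ⊗ i) ⊗ j ↦ ∑ Ψ°(C i j, x₁) x₀`. -/
def evMap (hC : IsComatrix k C) (X : RightComod k A) :
    Hom ((X.tensor (matComod hC.antiMatrix)).tensor (matComod hC)) X where
  toLinearMap := evLin C X
  colinear := by
    refine ev_ext fun n e D hD r a b => ?_
    have h := ((hD.tmul (isCoeff_matComod hC.antiMatrix)).tmul (isCoeff_matComod hC)).coact_eq
      ((r, a), b)
    simp only [LinearMap.comp_apply]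
    rw [h]
    simp only [map_sum, LinearMap.rTensor_tmul, evLin_tmul hD, map_smul, hD.coact_eq,
      Fintype.sum_prod_type, TensorProduct.sum_tmul, antiMatrix_apply]
    have h2 := fun s => psiOp_mul hC hD.toIsComatrix b a r s
    calc _ = ∑ t, e t ⊗ₜ[k] ∑ s, psiOp k (C a b) (D s r) • D t s := by
          simp only [Finset.smul_sum, TensorProduct.tmul_sum, TensorProduct.tmul_smul]
          rw [Finset.sum_comm]
      _ = _ := by
          simp only [← h2, TensorProduct.tmul_sum, TensorProduct.tmul_smul,
            ← TensorProduct.smul_tmul']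
          rw [sum_comm_three_one]
          refine Finset.sum_congr rfl fun _ _ => ?_
          rw [sum_comm_two_one]
          exact Finset.sum_congr rfl fun _ _ => Finset.sum_comm

theorem evLin_natural {X Y : RightComod k A} (f : Hom X Y) :
    evLin C Y ∘ₗ (f.toLinearMap.rTensor (ι → k)).rTensor (ι → k) = f.toLinearMap ∘ₗ evLin C X := by
  refine LinearMap.ext fun x => ?_
  simp [evLin, slice_rTensor, f.map_act]

/-- The linear map underlying the coevaluation `coevMap`. -/
def coevLin (C : ι → ι → A) (P : RightComod k A) :
    P.carrier →ₗ[k] (P.carrier ⊗[k] (ι → k)) ⊗[k] (ι → k) :=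
  ∑ i, ∑ j, (TensorProduct.mk k (P.carrier ⊗[k] (ι → k)) (ι → k)).flip (Pi.single j 1) ∘ₗ
    (TensorProduct.mk k P.carrier (ι → k)).flip (Pi.single i 1) ∘ₗ P.act (chiOp k (C i j))

theorem coevLin_apply {P : RightComod k A} {n : ℕ} {e : Fin n → P.carrier} {D : Fin n → Fin n → A}
    (hD : P.IsCoeff e D) (q) : coevLin C P (e q) = ∑ i, ∑ j, ∑ p, chiOp k (C i j) (D p q) •
      ((e p ⊗ₜ[k] (Pi.single i 1 : ι → k)) ⊗ₜ[k] (Pi.single j 1 : ι → k)) := by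
  simp [coevLin, LinearMap.sum_apply, hD.act_eq]

/-- The coevaluation `P → (P ⊗ F) ⊗ F*`, `p ↦ ∑ χ°(C i j, p₁) (p₀ ⊗ i) ⊗ j`. -/
def coevMap (hC : IsComatrix k C) (P : RightComod k A) :
    Hom P ((P.tensor (matComod hC)).tensor (matComod hC.antiMatrix)) where
  toLinearMap := coevLin C P
  colinear := by
    refine linearMap_ext fun n e D hD q => ?_
    have h := fun r a b => ((hD.tmul (isCoeff_matComod hC)).tmul
      (isCoeff_matComod hC.antiMatrix)).coact_eq ((r, a), b)
    simp only [LinearMap.comp_apply, coevLin_apply hD, map_sum, map_smul, hD.coact_eq,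
      LinearMap.rTensor_tmul, TensorProduct.sum_tmul]
    simp only [h, Fintype.sum_prod_type, antiMatrix_apply]
    have h2 := fun r a b => chiOp_mul hC hD.toIsComatrix b a q r
    calc _ = ∑ r, ∑ a, ∑ b, ((e r ⊗ₜ[k] (Pi.single a 1 : ι → k)) ⊗ₜ[k] (Pi.single b 1 : ι → k))
          ⊗ₜ[k] ∑ j, ∑ i, ∑ p, chiOp k (C i j) (D p q) •
            mulHom k A (mulHom k A (D r p) (C a i)) (𝐒 (C j b)) := by
          simp only [Finset.smul_sum, TensorProduct.tmul_sum, TensorProduct.tmul_smul]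
          rw [sum_comm_three_three]
          exact Finset.sum_congr rfl fun _ _ => Finset.sum_congr rfl fun _ _ =>
            Finset.sum_congr rfl fun _ _ => Finset.sum_comm
      _ = _ := by
          simp only [h2, TensorProduct.tmul_sum, TensorProduct.tmul_smul,
            ← TensorProduct.smul_tmul']
          rw [sum_comm_three_one]
          refine Finset.sum_congr rfl fun _ _ => ?_
          rw [← sum_comm_two_one]

/-- The triangle identity: the evaluation is inverse to the coevaluation tensored with `F`. -/
theorem evLin_coevLin (hC : IsComatrix k C) (P : RightComod k A) :
    evLin C (P.tensor (matComod hC)) ∘ₗ (coevLin C P).rTensor (ι → k) = LinearMap.id := by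
  refine TensorProduct.ext <| linearMap_ext fun n e D hD q => LinearMap.pi_ext' fun t =>
    LinearMap.ext_ring ?_
  have h := fun p i j => evLin_tmul (C := C) (hD.tmul (isCoeff_matComod hC)) (p, i) j t
  have h2 := fun s u => psiOp_chiOp hC hD.toIsComatrix t u q s
  change evLin C (P.tensor (matComod hC)) (coevLin C P (e q) ⊗ₜ[k] (Pi.single t 1 : ι → k)) =
    e q ⊗ₜ[k] (Pi.single t 1 : ι → k)
  simp only [coevLin_apply hD, TensorProduct.sum_tmul, map_sum, ← TensorProduct.smul_tmul',
    map_smul]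
  simp only [h, Fintype.sum_prod_type]
  calc _ = ∑ s, ∑ u, (∑ j, ∑ i, ∑ p, chiOp k (C i j) (D p q) *
        psiOp k (C j t) (mulHom k A (D s p) (C u i))) • (e s ⊗ₜ[k] (Pi.single u 1 : ι → k)) := by
        simp only [Finset.smul_sum, Finset.sum_smul, smul_smul]
        rw [sum_comm_three_two]
        exact Finset.sum_congr rfl fun _ _ => Finset.sum_congr rfl fun _ _ => Finset.sum_comm
    _ = _ := by
        simp only [h2]
        simp [Matrix.one_apply, ite_smul]

/-- As in any adjunction between `- ⊗ F` and `- ⊗ F*` whose right adjoint preserves surjections, `-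
⊗ F` preserves projectivity: `g : P ⊗ F → Y` corresponds to a colinear map `P → Y ⊗ F*`, and a lift
of the latter to `X ⊗ F*` yields a lift of `g` to `X`. -/
theorem IsProj.tensor_matComod {P : RightComod k A} (hP : P.IsProj) (hC : IsComatrix k C) :
    (P.tensor (matComod hC)).IsProj := by
  intro X Y π hπ g
  obtain ⟨h, hh⟩ := hP (tensorMap π (Hom.id (matComod hC.antiMatrix)))
    (TensorProduct.map_surjective hπ Function.surjective_id)
    ((tensorMap g (Hom.id (matComod hC.antiMatrix))).comp (coevMap hC P))
  refine ⟨(evMap hC X).comp (tensorMap h (Hom.id (matComod hC))), ?_⟩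
  have hh' : π.toLinearMap.rTensor (ι → k) ∘ₗ h.toLinearMap =
    g.toLinearMap.rTensor (ι → k) ∘ₗ coevLin C P := hh
  calc π.toLinearMap ∘ₗ evLin C X ∘ₗ h.toLinearMap.rTensor (ι → k)
      = evLin C Y ∘ₗ (π.toLinearMap.rTensor (ι → k) ∘ₗ h.toLinearMap).rTensor (ι → k) := by
        rw [← LinearMap.comp_assoc, ← evLin_natural, LinearMap.rTensor_comp, LinearMap.comp_assoc]
    _ = g.toLinearMap ∘ₗ evLin C (P.tensor (matComod hC)) ∘ₗ (coevLin C P).rTensor (ι → k) := by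
        rw [hh', LinearMap.rTensor_comp, ← LinearMap.comp_assoc, evLin_natural,
          LinearMap.comp_assoc]
    _ = g.toLinearMap := by rw [evLin_coevLin, LinearMap.comp_id]

end Hopf
end RightComod
end DualQuasi
end

noncomputable section
namespace DualQuasi

variable {k A : Type u} [Field k] [AddCommGroup A] [Module k A] [Coalgebra k A]

namespace RightComod

/-! ### Tensor products with a projective comodule -/

theorem IsStable.iSup {M : RightComod k A} {σ : Sort*} {N : σ → Submodule k M.carrier}
    (h : ∀ i, M.IsStable (N i)) : M.IsStable (⨆ i, N i) := by
  intro p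
  change _ ≤ (⨆ i, N i).comap (M.act p)
  exact iSup_le fun i => le_trans (fun m hm => h i p m hm) (Submodule.comap_mono (le_iSup N i))

theorem mem_map₂_of_lTensor_mkQ {V W : Type*} [AddCommGroup V] [Module k V] [AddCommGroup W]
    [Module k W] {N : Submodule k W} {x : V ⊗[k] W} (hx : N.mkQ.lTensor V x = 0) :
    x ∈ Submodule.map₂ (TensorProduct.mk k V W) ⊤ N := by
  rw [← LinearMap.mem_ker, lTensor_mkQ] at hx
  obtain ⟨y, rfl⟩ := hx
  induction y with
  | zero => simp
  | tmul v w => exact Submodule.apply_mem_map₂ _ trivial w.2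
  | add a b ha hb => rw [map_add]; exact add_mem ha hb

theorem lTensor_mkQ_of_mem {V W : Type*} [AddCommGroup V] [Module k V] [AddCommGroup W]
    [Module k W] {N : Submodule k W} {x : V ⊗[k] W}
    (hx : x ∈ Submodule.map₂ (TensorProduct.mk k V W) ⊤ N) : N.mkQ.lTensor V x = 0 := by
  have h : Submodule.map₂ (TensorProduct.mk k V W) ⊤ N ≤ LinearMap.ker (N.mkQ.lTensor V) := by
    rw [Submodule.map₂_le]
    intro v _ w hw
    simp [(Submodule.Quotient.mk_eq_zero N).mpr hw]
  exact h hx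

section Hopf

variable [DualQuasiHopfAlgebra k A]

/-- Pairs `(N, Γ)` such that `Γ` is the image of a colinear section over `P ⊗ N` of
`π : X → P ⊗ M`. As `Γ` determines the section, no compatibility of maps is needed to order these
pairs. -/
structure IsPartialSection {P M X : RightComod k A} (π : Hom X (P.tensor M))
    (z : Submodule k M.carrier × Submodule k X.carrier) : Prop where
  stable_left : M.IsStable z.1
  stable_right : X.IsStable z.2
  eq_zero : ∀ x ∈ z.2, π.toLinearMap x = 0 → x = 0
  map_eq : z.2.map π.toLinearMap = Submodule.map₂ (TensorProduct.mk k P.carrier M.carrier) ⊤ z.1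

/-- A partial section over `P ⊗ N` extends to `P ⊗ N'`, where `N' ⊇ N` is the preimage of a finite
dimensional subcomodule `F` of `M / N` containing the class of `m`. Indeed, `P ⊗ F` is projective,
so that its inclusion in `P ⊗ (M / N)` lifts to a colinear map `P ⊗ F → X`. -/
theorem IsPartialSection.exists_lt {P M X : RightComod k A} (hP : P.IsProj)
    {π : Hom X (P.tensor M)} (hπ : Function.Surjective π.toLinearMap)
    {z : Submodule k M.carrier × Submodule k X.carrier} (hz : IsPartialSection π z)
    {m : M.carrier} (hm : m ∉ z.1) : ∃ z', IsPartialSection π z' ∧ z ≤ z' ∧ m ∈ z'.1 := by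
  obtain ⟨N, Γ⟩ := z
  have hN := hz.stable_left
  simp only at hN hm
  let Q := M.quot N hN
  let μ := M.quotπ N hN
  obtain ⟨n, e, C, he, hC, hm', -⟩ := exists_isCoeff (M := Q) (μ.toLinearMap m)
  let ι := matHom hC.toIsComatrix hC
  have hι : Function.Injective ι.toLinearMap :=
    linearIndependent_iff_injective_fintypeLinearCombination.mp he
  obtain ⟨σ, hσ⟩ := hP.tensor_matComod hC.toIsComatrix ((tensorMap (Hom.id P) μ).comp π)
    ((TensorProduct.map_surjective Function.surjective_id N.mkQ_surjective).comp hπ)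
    (tensorMap (Hom.id P) ι)
  have hσ' (y) : N.mkQ.lTensor P.carrier (π.toLinearMap (σ.toLinearMap y)) =
      ι.toLinearMap.lTensor P.carrier y := LinearMap.congr_fun hσ y
  have hιm : m ∈ (LinearMap.range ι.toLinearMap).comap μ.toLinearMap := by
    obtain ⟨c, hc⟩ := (Submodule.mem_span_range_iff_exists_fun k).mp hm'
    exact ⟨c, (Fintype.linearCombination_apply k e c).trans hc⟩
  -- `π ∘ σ` and the identity agree modulo `P ⊗ N`
  have hdiff (p : P.carrier) (f) (x : M.carrier) (hx : ι.toLinearMap f = μ.toLinearMap x) :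
      π.toLinearMap (σ.toLinearMap (p ⊗ₜ f)) - p ⊗ₜ x ∈
        Submodule.map₂ (TensorProduct.mk k P.carrier M.carrier) ⊤ N := by
    apply mem_map₂_of_lTensor_mkQ
    rw [map_sub, hσ', LinearMap.lTensor_tmul, hx, LinearMap.lTensor_tmul]
    exact sub_self _
  have hNN : N ≤ (LinearMap.range ι.toLinearMap).comap μ.toLinearMap := by
    intro x hx
    rw [Submodule.mem_comap]
    have : μ.toLinearMap x = 0 := (Submodule.Quotient.mk_eq_zero N).mpr hx
    rw [this]
    exact zero_mem _
  refine ⟨((LinearMap.range ι.toLinearMap).comap μ.toLinearMap,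
    Γ ⊔ LinearMap.range σ.toLinearMap), ⟨?_, ?_, ?_, ?_⟩, ⟨hNN, le_sup_left⟩, hιm⟩
  · exact μ.isStable_comap ι.isStable_range
  · exact hz.stable_right.sup σ.isStable_range
  · intro x hx hx0
    obtain ⟨γ, hγ, _, ⟨y, rfl⟩, rfl⟩ := Submodule.mem_sup.mp hx
    have h1 : N.mkQ.lTensor P.carrier (π.toLinearMap γ) = 0 :=
      lTensor_mkQ_of_mem (hz.map_eq ▸ Submodule.mem_map_of_mem hγ)
    have h2 : ι.toLinearMap.lTensor P.carrier y = 0 := by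
      have := congrArg (N.mkQ.lTensor P.carrier) hx0
      rwa [map_add, map_add, h1, zero_add, hσ', map_zero] at this
    have h3 : y = 0 := (injective_iff_map_eq_zero _).mp
      (Module.Flat.lTensor_preserves_injective_linearMap ι.toLinearMap hι) y h2
    rw [h3, map_zero, add_zero] at hx0 ⊢
    exact hz.eq_zero γ hγ hx0
  · rw [Submodule.map_sup, hz.map_eq]
    refine le_antisymm (sup_le (Submodule.map₂_le_map₂_right hNN) ?_) ?_
    · rintro _ ⟨_, ⟨y, rfl⟩, rfl⟩
      induction y using TensorProduct.induction_on with
      | zero => simp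
      | tmul p f =>
        obtain ⟨x, hx⟩ := N.mkQ_surjective (ι.toLinearMap f)
        rw [← sub_add_cancel (π.toLinearMap (σ.toLinearMap (p ⊗ₜ f))) (p ⊗ₜ x)]
        exact add_mem (Submodule.map₂_le_map₂_right hNN (hdiff p f x hx.symm))
          (Submodule.apply_mem_map₂ _ trivial ⟨f, hx.symm⟩)
      | add a b ha hb =>
        simp only [map_add]
        exact add_mem ha hb
    · rw [Submodule.map₂_le]
      rintro p - x ⟨f, hf⟩
      rw [TensorProduct.mk_apply, ← sub_sub_cancel (π.toLinearMap (σ.toLinearMap (p ⊗ₜ f)))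
        (p ⊗ₜ x)]
      exact sub_mem (Submodule.mem_sup_right ⟨_, ⟨_, rfl⟩, rfl⟩)
        (Submodule.mem_sup_left (hdiff p f x hf))

/-- The tensor product of a projective comodule with any comodule is projective: by Zorn's lemma, a
surjection onto `P ⊗ M` has a maximal partial section, which is defined on all of `P ⊗ M`. -/
theorem IsProj.tensor {P : RightComod k A} (hP : P.IsProj) (M : RightComod k A) :
    (P.tensor M).IsProj := by
  refine isProj_of_split fun X π hπ => ?_
  obtain ⟨z, -, hz⟩ := zorn_le_nonempty₀ {z | IsPartialSection π z}
    (by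
      intro c hc hchain y hy
      have : Nonempty c := ⟨⟨y, hy⟩⟩
      refine ⟨(⨆ z : c, z.1.1, ⨆ z : c, z.1.2), ⟨?_, ?_, ?_, ?_⟩, fun z hz =>
        ⟨le_iSup (fun z : c => z.1.1) ⟨z, hz⟩, le_iSup (fun z : c => z.1.2) ⟨z, hz⟩⟩⟩
      · exact IsStable.iSup fun z => (hc z.2).stable_left
      · exact IsStable.iSup fun z => (hc z.2).stable_right
      · intro x hx
        have hdir : Directed (· ≤ ·) fun z : c => z.1.2 := fun a b => by
          rcases hchain.total a.2 b.2 with h | h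
          · exact ⟨b, h.2, le_rfl⟩
          · exact ⟨a, le_rfl, h.2⟩
        obtain ⟨z, hz⟩ := (Submodule.mem_iSup_of_directed _ hdir).mp hx
        exact (hc z.2).eq_zero x hz
      · simp only [Submodule.map_iSup, Submodule.map₂_iSup_right]
        exact iSup_congr fun z => (hc z.2).map_eq)
    (⊥, ⊥) ⟨fun p m hm => by simp_all, fun p m hm => by simp_all, fun x hx _ => by simpa using hx,
      by simp⟩
  have hz1 : z.1 = ⊤ := by
    rw [eq_top_iff]
    intro m _
    by_contra hm
    obtain ⟨z', hz', hle, hm'⟩ := hz.prop.exists_lt hP hπ hm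
    exact hm ((hz.le_of_ge hz' hle).1 hm')
  let f : z.2 →ₗ[k] (P.tensor M).carrier := π.toLinearMap ∘ₗ z.2.subtype
  have hf : Function.Bijective f := by
    constructor
    · rw [injective_iff_map_eq_zero]
      exact fun x hx => Subtype.ext (hz.prop.eq_zero x x.2 hx)
    · intro y
      have h : y ∈ z.2.map π.toLinearMap := by
        rw [hz.prop.map_eq, hz1, TensorProduct.map₂_mk_top_top_eq_top]
        trivial
      obtain ⟨x, hx, rfl⟩ := h
      exact ⟨⟨x, hx⟩, rfl⟩
  let E := LinearEquiv.ofBijective f hf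
  have hE (y) : π.toLinearMap (E.symm y) = y := E.apply_symm_apply y
  refine ⟨Hom.ofAct (z.2.subtype ∘ₗ E.symm.toLinearMap) fun p y => ?_, LinearMap.ext hE⟩
  rw [← sub_eq_zero]
  refine hz.prop.eq_zero _ (sub_mem (E.symm _).2 (hz.prop.stable_right p _ (E.symm y).2)) ?_
  rw [map_sub, Hom.map_act]
  simp only [LinearMap.comp_apply, Submodule.subtype_apply, LinearEquiv.coe_coe, hE, sub_self]

end Hopf
end RightComod
end DualQuasi
end

noncomputable section
namespace DualQuasi

variable {k A : Type u} [Field k] [AddCommGroup A] [Module k A] [Coalgebra k A]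

namespace RightComod

variable (k A) in
/-- The bilinear map `(p, g) ↦ (a ↦ ∑ p(a₁) g(a₂))`. -/
def convLeftBil : (A →ₗ[k] k) →ₗ[k] (A →ₗ[k] A) →ₗ[k] (A →ₗ[k] A) :=
  LinearMap.mk₂ k (fun p g => convLeft p g)
    (by intros; simp [convLeft, TensorProduct.map_add_left, LinearMap.comp_add, LinearMap.add_comp])
    (by intros; simp [convLeft, TensorProduct.map_smul_left, LinearMap.comp_smul,
      LinearMap.smul_comp])
    (by intros; simp [convLeft, TensorProduct.map_add_right, LinearMap.comp_add,
      LinearMap.add_comp])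
    (by intros; simp [convLeft, TensorProduct.map_smul_right, LinearMap.comp_smul,
      LinearMap.smul_comp])

theorem convLeftBil_apply (p : A →ₗ[k] k) (g : A →ₗ[k] A) : convLeftBil k A p g = convLeft p g :=
  rfl

section Hopf

variable [DualQuasiHopfAlgebra k A]

/-! ### The regular comodule as a direct summand of `P ⊗ A` -/

section Retract

local notation "𝐒" => DualQuasiHopfAlgebra.antipode (k := k) (A := A)

variable (k A) in
/-- The bilinear map `(c, a) ↦ ∑ χ(c₁, a₁) c₂a₂`. -/
def chiMul : A →ₗ[k] A →ₗ[k] A :=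
  TensorProduct.lift ((convLeftBil k A).compl₁₂ (chi k A) (mulHom k A)) ∘ₗ Coalgebra.comul

theorem chiMul_comatrix {ι κ : Type*} [Fintype ι] [DecidableEq ι] [Fintype κ] [DecidableEq κ]
    {C : ι → ι → A} {D : κ → κ → A} (hC : IsComatrix k C) (hD : IsComatrix k D) (i j p q) :
    chiMul k A (C i j) (D p q) =
      ∑ l, ∑ r, chi k A (C i l) (D p r) • mulHom k A (C l j) (D r q) := by
  simp [chiMul, hC.comul, convLeftBil_apply, convLeft_comatrix hD]

variable (k A) in
/-- The regular comodule, as a reducible definition: elements of its carrier are elements of `A`. -/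
abbrev reg : RightComod k A where
  carrier := A
  coact := Coalgebra.comul
  coassoc := Coalgebra.coassoc
  counit_coact := by ext; simp

/-- The linear map `p ⊗ a ↦ ∑ f(p₀) χ(p₁, a₁) p₂a₂` for a functional `f` on `P`. -/
def projLin {P : RightComod k A} (f : P.carrier →ₗ[k] k) : P.carrier ⊗[k] A →ₗ[k] A :=
  TensorProduct.lift (chiMul k A ∘ₗ (TensorProduct.lid k A).toLinearMap ∘ₗ f.rTensor A ∘ₗ P.coact)

theorem projLin_tmul {P : RightComod k A} (f : P.carrier →ₗ[k] k) {ι κ : Type*} [Fintype ι]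
    [DecidableEq ι] [Fintype κ] [DecidableEq κ] {e : ι → P.carrier} {C : ι → ι → A}
    {D : κ → κ → A} (hC : P.IsCoeff e C) (hD : IsComatrix k D) (j p q) :
    projLin f (e j ⊗ₜ D p q) = ∑ i, ∑ l, ∑ r, (f (e i) * chi k A (C i l) (D p r)) •
      mulHom k A (C l j) (D r q) := by
  simp [projLin, hC.coact_eq, chiMul_comatrix hC.toIsComatrix hD, Finset.smul_sum, smul_smul]

/-- The colinear map `P ⊗ A → A`, `p ⊗ a ↦ ∑ f(p₀) χ(p₁, a₁) p₂a₂`. -/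
def projHom {P : RightComod k A} (f : P.carrier →ₗ[k] k) :
    Hom (P.tensor (reg k A)) (reg k A) where
  toLinearMap := projLin f
  colinear := by
    refine TensorProduct.ext <| linearMap_ext fun n e C hC j => comatrix_ext fun m D hD p q => ?_
    change Coalgebra.comul (projLin f (e j ⊗ₜ D p q)) =
      (projLin f).rTensor A (tensorCoact P (reg k A) (e j ⊗ₜ D p q))
    have h := tensorCoact_tmul (N := reg k A) hC.coact_eq (d := fun q => D p q) (D := D)
      (hD.comul p) j q
    rw [h]
    simp only [projLin_tmul f hC hD, map_sum, map_smul, comul_mulHom hC.toIsComatrix hD,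
      LinearMap.rTensor_tmul, Fintype.sum_prod_type, Finset.smul_sum, TensorProduct.sum_tmul,
      TensorProduct.smul_tmul']
    exact sum_comm_three_two _

/-- The linear map `a ↦ ∑ Ψ(p₁, a₂) p₀ ⊗ S(p₂)a₁` for the element `p = e j` of a family in `P` with
coefficients `C`. -/
def inclLin {P : RightComod k A} {n : ℕ} (e : Fin n → P.carrier) (C : Fin n → Fin n → A)
    (j : Fin n) : A →ₗ[k] P.carrier ⊗[k] A :=
  ∑ i, ∑ l, TensorProduct.mk k P.carrier A (e i) ∘ₗ
    convRight (mulHom k A (𝐒 (C l j))) (psi k A (C i l))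

theorem inclLin_apply {P : RightComod k A} {n m : ℕ} {e : Fin n → P.carrier}
    {C : Fin n → Fin n → A} {D : Fin m → Fin m → A} (hD : IsComatrix k D) (j p q) :
    inclLin e C j (D p q) = ∑ i, ∑ l, ∑ r, psi k A (C i l) (D r q) •
      (e i ⊗ₜ[k] mulHom k A (𝐒 (C l j)) (D p r)) := by
  simp [inclLin, LinearMap.sum_apply, convRight_comatrix hD]

/-- The colinear map `A → P ⊗ A`, `a ↦ ∑ Ψ(p₁, a₂) p₀ ⊗ S(p₂)a₁` for the element `p = e j` of a
family in `P` with coefficients `C`. -/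
def inclHom {P : RightComod k A} {n : ℕ} {e : Fin n → P.carrier} {C : Fin n → Fin n → A}
    (hC : P.IsCoeff e C) (j : Fin n) : Hom (reg k A) (P.tensor (reg k A)) where
  toLinearMap := inclLin e C j
  colinear := by
    refine comatrix_ext fun m D hD p q => ?_
    change tensorCoact P (reg k A) (inclLin e C j (D p q)) =
      (inclLin e C j).rTensor A (Coalgebra.comul (D p q))
    have h (i l : Fin n) (r : Fin m) : tensorCoact P (reg k A)
        (e i ⊗ₜ mulHom k A (𝐒 (C l j)) (D p r)) = _ :=
      tensorCoact_tmul (N := reg k A) hC.coact_eq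
        (d := fun (x : Fin n × Fin m) => mulHom k A (𝐒 (C x.1 j)) (D p x.2))
        ((hC.toIsComatrix.antiMatrix.mul hD).comul (j, p)) i (l, r)
    rw [inclLin_apply hD, hD.comul]
    simp only [map_sum, map_smul, LinearMap.rTensor_tmul, inclLin_apply hD, h,
      Fintype.sum_prod_type, Finset.smul_sum, TensorProduct.sum_tmul, antiMatrix_apply]
    have h2 (a b r) : _ = _ :=
      congrArg ((e a ⊗ₜ[k] mulHom k A (𝐒 (C b j)) (D p r)) ⊗ₜ[k] ·)
        (psi_mul hC.toIsComatrix hD a b r q)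
    simp only [TensorProduct.tmul_sum, TensorProduct.tmul_smul] at h2
    rw [sum_comm_three_three]
    simp only [h2, ← TensorProduct.smul_tmul']
    exact sum_comm_three_one _

/-- The composite `A → P ⊗ A → A` is the multiplication by the scalar `f(p)`, by `psi_mul` and
`chi_psi`. -/
theorem projLin_inclLin {P : RightComod k A} (f : P.carrier →ₗ[k] k) {n : ℕ}
    {e : Fin n → P.carrier} {C : Fin n → Fin n → A} (hC : P.IsCoeff e C) (j : Fin n) :
    projLin f ∘ₗ inclLin e C j = f (e j) • LinearMap.id := by
  refine comatrix_ext fun m D hD p q => ?_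
  have hC' := hC.toIsComatrix
  have h (i l : Fin n) (r : Fin m) : projLin f (e i ⊗ₜ mulHom k A (𝐒 (C l j)) (D p r)) = _ :=
    projLin_tmul f hC (hC'.antiMatrix.mul hD) i (j, p) (l, r)
  have h2 (x y : Fin n) (s : Fin m) := psi_mul hC' hD y x s q
  rw [LinearMap.comp_apply, inclLin_apply hD]
  simp only [map_sum, map_smul, h, Fintype.sum_prod_type, antiMatrix_apply]
  calc _ = ∑ i, ∑ y, ∑ x, ∑ s, (f (e i) * chi k A (C i y) (mulHom k A (𝐒 (C x j)) (D p s))) •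
        ∑ l, ∑ t, ∑ r, psi k A (C l t) (D r q) •
          mulHom k A (C y l) (mulHom k A (𝐒 (C t x)) (D s r)) := by
        simp only [Finset.smul_sum]
        refine (sum_comm_three_one _).trans (Finset.sum_congr rfl fun i _ => ?_)
        refine (sum_comm_three_three _).trans ?_
        simp only [smul_comm (psi k A _ _)]
    _ = ∑ r, (∑ i, f (e i) * ∑ y, ∑ x, ∑ s, chi k A (C i y) (mulHom k A (𝐒 (C x j)) (D p s)) *
          psi k A (C y x) (D s r)) • D r q := by
        simp only [h2, Finset.smul_sum, Finset.sum_smul, Finset.mul_sum, smul_smul, mul_assoc]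
        exact (Finset.sum_congr rfl fun i _ => sum_comm_three_one _).trans Finset.sum_comm
    _ = _ := by
        simp [chi_psi hC' hD, Matrix.one_apply]

/-- If there is a nonzero projective comodule `P`, then the regular comodule is projective, being a
direct summand of `P ⊗ A`. -/
theorem IsProj.isProj_reg {P : RightComod k A} (hP : P.IsProj) (hP0 : Nontrivial P.carrier) :
    (reg k A).IsProj := by
  obtain ⟨p, hp⟩ := exists_ne (0 : P.carrier)
  obtain ⟨n, e, C, he, hC, hm, -⟩ := exists_isCoeff p
  have : ∃ j : Fin n, True := by
    by_contra h
    push Not at h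
    have : Set.range e = ∅ := Set.range_eq_empty_iff.mpr ⟨fun j => (h j).elim⟩
    rw [this, Submodule.span_empty] at hm
    exact hp hm
  obtain ⟨j, -⟩ := this
  obtain ⟨f, hf⟩ := Module.Projective.exists_dual_ne_zero k (he.ne_zero j)
  refine (hP.tensor (reg k A)).of_retract (inclHom hC j) (projHom ((f (e j))⁻¹ • f)) ?_
  refine (projLin_inclLin _ hC j).trans ?_
  simp [hf]

end Retract

end Hopf
end RightComod
end DualQuasi
end

noncomputable section
namespace DualQuasi

variable {k A : Type u} [Field k] [AddCommGroup A] [Module k A] [Coalgebra k A]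

/-! ### Balanced forms and module maps from `C` to `C^*` -/

theorem convMul_apply_right (f p : A →ₗ[k] k) (a : A) :
    (WithConv.toConv f * WithConv.toConv p : DualAlg k A).ofConv a =
      f (convRight LinearMap.id p a) := by
  have : LinearMap.mul' k k ∘ₗ TensorProduct.map f p =
      f ∘ₗ (TensorProduct.rid k A).toLinearMap ∘ₗ TensorProduct.map LinearMap.id p := by
    ext; simp [mul_comm]
  exact LinearMap.congr_fun this (Coalgebra.comul a)

theorem convMul_apply_left (p f : A →ₗ[k] k) (a : A) :
    (WithConv.toConv p * WithConv.toConv f : DualAlg k A).ofConv a =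
      f (convLeft p LinearMap.id a) := by
  have : LinearMap.mul' k k ∘ₗ TensorProduct.map p f =
      f ∘ₗ (TensorProduct.lid k A).toLinearMap ∘ₗ TensorProduct.map p LinearMap.id := by
    ext; simp
  exact LinearMap.congr_fun this (Coalgebra.comul a)

/-- A form is balanced if and only if `∑ p(c₁) B(c₂, a) = ∑ B(c, a₁) p(a₂)` for all functionals
`p`. -/
theorem isBalanced_iff {B : A →ₗ[k] A →ₗ[k] k} : IsBalanced B ↔
    ∀ (p : A →ₗ[k] k) (c a : A), B (convLeft p LinearMap.id c) a =
      B c (convRight LinearMap.id p a) := by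
  have h1 {n : ℕ} {C : Fin n → Fin n → A} (hC : IsComatrix k C) {m : ℕ} {D : Fin m → Fin m → A}
      (hD : IsComatrix k D) (g i j p q) : B (convLeft g LinearMap.id (C i j)) (D p q) =
        g (∑ l, B (C l j) (D p q) • C i l) ∧ B (C i j) (convRight LinearMap.id g (D p q)) =
        g (∑ r, B (C i j) (D p r) • D r q) := by
    simp [convLeft_comatrix hC, convRight_comatrix hD, LinearMap.sum_apply, mul_comm]
  constructor
  · intro hB p
    have : B ∘ₗ convLeft p LinearMap.id = B.compl₂ (convRight LinearMap.id p) := by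
      refine comatrix_ext fun n C hC i j => comatrix_ext fun m D hD s t => ?_
      exact (h1 hC hD p i j s t).1.trans ((congrArg p (hB hC hD i j s t)).trans
        (h1 hC hD p i j s t).2.symm)
    exact fun c a => LinearMap.congr_fun (LinearMap.congr_fun this c) a
  · intro h n C hC m D hD i j s t
    rw [← sub_eq_zero, ← Module.forall_dual_apply_eq_zero_iff k]
    intro g
    rw [map_sub, sub_eq_zero, ← (h1 hC hD g i j s t).1, ← (h1 hC hD g i j s t).2, h]

theorem isRightCoFrobenius_of_balanced {B : A →ₗ[k] A →ₗ[k] k} (hB : IsBalanced B)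
    (hi : Function.Injective B) : IsRightCoFrobenius k A := by
  refine ⟨{ toFun := fun c => WithConv.toConv (B c)
            map_add' := fun x y => congrArg WithConv.toConv (map_add B x y)
            map_smul' := fun p c => ?_ }, fun x y h => hi (congrArg WithConv.ofConv h)⟩
  refine congrArg WithConv.toConv (LinearMap.ext fun a => ?_)
  exact (isBalanced_iff.mp hB p.unop.ofConv c a).trans
    (convMul_apply_right (B c) p.unop.ofConv a).symm

theorem IsRightCoFrobenius.isRightQcF (h : IsRightCoFrobenius k A) : IsRightQcF k A := by
  obtain ⟨f, hf⟩ := h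
  exact ⟨PUnit, (Finsupp.lsingle PUnit.unit).comp f, (Finsupp.single_injective _).comp hf⟩

theorem smul_eq_counit_smul (r : k) (c : A) :
    r • c = MulOpposite.op (r • (1 : DualAlg k A)) • c := by
  change r • c = convLeft (r • (1 : DualAlg k A)).ofConv LinearMap.id c
  have h : convLeft (1 : DualAlg k A).ofConv LinearMap.id c = c :=
    one_smul (DualAlg k A)ᵐᵒᵖ c
  have h2 : convLeft (r • (1 : DualAlg k A)).ofConv LinearMap.id =
      r • convLeft (1 : DualAlg k A).ofConv LinearMap.id := by
    simp [convLeft, TensorProduct.map_smul_left, LinearMap.comp_smul, LinearMap.smul_comp]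
  rw [h2, LinearMap.smul_apply, h]

/-- A morphism of right `C^*`-modules from `C` to `C^*` is given by a balanced form. -/
theorem exists_balanced_of_linearMap (f : A →ₗ[(DualAlg k A)ᵐᵒᵖ] DualAlg k A) :
    ∃ B : A →ₗ[k] A →ₗ[k] k, IsBalanced B ∧ ∀ c, WithConv.toConv (B c) = f c := by
  refine ⟨{ toFun := fun c => (f c).ofConv
            map_add' := fun x y => congrArg WithConv.ofConv (map_add f x y)
            map_smul' := fun r c => ?_ }, isBalanced_iff.mpr fun p c a => ?_, fun c => rfl⟩
  · rw [smul_eq_counit_smul, map_smul]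
    change (f c * r • (1 : DualAlg k A)).ofConv = r • (f c).ofConv
    rw [mul_smul_comm, mul_one]
    rfl
  · change (f (MulOpposite.op (WithConv.toConv p) • c)).ofConv a = _
    rw [map_smul]
    exact convMul_apply_right (f c).ofConv p a

/-- A coordinate of an embedding of `A` in a free module gives a nonzero balanced form. -/
theorem exists_balanced_of_isRightQcF [Nontrivial A] (h : IsRightQcF k A) :
    ∃ B : A →ₗ[k] A →ₗ[k] k, IsBalanced B ∧ B ≠ 0 := by
  obtain ⟨ι, f, hf⟩ := h
  obtain ⟨c, hc⟩ := exists_ne (0 : A)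
  obtain ⟨x, hx⟩ := Finsupp.ne_iff.mp ((map_ne_zero_iff f hf).mpr hc)
  obtain ⟨B, hB, hBf⟩ := exists_balanced_of_linearMap ((Finsupp.lapply x).comp f)
  refine ⟨B, hB, fun h => hx ?_⟩
  have := hBf c
  rw [h] at this
  exact this.symm

/-- A nonzero balanced form gives a nonzero colinear map from `A`, as a left comodule, to a finite
dimensional left comodule: its coordinates are the functionals `B(·, e j)`, where the `e j` span a
right subcomodule of `A`. -/
theorem IsBalanced.exists_coordinate {B : A →ₗ[k] A →ₗ[k] k} (hB : IsBalanced B) (hB0 : B ≠ 0) :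
    ∃ (n : ℕ) (C : Fin n → Fin n → A) (f : Fin n → (A →ₗ[k] k)), IsComatrix k C ∧ f ≠ 0 ∧
      ∀ (m : ℕ) (D : Fin m → Fin m → A), IsComatrix k D → ∀ j p q,
        ∑ r, f j (D r p) • D q r = ∑ i, f i (D q p) • C i j := by
  obtain ⟨c, hc⟩ : ∃ c, B c ≠ 0 := by
    by_contra! h
    exact hB0 (LinearMap.ext h)
  obtain ⟨a, ha⟩ : ∃ a, B c a ≠ 0 := by
    by_contra! h
    exact hc (LinearMap.ext h)
  obtain ⟨n, (e : Fin n → A), C, -, hC, hm, -⟩ :=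
    RightComod.exists_isCoeff (M := RightComod.reg k A) a
  refine ⟨n, C, fun j => B.flip (e j), hC.toIsComatrix, fun h => ha ?_, fun m D hD j p q => ?_⟩
  · have h2 : Submodule.span k (Set.range e) ≤ LinearMap.ker (B c) :=
      Submodule.span_le.mpr (Set.range_subset_iff.mpr fun j =>
        LinearMap.congr_fun (congrFun h j) c)
    exact h2 hm
  · rw [← sub_eq_zero, ← Module.forall_dual_apply_eq_zero_iff k]
    intro g
    rw [map_sub, sub_eq_zero]
    have h1 := isBalanced_iff.mp hB g (D q p) (e j)
    have h2 : convRight LinearMap.id g (e j) = ∑ i, g (C i j) • e i := hC.act_eq g j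
    rw [h2, convLeft_comatrix hD, map_sum, map_sum, LinearMap.sum_apply] at h1
    simp only [map_smul, LinearMap.smul_apply, LinearMap.id_apply, smul_eq_mul] at h1
    simp only [map_sum, map_smul, smul_eq_mul, LinearMap.flip_apply]
    simpa only [mul_comm] using h1

end DualQuasi
end

noncomputable section
namespace DualQuasi

variable {k A : Type u} [Field k] [AddCommGroup A] [Module k A] [Coalgebra k A]

namespace RightComod

/-! ### Colinear maps from the regular comodule given by a balanced form -/

variable (M : RightComod k A)

/-- The bilinear map `(m, a) ↦ ∑ B(m₁, a) m₀`. -/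
def pairLin (B : A →ₗ[k] A →ₗ[k] k) : M.carrier →ₗ[k] A →ₗ[k] M.carrier :=
  LinearMap.mk₂ k (fun m a => M.act (B.flip a) m)
    (by simp) (by simp)
    (by intros; simp [act, slice, LinearMap.lTensor_add])
    (by intros; simp [act, slice, LinearMap.lTensor_smul])

variable {M} {B : A →ₗ[k] A →ₗ[k] k}

/-- The colinear map `a ↦ ∑ B(m₁, a) m₀` from the regular comodule. -/
def pairHom (hB : IsBalanced B) (m : M.carrier) : Hom (reg k A) M :=
  Hom.ofAct (M.pairLin B m) fun p (a : A) => by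
    change M.act (B.flip (convRight LinearMap.id p a)) m = M.act p (M.act (B.flip a) m)
    rw [act_act]
    congr 1
    congr 1
    refine LinearMap.ext fun c => ?_
    exact (isBalanced_iff.mp hB p c a).symm.trans (convMul_apply_left p (B.flip a) c).symm

theorem map_pairHom {N : RightComod k A} (f : Hom M N) (hB : IsBalanced B) (m : M.carrier) :
    f.toLinearMap ∘ₗ (pairHom hB m).toLinearMap = (pairHom hB (f.toLinearMap m)).toLinearMap :=
  LinearMap.ext fun _ => f.map_act _ m

theorem pairHom_sub (hB : IsBalanced B) (m n : M.carrier) :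
    (pairHom hB (m - n)).toLinearMap = (pairHom hB m).toLinearMap - (pairHom hB n).toLinearMap :=
  map_sub (M.pairLin B) m n

/-- An injective balanced form `B` detects the elements of comodules by the maps
`a ↦ ∑ B(m₁, a) m₀`. -/
theorem eq_zero_of_pairHom_eq_zero (hB : IsBalanced B) (hi : Function.Injective B) {m : M.carrier}
    (h : (pairHom hB m).toLinearMap = 0) : m = 0 := by
  obtain ⟨n, e, C, he, hC, hm, -⟩ := exists_isCoeff m
  obtain ⟨μ, rfl⟩ := (Submodule.mem_span_range_iff_exists_fun k).mp hm
  have h1 (a : A) : ∑ i, B (∑ j, μ j • C i j) a • e i = 0 := by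
    refine Eq.trans ?_ (LinearMap.congr_fun h a)
    change _ = M.act (B.flip a) _
    simp only [map_sum, map_smul, hC.act_eq, LinearMap.flip_apply, LinearMap.sum_apply,
      LinearMap.smul_apply, Finset.sum_smul, Finset.smul_sum, smul_smul, smul_eq_mul]
    exact Finset.sum_comm
  have h2 (i) : ∑ j, μ j • C i j = 0 := hi <| by
    rw [map_zero]
    exact LinearMap.ext fun a => Fintype.linearIndependent_iff.mp he _ (h1 a) i
  have h3 (i) : μ i = 0 := by
    have := congrArg (Coalgebra.counit (R := k)) (h2 i)
    simpa [hC.counit, Matrix.one_apply] using this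
  simp [h3]

/-- The maps `a ↦ ∑ B(m₁, a) m₀` are natural in `m`, so they distinguish different colinear maps. -/
theorem isSeparator_regular (hB : IsBalanced B) (hi : Function.Injective B) :
    IsSeparator (regular k A) := by
  rw [isSeparator_def]
  intro X Y f g h
  refine Hom.ext (LinearMap.ext fun m => ?_)
  rw [← sub_eq_zero]
  refine eq_zero_of_pairHom_eq_zero hB hi ?_
  rw [pairHom_sub, ← map_pairHom, ← map_pairHom, sub_eq_zero]
  exact congrArg Hom.toLinearMap (h (pairHom hB m))

section Bialgebra

variable [DualQuasiBialgebra k A]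

/-- Colinear maps from `A` to the trivial comodule `k` are right integrals. -/
theorem isRightIntegral_of_hom (f : Hom (reg k A) (trivialOn k)) :
    IsRightIntegral (WithConv.toConv f.toLinearMap) := by
  intro p
  refine congrArg WithConv.toConv (LinearMap.ext fun (a : A) => ?_)
  refine (convMul_apply_right f.toLinearMap p.ofConv a).trans ?_
  refine (f.map_act p.ofConv a).trans ?_
  simp [act]

/-- If `A` is a generator, some colinear map `A → k` distinguishes the identity of `k` from `0`. -/
theorem exists_integral_of_isSeparator (h : IsSeparator (regular k A)) :
    ∃ T : DualAlg k A, T ≠ 0 ∧ IsRightIntegral T := by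
  by_contra! hT
  have h1 := h.def (X := trivialOn k) (Y := trivialOn k) (𝟙 _) (Hom.mk 0 (by simp)) fun f => by
    have hf : Hom.toLinearMap f = 0 := by
      by_contra hf
      exact hT (WithConv.toConv (Hom.toLinearMap f)) (fun h0 => hf (congrArg WithConv.ofConv h0))
        (isRightIntegral_of_hom f)
    refine Hom.ext ?_
    change LinearMap.id ∘ₗ Hom.toLinearMap f = 0 ∘ₗ Hom.toLinearMap f
    rw [hf, LinearMap.comp_zero, LinearMap.comp_zero]
  have h2 := LinearMap.congr_fun (congrArg Hom.toLinearMap h1) (1 : k)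
  exact one_ne_zero h2

/-! ### A finite dimensional projective comodule -/

/-- A nonzero colinear map `q : F → k` which factors through all surjections to `k`. -/
structure IsLifting {F : RightComod k A} (q : Hom F (trivialOn k)) : Prop where
  ne_zero : q.toLinearMap ≠ 0
  exists_lift : ∀ (X : RightComod k A) (π : Hom X (trivialOn k)),
    Function.Surjective π.toLinearMap →
      ∃ g : Hom F X, π.toLinearMap ∘ₗ g.toLinearMap = q.toLinearMap

/-- The map `a ↦ ∑ B(m₁, a) m₀` for `m = 1 ∈ k` factors through any surjection `π : X → k`, namely
through the corresponding map for some `x` with `π(x) = 1`. It remains nonzero on a finite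
dimensional subcomodule of `A`. -/
theorem exists_isLifting (hB : IsBalanced B) (hi : Function.Injective B) :
    ∃ (F : RightComod k A) (q : Hom F (trivialOn k)), Module.Finite k F.carrier ∧ IsLifting q := by
  let q := pairHom hB (M := trivialOn k) (1 : k)
  have hq : q.toLinearMap ≠ 0 := fun h =>
    one_ne_zero (eq_zero_of_pairHom_eq_zero hB hi (M := trivialOn k) h)
  obtain ⟨a, ha⟩ : ∃ a, q.toLinearMap a ≠ 0 := by
    by_contra! h
    exact hq (LinearMap.ext h)
  have hs : (reg k A).IsStable ((reg k A).orbit a) := fun p m hm => act_mem_orbit hm p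
  let i := (reg k A).subι _ hs
  refine ⟨(reg k A).sub _ hs, q.comp i, finite_orbit (M := reg k A) a, fun h => ha ?_,
    fun X π hπ => ?_⟩
  · exact LinearMap.congr_fun h ⟨a, self_mem_orbit (M := reg k A) a⟩
  · obtain ⟨x, hx⟩ := hπ (1 : k)
    refine ⟨(pairHom hB x).comp i, ?_⟩
    rw [Hom.comp_toLinearMap, ← LinearMap.comp_assoc, map_pairHom, hx]
    rfl

/-- If `q : F → k` is lifting with `F` of minimal dimension, any endomorphism `e` of `F` with `q ∘ e
= q` is bijective. For a surjection `π : X → F`, a lift `g : F → X` of `q` through `q ∘ π` gives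
such an endomorphism `e = π ∘ g`, and `g ∘ e⁻¹` is a section of `π`. -/
theorem IsLifting.isProj_of_minimal {F : RightComod k A} {q : Hom F (trivialOn k)}
    (hq : IsLifting q) (hF : Module.Finite k F.carrier)
    (hmin : ∀ (F' : RightComod k A) (q' : Hom F' (trivialOn k)), Module.Finite k F'.carrier →
      IsLifting q' → Module.finrank k F.carrier ≤ Module.finrank k F'.carrier) : F.IsProj := by
  refine isProj_of_split fun X π hπ => ?_
  have hqs : Function.Surjective q.toLinearMap := LinearMap.surjective hq.ne_zero
  obtain ⟨g, hg⟩ := hq.exists_lift X (q.comp π) (hqs.comp hπ)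
  let e := π.comp g
  have he : q.toLinearMap ∘ₗ e.toLinearMap = q.toLinearMap := hg
  -- the restriction of `q` to the image of `e` is again a lifting map
  have hs := e.isStable_range
  let i := F.subι _ hs
  have hi : IsLifting (q.comp i) := by
    refine ⟨fun h => hq.ne_zero ?_, fun Y ρ hρ => ?_⟩
    · rw [← he]
      exact LinearMap.ext fun x => LinearMap.congr_fun h ⟨e.toLinearMap x, x, rfl⟩
    · obtain ⟨l, hl⟩ := hq.exists_lift Y ρ hρ
      exact ⟨l.comp i, congrArg (· ∘ₗ i.toLinearMap) hl⟩
  have htop : LinearMap.range e.toLinearMap = ⊤ :=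
    Submodule.eq_top_of_finrank_eq (le_antisymm (Submodule.finrank_le _)
      (hmin _ _ (inferInstanceAs (Module.Finite k (LinearMap.range e.toLinearMap))) hi))
  have hsurj := LinearMap.range_eq_top.mp htop
  let E := LinearEquiv.ofBijective e.toLinearMap
    ⟨LinearMap.injective_iff_surjective.mpr hsurj, hsurj⟩
  have hE (y) : e.toLinearMap (E.symm y) = y := E.apply_symm_apply y
  refine ⟨g.comp (Hom.ofAct E.symm.toLinearMap fun p m => E.injective ?_), LinearMap.ext hE⟩
  change e.toLinearMap (E.symm _) = e.toLinearMap (F.act p (E.symm m))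
  rw [hE, e.map_act, hE]

/-- An injective balanced form yields a nonzero projective comodule. -/
theorem exists_isProj (hB : IsBalanced B) (hi : Function.Injective B) :
    ∃ F : RightComod k A, F.IsProj ∧ Nontrivial F.carrier := by
  classical
  have h : ∃ n : ℕ, ∃ (F : RightComod k A) (q : Hom F (trivialOn k)),
      Module.Finite k F.carrier ∧ IsLifting q ∧ Module.finrank k F.carrier = n := by
    obtain ⟨F, q, hF, hq⟩ := exists_isLifting hB hi
    exact ⟨_, F, q, hF, hq, rfl⟩
  obtain ⟨F, q, hF, hq, hn⟩ := Nat.find_spec h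
  refine ⟨F, hq.isProj_of_minimal hF fun F' q' hF' hq' => ?_, ?_⟩
  · rw [hn]
    exact Nat.find_min' h ⟨F', q', hF', hq', rfl⟩
  · by_contra hF0
    rw [not_nontrivial_iff_subsingleton] at hF0
    exact hq.ne_zero (LinearMap.ext fun x => by rw [Subsingleton.elim x 0, map_zero, map_zero])

end Bialgebra

section Hopf

variable [DualQuasiHopfAlgebra k A]

theorem tensorCoact_trivialOn {V : Type u} [AddCommGroup V] [Module k V] (a : A) (v : V) :
    tensorCoact (reg k A) (trivialOn V) (a ⊗ₜ v) =
      ((TensorProduct.mk k A V).flip v).rTensor A (Coalgebra.comul a) := by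
  change LinearMap.lTensor _ _ (TensorProduct.tensorTensorTensorComm k A A V A
    (Coalgebra.comul a ⊗ₜ (v ⊗ₜ DualQuasiBialgebra.one k A))) = _
  generalize Coalgebra.comul (R := k) a = y
  induction y with
  | zero => simp
  | tmul b c =>
    rw [TensorProduct.tensorTensorTensorComm_tmul, LinearMap.lTensor_tmul, LinearMap.rTensor_tmul]
    exact congrArg _ (DualQuasiBialgebra.mul_one c)
  | add b c hb hc => rw [TensorProduct.add_tmul, map_add, map_add, hb, hc, map_add]

/-- The colinear map `a ⊗ m ↦ ∑ B(m₁, a) m₀`, where the factor `M` of the source is a trivial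
comodule. -/
def pairTensorHom (M : RightComod k A) (hB : IsBalanced B) :
    Hom ((reg k A).tensor (trivialOn M.carrier)) M where
  toLinearMap := TensorProduct.lift (M.pairLin B).flip
  colinear := by
    refine TensorProduct.ext' fun (a : A) m => ?_
    refine (LinearMap.congr_fun (pairHom (M := M) hB m).colinear a).trans ?_
    refine Eq.trans ?_ (congrArg (LinearMap.rTensor A _) (tensorCoact_trivialOn a m)).symm
    rw [← LinearMap.rTensor_comp_apply]
    rfl

/-- In the cokernel of `a ⊗ m ↦ ∑ B(m₁, a) m₀`, all maps `a ↦ ∑ B(m₁, a) m₀` vanish. -/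
theorem pairTensorHom_surjective (hB : IsBalanced B) (hi : Function.Injective B) :
    Function.Surjective (pairTensorHom M hB).toLinearMap := by
  rw [← LinearMap.range_eq_top]
  have hs := (pairTensorHom M hB).isStable_range
  rw [eq_top_iff]
  intro m _
  rw [← Submodule.Quotient.mk_eq_zero]
  refine eq_zero_of_pairHom_eq_zero (M := M.quot _ hs) hB hi ?_
  refine (map_pairHom (M.quotπ _ hs) hB m).symm.trans (LinearMap.ext fun (a : A) => ?_)
  exact (Submodule.Quotient.mk_eq_zero _).mpr ⟨a ⊗ₜ m, rfl⟩

/-- Every comodule `M` is a quotient of the projective comodule `A ⊗ M`, with `M` taken trivial. -/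
theorem isRightSemiperfect_of_balanced (hB : IsBalanced B) (hi : Function.Injective B) :
    IsRightSemiperfect k A := by
  obtain ⟨F, hF, hF0⟩ := exists_isProj hB hi
  refine ⟨fun M => ⟨?_⟩⟩
  have h1 := projective_iff.mpr ((hF.isProj_reg hF0).tensor (trivialOn M.carrier))
  have h2 := (epi_iff_surjective (M := (reg k A).tensor (trivialOn M.carrier)) (N := M)
    (pairTensorHom M hB)).mpr (pairTensorHom_surjective hB hi)
  exact { p := _, f := _, projective := h1, epi := h2 }

theorem projective_regular_of_semiperfect (h : IsRightSemiperfect k A) :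
    Projective (regular k A) := by
  obtain ⟨P⟩ := h.presentation (trivialOn k)
  refine projective_iff.mpr ((projective_iff.mp P.projective).isProj_reg ?_)
  have := (epi_iff_surjective P.f).mp P.epi
  exact this.nontrivial

end Hopf

end RightComod
end DualQuasi
end

noncomputable section
namespace DualQuasi

variable {k A : Type u} [Field k] [AddCommGroup A] [Module k A] [Coalgebra k A]

namespace RightComod

/-! ### Projectivity of the regular comodule -/

section Cover

/-- The direct sum of the comodules `k^(n a)` with coefficients `C a`, as the comodule of finitely
supported functions on the disjoint union of the bases. -/
abbrev sigmaComod {σ : Type u} {n : σ → ℕ} {C : ∀ a, Fin (n a) → Fin (n a) → A}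
    (hC : ∀ a, IsComatrix k (C a)) : RightComod k A :=
  ofCoeff (V := (Σ a, Fin (n a)) →₀ k) (Finsupp.lsum k fun x => LinearMap.toSpanSingleton k _
    (∑ i, Finsupp.single ⟨x.1, i⟩ (1 : k) ⊗ₜ[k] C x.1 i x.2)) <| by
    rw [← (Finsupp.basisSingleOne (R := k) (ι := Σ a, Fin (n a))).span_eq]
    refine le_antisymm (by rw [Module.Basis.span_eq]; exact le_top) (Submodule.span_mono ?_)
    rintro _ ⟨⟨a, j⟩, rfl⟩
    exact ⟨Fin (n a), _, _, fun i => Finsupp.single ⟨a, i⟩ 1, C a, hC a, fun i => by simp, j,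
      by simp⟩

variable {σ : Type u} {n : σ → ℕ} {C : ∀ a, Fin (n a) → Fin (n a) → A}

/-- The colinear map from a direct sum given by families with coefficients `C a`. -/
def sigmaHom (hC : ∀ a, IsComatrix k (C a)) {M : RightComod k A} {e : ∀ a, Fin (n a) → M.carrier}
    (he : ∀ a, M.IsCoeff (e a) (C a)) : Hom (sigmaComod hC) M where
  toLinearMap := Finsupp.linearCombination k fun x : Σ a, Fin (n a) => e x.1 x.2
  colinear := by
    refine Finsupp.lhom_ext' fun x => LinearMap.ext_ring ?_
    simp [(he x.1).coact_eq]

/-- The `(a, i)` coordinate of the coaction of a direct sum. -/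
theorem lapply_coact (hC : ∀ a, IsComatrix k (C a)) (a : σ) (i : Fin (n a))
    (x : (Σ a, Fin (n a)) →₀ k) :
    (Finsupp.lapply (⟨a, i⟩ : Σ a, Fin (n a)) : _ →ₗ[k] k).rTensor A ((sigmaComod hC).coact x) =
      (1 : k) ⊗ₜ ∑ j, x ⟨a, j⟩ • C a i j := by
  refine LinearMap.congr_fun
    (f := (Finsupp.lapply (⟨a, i⟩ : Σ a, Fin (n a)) : _ →ₗ[k] k).rTensor A ∘ₗ (sigmaComod hC).coact)
    (g := TensorProduct.mk k k A 1 ∘ₗ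
      ∑ j, (Finsupp.lapply (⟨a, j⟩ : Σ a, Fin (n a)) : _ →ₗ[k] k).smulRight (C a i j))
    ?_ x |>.trans ?_
  · refine Finsupp.lhom_ext' fun ⟨b, l⟩ => LinearMap.ext_ring ?_
    by_cases h : b = a
    · subst h
      have hj (l j : Fin (n b)) : (Finsupp.single (⟨b, l⟩ : Σ a, Fin (n a)) (1 : k)) ⟨b, j⟩ =
          if l = j then 1 else 0 := by
        classical
        simp [Finsupp.single_apply]
      simp [hj, TensorProduct.ite_tmul]
    · simp [h]
  · simp [← TensorProduct.tmul_smul, ← TensorProduct.tmul_sum]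

/-- The coordinates of a colinear map from the regular comodule to a direct sum of comodules. -/
theorem isCoordinate_of_hom (hC : ∀ a, IsComatrix k (C a)) (s : Hom (reg k A) (sigmaComod hC))
    (a : σ) : IsCoordinate (fun i => (Finsupp.lapply (⟨a, i⟩ : Σ a, Fin (n a)) :
      ((Σ a, Fin (n a)) →₀ k) →ₗ[k] k) ∘ₗ s.toLinearMap) (C a) := by
  intro m D hD i p q
  have h1 : (sigmaComod hC).coact (s.toLinearMap (D p q)) =
      s.toLinearMap.rTensor A (Coalgebra.comul (D p q)) := LinearMap.congr_fun s.colinear (D p q)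
  have h2 := lapply_coact hC a i (s.toLinearMap (D p q))
  rw [h1, hD.comul] at h2
  have h3 := congrArg (TensorProduct.lid k A) h2
  simp only [map_sum, LinearMap.rTensor_tmul, TensorProduct.lid_tmul, one_smul] at h3
  exact h3

/-- The regular comodule is a quotient of a direct sum of finite dimensional comodules. If it is
projective, it embeds in this sum, and one of the components of the embedding is nonzero. -/
theorem exists_integral_of_isProj [DualQuasiHopfAlgebra k A] (h : (reg k A).IsProj) :
    ∃ T : DualAlg k A, T ≠ 0 ∧ IsRightIntegral T := by
  choose n e C he hC hm _ using fun a : A => exists_isCoeff (M := reg k A) a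
  have hC' := fun a => (hC a).toIsComatrix
  let π := sigmaHom hC' hC
  have hπ : Function.Surjective π.toLinearMap := by
    intro a
    obtain ⟨c, hc⟩ := (Submodule.mem_span_range_iff_exists_fun k).mp (hm a)
    refine ⟨∑ j, Finsupp.single ⟨a, j⟩ (c j), ?_⟩
    rw [map_sum]
    exact (Finset.sum_congr rfl fun j _ => Finsupp.linearCombination_single k (c j) _).trans hc
  obtain ⟨s, hs⟩ := h π hπ (Hom.id _)
  have h1 : DualQuasiBialgebra.one k A ≠ 0 := fun h0 => by
    have := counit_one (k := k) (A := A)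
    rw [h0, map_zero] at this
    exact zero_ne_one this
  by_contra hT
  have h0 (a : A) (i : Fin (n a)) := congrFun (not_not.mp fun h0 => hT
    (exists_integral_of_isCoordinate (hC' a) (isCoordinate_of_hom hC' s a) h0)) i
  have h2 : s.toLinearMap (DualQuasiBialgebra.one k A) = 0 := Finsupp.ext fun x =>
    LinearMap.congr_fun (h0 x.1 x.2) _
  have h3 := LinearMap.congr_fun hs (DualQuasiBialgebra.one k A)
  rw [LinearMap.comp_apply, h2, map_zero] at h3
  exact h1 h3.symm

end Cover

end RightComod
end DualQuasi
end

noncomputable section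
namespace DualQuasi

/-! ### Passing between left and right through `A^{op,cop}` -/

section DualAlgebra

variable {k A : Type u} [Field k] [AddCommGroup A] [Module k A] [Coalgebra k A]

/-- The dual algebra of `A^{op,cop}` is the opposite of that of `A`. -/
def opAlg : DualAlg k A ≃+* (DualAlg k (OpCop A))ᵐᵒᵖ where
  toFun p := MulOpposite.op (WithConv.toConv (p.ofConv ∘ₗ (opEquiv k A).toLinearMap))
  invFun p := WithConv.toConv (p.unop.ofConv ∘ₗ (opEquiv k A).symm.toLinearMap)
  left_inv _ := rfl
  right_inv _ := rfl
  map_mul' p q := congrArg MulOpposite.op (isAnti_opEquiv.mul_comp q.ofConv p.ofConv).symm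
  map_add' _ _ := rfl

theorem symm_smul (p : DualAlg k A) (a : A) :
    (opEquiv k A).symm (p • a) = opAlg p • (opEquiv k A).symm a := by
  have h := (isAnti_opEquiv (k := k) (A := A)).convLeft_comp LinearMap.id p.ofConv
  exact (LinearMap.congr_fun h ((opEquiv k A).symm a)).symm

theorem IsRightCoFrobenius.ofOpCop (h : IsRightCoFrobenius k (OpCop A)) :
    IsLeftCoFrobenius k A := by
  obtain ⟨f, hf⟩ := h
  refine ⟨{ toFun := fun a => opAlg.symm (MulOpposite.op (f ((opEquiv k A).symm a)))
            map_add' := fun x y => by simp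
            map_smul' := fun p a => ?_ }, fun x y hxy => ?_⟩
  · rw [symm_smul, map_smul, RingHom.id_apply, smul_eq_mul]
    apply opAlg.injective
    rw [map_mul, RingEquiv.apply_symm_apply, RingEquiv.apply_symm_apply]
    rfl
  · exact (opEquiv k A).symm.injective (hf (MulOpposite.op_injective (opAlg.symm.injective hxy)))

theorem IsLeftCoFrobenius.isLeftQcF (h : IsLeftCoFrobenius k A) : IsLeftQcF k A := by
  obtain ⟨f, hf⟩ := h
  exact ⟨PUnit, (Finsupp.lsingle PUnit.unit).comp f, (Finsupp.single_injective _).comp hf⟩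

theorem IsLeftQcF.opCop (h : IsLeftQcF k A) : IsRightQcF k (OpCop A) := by
  obtain ⟨ι, f, hf⟩ := h
  let o : DualAlg k A →+ DualAlg k (OpCop A) :=
    (MulOpposite.opAddEquiv.symm : (DualAlg k (OpCop A))ᵐᵒᵖ ≃+ _).toAddMonoidHom.comp
      (opAlg (k := k) (A := A)).toAddMonoidHom
  have ho : Function.Injective o := MulOpposite.unop_injective.comp opAlg.injective
  refine ⟨ι, { toFun := fun a => Finsupp.mapRange.addMonoidHom o (f (opEquiv k A a))
               map_add' := fun x y => by rw [map_add, map_add, map_add]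
               map_smul' := fun p a => ?_ }, ?_⟩
  · obtain ⟨p, rfl⟩ := opAlg.surjective p
    have h : opEquiv k A (opAlg p • a) = p • opEquiv k A a :=
      (congrArg (opEquiv k A) (symm_smul p (opEquiv k A a))).symm
    rw [h, map_smul]
    ext1 i
    exact congrArg MulOpposite.unop (map_mul opAlg p (f (opEquiv k A a) i))
  · exact (Finsupp.mapRange_injective o (map_zero o) ho).comp (hf.comp (opEquiv k A).injective)

variable [DualQuasiBialgebra k A]

theorem exists_rightIntegral_opCop : (∃ T : DualAlg k (OpCop A), T ≠ 0 ∧ IsRightIntegral T) ↔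
    ∃ T : DualAlg k A, T ≠ 0 ∧ IsLeftIntegral T := by
  constructor
  · rintro ⟨T, hT0, hT⟩
    refine ⟨opAlg.symm (MulOpposite.op T), by simpa using hT0, fun p => opAlg.injective ?_⟩
    rw [map_mul, RingEquiv.apply_symm_apply]
    exact congrArg MulOpposite.op (hT (opAlg p).unop)
  · rintro ⟨T, hT0, hT⟩
    refine ⟨(opAlg T).unop, by simpa using hT0, fun p => ?_⟩
    have := congrArg (fun x => (opAlg x).unop) (hT (opAlg.symm (MulOpposite.op p)))
    simp only [map_mul, RingEquiv.apply_symm_apply] at this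
    exact this

theorem exists_leftIntegral_opCop : (∃ T : DualAlg k (OpCop A), T ≠ 0 ∧ IsLeftIntegral T) ↔
    ∃ T : DualAlg k A, T ≠ 0 ∧ IsRightIntegral T := by
  constructor
  · rintro ⟨T, hT0, hT⟩
    refine ⟨opAlg.symm (MulOpposite.op T), by simpa using hT0, fun p => opAlg.injective ?_⟩
    rw [map_mul, RingEquiv.apply_symm_apply]
    exact congrArg MulOpposite.op (hT (opAlg p).unop)
  · rintro ⟨T, hT0, hT⟩
    refine ⟨(opAlg T).unop, by simpa using hT0, fun p => ?_⟩
    have := congrArg (fun x => (opAlg x).unop) (hT (opAlg.symm (MulOpposite.op p)))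
    simp only [map_mul, RingEquiv.apply_symm_apply] at this
    exact this

end DualAlgebra

/-! ### Left comodules over `A` and right comodules over `A^{op,cop}` -/

section Flip

variable {k A : Type u} [Field k] [AddCommGroup A] [Module k A]

/-- The flip `a ⊗ v ↦ v ⊗ a`. -/
def flipCoact (k A V : Type u) [Field k] [AddCommGroup A] [Module k A] [AddCommGroup V]
    [Module k V] : A ⊗[k] V ≃ₗ[k] V ⊗[k] OpCop A :=
  TensorProduct.comm k A V ≪≫ₗ TensorProduct.congr (LinearEquiv.refl k V) (opEquiv k A).symm

@[simp]
theorem flipCoact_tmul {V : Type u} [AddCommGroup V] [Module k V] (a : A) (v : V) :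
    flipCoact k A V (a ⊗ₜ v) = v ⊗ₜ (opEquiv k A).symm a := rfl

theorem flipCoact_lTensor {V W : Type u} [AddCommGroup V] [Module k V] [AddCommGroup W]
    [Module k W] (f : V →ₗ[k] W) (x : A ⊗[k] V) :
    flipCoact k A W (f.lTensor A x) = f.rTensor (OpCop A) (flipCoact k A V x) := by
  induction x with
  | zero => simp
  | tmul a v => simp
  | add x y hx hy => simp only [map_add, hx, hy]

/-- The flip `(a ⊗ b) ⊗ v ↦ v ⊗ (b ⊗ a)`. -/
def flipCoactTwo (k A V : Type u) [Field k] [AddCommGroup A] [Module k A] [AddCommGroup V]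
    [Module k V] : (A ⊗[k] A) ⊗[k] V ≃ₗ[k] V ⊗[k] (OpCop A ⊗[k] OpCop A) :=
  TensorProduct.congr (TensorProduct.congr (opEquiv k A).symm (opEquiv k A).symm ≪≫ₗ
    TensorProduct.comm k _ _) (LinearEquiv.refl k V) ≪≫ₗ
    TensorProduct.comm k (OpCop A ⊗[k] OpCop A) V

theorem assoc_flipCoact {V : Type u} [AddCommGroup V] [Module k V] (ρ : V →ₗ[k] A ⊗[k] V)
    (x : A ⊗[k] V) : TensorProduct.assoc k V (OpCop A) (OpCop A)
      (((flipCoact k A V).toLinearMap ∘ₗ ρ).rTensor (OpCop A) (flipCoact k A V x)) =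
    flipCoactTwo k A V ((TensorProduct.assoc k A A V).symm (ρ.lTensor A x)) := by
  induction x with
  | zero => simp
  | tmul a v =>
    simp only [flipCoact_tmul, LinearMap.rTensor_tmul, LinearMap.lTensor_tmul,
      LinearMap.comp_apply, LinearEquiv.coe_coe]
    generalize ρ v = y
    induction y with
    | zero => simp
    | tmul b w => simp [flipCoactTwo]
    | add x y hx hy => simp only [map_add, TensorProduct.add_tmul, TensorProduct.tmul_add, hx, hy]
  | add x y hx hy => simp only [map_add, hx, hy]

end Flip

section Comodules

variable {k A : Type u} [Field k] [AddCommGroup A] [Module k A] [Coalgebra k A]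

theorem lTensor_comul_flipCoact {V : Type u} [AddCommGroup V] [Module k V] (x : A ⊗[k] V) :
    (Coalgebra.comul (R := k)).lTensor V (flipCoact k A V x) =
    flipCoactTwo k A V ((Coalgebra.comul (R := k)).rTensor V x) := by
  induction x with
  | zero => simp
  | tmul a v =>
    have h := (isAnti_opEquiv_symm (k := k) (A := A)).comul_apply a
    simp only [LinearEquiv.coe_coe] at h
    simp only [flipCoact_tmul, LinearMap.lTensor_tmul, h]
    rfl
  | add x y hx hy => simp only [map_add, hx, hy]

/-- A coaction of `A` from the left is the same as a coaction of `A^{op,cop}` from the right. -/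
theorem coassoc_flip_iff {V : Type u} [AddCommGroup V] [Module k V] (ρ : V →ₗ[k] A ⊗[k] V) :
    (TensorProduct.assoc k V (OpCop A) (OpCop A)).toLinearMap ∘ₗ
      ((flipCoact k A V).toLinearMap ∘ₗ ρ).rTensor (OpCop A) ∘ₗ (flipCoact k A V).toLinearMap ∘ₗ ρ =
      (Coalgebra.comul (R := k) (A := OpCop A)).lTensor V ∘ₗ (flipCoact k A V).toLinearMap ∘ₗ ρ ↔
    (TensorProduct.assoc k A A V).toLinearMap ∘ₗ
      (Coalgebra.comul (R := k) (A := A)).rTensor V ∘ₗ ρ = ρ.lTensor A ∘ₗ ρ := by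
  rw [LinearMap.ext_iff, LinearMap.ext_iff]
  refine forall_congr' fun v => ?_
  have h1 := assoc_flipCoact ρ (ρ v)
  have h2 := lTensor_comul_flipCoact (ρ v)
  refine (Eq.congr h1 h2).trans (((flipCoactTwo k A V).injective.eq_iff
    (a := (TensorProduct.assoc k A A V).symm (ρ.lTensor A (ρ v)))
    (b := (Coalgebra.comul (R := k)).rTensor V (ρ v))).trans ?_)
  rw [LinearEquiv.symm_apply_eq]
  exact eq_comm

theorem counit_flip {V : Type u} [AddCommGroup V] [Module k V] (ρ : V →ₗ[k] A ⊗[k] V) :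
    (TensorProduct.rid k V).toLinearMap ∘ₗ (Coalgebra.counit (R := k) (A := OpCop A)).lTensor V ∘ₗ
      (flipCoact k A V).toLinearMap ∘ₗ ρ =
    (TensorProduct.lid k V).toLinearMap ∘ₗ (Coalgebra.counit (R := k) (A := A)).rTensor V ∘ₗ ρ := by
  refine LinearMap.ext fun v => ?_
  simp only [LinearMap.comp_apply, LinearEquiv.coe_coe]
  generalize ρ v = x
  induction x with
  | zero => simp
  | tmul a v => simp [← op_counit]
  | add x y hx hy => simp only [map_add, hx, hy]

variable (k A) in
/-- A left comodule over `A` as a right comodule over `A^{op,cop}`. -/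
def toOpCop : LeftComod k A ⥤ RightComod k (OpCop A) where
  obj M :=
    { carrier := M.carrier
      coact := (flipCoact k A M.carrier).toLinearMap ∘ₗ M.coact
      coassoc := (coassoc_flip_iff M.coact).mpr M.coassoc
      counit_coact := (counit_flip M.coact).trans M.counit_coact }
  map {M N} f := RightComod.Hom.mk (LeftComod.Hom.toLinearMap f) <| LinearMap.ext fun m =>
    (congrArg (flipCoact k A N.carrier) (LinearMap.congr_fun (LeftComod.Hom.colinear f) m)).trans
      (flipCoact_lTensor _ _)

instance : (toOpCop k A).Faithful where
  map_injective h := LeftComod.Hom.ext (congrArg RightComod.Hom.toLinearMap h)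

instance : (toOpCop k A).Full where
  map_surjective {M N} f := by
    refine ⟨LeftComod.Hom.mk (RightComod.Hom.toLinearMap f) <| LinearMap.ext fun m =>
      (flipCoact k A N.carrier).injective ?_, rfl⟩
    exact (LinearMap.congr_fun (RightComod.Hom.colinear f) m).trans (flipCoact_lTensor _ _).symm

instance : (toOpCop k A).EssSurj where
  mem_essImage N := by
    let ρ : N.carrier →ₗ[k] A ⊗[k] N.carrier :=
      (flipCoact k A N.carrier).symm.toLinearMap ∘ₗ N.coact
    have hρ : (flipCoact k A N.carrier).toLinearMap ∘ₗ ρ = N.coact :=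
      LinearMap.ext fun v => (flipCoact k A N.carrier).apply_symm_apply _
    let M : LeftComod k A :=
      { carrier := N.carrier
        coact := ρ
        coassoc := (coassoc_flip_iff ρ).mp (by rw [hρ]; exact N.coassoc)
        counit_coact := by rw [← counit_flip, hρ]; exact N.counit_coact }
    have h1 : N.coact ∘ₗ LinearMap.id = LinearMap.id.rTensor (OpCop A) ∘ₗ
        (flipCoact k A N.carrier).toLinearMap ∘ₗ ρ := by simp [hρ]
    have h2 : ((flipCoact k A N.carrier).toLinearMap ∘ₗ ρ) ∘ₗ LinearMap.id =
        LinearMap.id.rTensor (OpCop A) ∘ₗ N.coact := by simp [hρ]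
    let f : (toOpCop k A).obj M ⟶ N := RightComod.Hom.mk LinearMap.id h1
    let g : N ⟶ (toOpCop k A).obj M := RightComod.Hom.mk LinearMap.id h2
    exact ⟨M, ⟨⟨f, g, rfl, rfl⟩⟩⟩

instance : (toOpCop k A).IsEquivalence where

theorem comul_symm (a : A) : Coalgebra.comul ((opEquiv k A).symm a) =
    (opEquiv k A).symm.toLinearMap.rTensor (OpCop A) (flipCoact k A A (Coalgebra.comul a)) := by
  refine ((isAnti_opEquiv_symm (k := k) (A := A)).comul_apply a).trans ?_
  generalize Coalgebra.comul (R := k) a = x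
  induction x with
  | zero => simp
  | tmul a v => simp
  | add x y hx hy => simp only [map_add, hx, hy]

theorem flipCoact_comul : ((flipCoact k A A).toLinearMap ∘ₗ Coalgebra.comul) ∘ₗ
    (opEquiv k A).toLinearMap = (opEquiv k A).toLinearMap.rTensor (OpCop A) ∘ₗ Coalgebra.comul := by
  refine LinearMap.ext fun x => ?_
  refine Eq.trans ?_ (congrArg (LinearMap.rTensor _ _) (comul_symm (opEquiv k A x))).symm
  rw [← LinearMap.rTensor_comp_apply, LinearEquiv.comp_symm, LinearMap.rTensor_id]
  rfl

variable (k A) in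
/-- The regular left comodule of `A` is the regular right comodule of `A^{op,cop}`. -/
def regularIso : (toOpCop k A).obj (LeftComod.regular k A) ≅ RightComod.regular k (OpCop A) where
  hom :=
    RightComod.Hom.mk (show A →ₗ[k] OpCop A from (opEquiv k A).symm.toLinearMap)
      (LinearMap.ext fun a : A => comul_symm a)
  inv :=
    RightComod.Hom.mk (show OpCop A →ₗ[k] A from (opEquiv k A).toLinearMap)
      (flipCoact_comul (k := k) (A := A))
  hom_inv_id := rfl
  inv_hom_id := rfl

theorem isRightSemiperfect_opCop : IsRightSemiperfect k (OpCop A) ↔ IsLeftSemiperfect k A :=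
  (Equivalence.enoughProjectives_iff (toOpCop k A).asEquivalence).symm

theorem projective_regular_opCop : Projective (RightComod.regular k (OpCop A)) ↔
    Projective (LeftComod.regular k A) :=
  ⟨fun h => ((toOpCop k A).asEquivalence.map_projective_iff _).mp
      (Projective.of_iso (regularIso k A).symm h),
    fun h => Projective.of_iso (regularIso k A)
      (((toOpCop k A).asEquivalence.map_projective_iff _).mpr h)⟩

theorem isSeparator_of_iso {𝒞 : Type*} [Category 𝒞] {G H : 𝒞} (i : G ≅ H) (h : IsSeparator G) :
    IsSeparator H := by
  rw [isSeparator_def]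
  intro X Y f g hfg
  refine h.def f g fun l => ?_
  rw [← cancel_epi i.inv, ← Category.assoc, ← Category.assoc, hfg]

theorem isSeparator_regular_opCop : IsSeparator (RightComod.regular k (OpCop A)) ↔
    IsSeparator (LeftComod.regular k A) := by
  refine ⟨fun h => ?_, fun h => isSeparator_of_iso (regularIso k A)
    (h.of_equivalence (toOpCop k A).asEquivalence)⟩
  exact isSeparator_of_iso ((toOpCop k A).asEquivalence.unitIso.app _).symm
    ((isSeparator_of_iso (regularIso k A).symm h).of_equivalence (toOpCop k A).asEquivalence.symm)

end Comodules

end DualQuasi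
end

noncomputable section
namespace DualQuasi

/-! ### The implications for right comodules -/

section Right

variable {k A : Type u} [Field k] [AddCommGroup A] [Module k A] [Coalgebra k A]
  [DualQuasiHopfAlgebra k A]

/-- The step which connects the two sides: a module embedding for the right `A^*`-module structure
gives a balanced form, whose coordinates in the second variable are colinear for the left comodule
structure, that is, for the right comodule structure over `A^{op,cop}`. -/
theorem exists_leftIntegral_of_isRightQcF (h : IsRightQcF k A) :
    ∃ T : DualAlg k A, T ≠ 0 ∧ IsLeftIntegral T := by
  have : Nontrivial A := ⟨⟨DualQuasiBialgebra.one k A, 0, fun h0 => by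
    have := counit_one (k := k) (A := A)
    rw [h0, map_zero] at this
    exact zero_ne_one this⟩⟩
  obtain ⟨B, hB, hB0⟩ := exists_balanced_of_isRightQcF h
  obtain ⟨n, C, f, hC, hf0, hf⟩ := hB.exists_coordinate hB0
  have hf' : IsCoordinate (fun i => f i ∘ₗ (opEquiv k A).toLinearMap)
      fun i j => (opEquiv k A).symm (C j i) := fun m D hD i p q =>
    (opEquiv k A).injective (by simpa using hf m _ hD.ofOpCop i p q)
  refine exists_rightIntegral_opCop.mp (exists_integral_of_isCoordinate
    (hC.anti isAnti_opEquiv_symm) hf' fun h0 => hf0 (funext fun i => ?_))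
  exact LinearMap.ext fun a => LinearMap.congr_fun (congrFun h0 i) ((opEquiv k A).symm a)

theorem isRightCoFrobenius_of_integral (h : ∃ T : DualAlg k A, T ≠ 0 ∧ IsRightIntegral T) :
    IsRightCoFrobenius k A := by
  obtain ⟨B, hB, hi⟩ := exists_balanced_of_integral h
  exact isRightCoFrobenius_of_balanced hB hi

theorem isSeparator_of_integral (h : ∃ T : DualAlg k A, T ≠ 0 ∧ IsRightIntegral T) :
    IsSeparator (RightComod.regular k A) := by
  obtain ⟨B, hB, hi⟩ := exists_balanced_of_integral h
  exact RightComod.isSeparator_regular hB hi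

theorem isRightSemiperfect_of_integral (h : ∃ T : DualAlg k A, T ≠ 0 ∧ IsRightIntegral T) :
    IsRightSemiperfect k A := by
  obtain ⟨B, hB, hi⟩ := exists_balanced_of_integral h
  exact RightComod.isRightSemiperfect_of_balanced hB hi

theorem exists_integral_of_projective (h : Projective (RightComod.regular k A)) :
    ∃ T : DualAlg k A, T ≠ 0 ∧ IsRightIntegral T :=
  RightComod.exists_integral_of_isProj (RightComod.projective_iff.mp h)

end Right

end DualQuasi
end

theorem theorem4p5 (k A : Type u) [Field k] [AddCommGroup A] [Module k A] [Coalgebra k A]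
    [DualQuasi.DualQuasiHopfAlgebra k A] :
    List.TFAE [
      ∃ T : DualQuasi.DualAlg k A, T ≠ 0 ∧ DualQuasi.IsLeftIntegral T,
      DualQuasi.IsLeftCoFrobenius k A,
      DualQuasi.IsLeftQcF k A,
      DualQuasi.IsLeftSemiperfect k A,
      ∃ T : DualQuasi.DualAlg k A, T ≠ 0 ∧ DualQuasi.IsRightIntegral T,
      DualQuasi.IsRightCoFrobenius k A,
      DualQuasi.IsRightQcF k A,
      DualQuasi.IsRightSemiperfect k A,
      IsSeparator (DualQuasi.LeftComod.regular k A),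
      IsSeparator (DualQuasi.RightComod.regular k A),
      Projective (DualQuasi.LeftComod.regular k A),
      Projective (DualQuasi.RightComod.regular k A)] := by
  open DualQuasi in
  tfae_have 5 → 6 := isRightCoFrobenius_of_integral
  tfae_have 6 → 7 := IsRightCoFrobenius.isRightQcF
  tfae_have 7 → 1 := exists_leftIntegral_of_isRightQcF
  tfae_have 5 → 10 := isSeparator_of_integral
  tfae_have 10 → 5 := RightComod.exists_integral_of_isSeparator
  tfae_have 5 → 8 := isRightSemiperfect_of_integral
  tfae_have 8 → 12 := RightComod.projective_regular_of_semiperfect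
  tfae_have 12 → 5 := exists_integral_of_projective
  tfae_have 1 → 2 := fun h =>
    (isRightCoFrobenius_of_integral (exists_rightIntegral_opCop.mpr h)).ofOpCop
  tfae_have 2 → 3 := IsLeftCoFrobenius.isLeftQcF
  tfae_have 3 → 5 := fun h =>
    exists_leftIntegral_opCop.mp (exists_leftIntegral_of_isRightQcF h.opCop)
  tfae_have 1 → 9 := fun h =>
    isSeparator_regular_opCop.mp (isSeparator_of_integral (exists_rightIntegral_opCop.mpr h))
  tfae_have 9 → 1 := fun h => exists_rightIntegral_opCop.mp
    (RightComod.exists_integral_of_isSeparator (isSeparator_regular_opCop.mpr h))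
  tfae_have 1 → 4 := fun h => isRightSemiperfect_opCop.mp
    (isRightSemiperfect_of_integral (exists_rightIntegral_opCop.mpr h))
  tfae_have 4 → 11 := fun h => projective_regular_opCop.mp
    (RightComod.projective_regular_of_semiperfect (isRightSemiperfect_opCop.mpr h))
  tfae_have 11 → 1 := fun h => exists_rightIntegral_opCop.mp
    (exists_integral_of_projective (projective_regular_opCop.mpr h))
  tfae_finish
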